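/- **Conventions.** All mapping objects are simplicial sets and operads are symmetric operads in simplicial sets, with spaces of operations $O(n)$ for all $n\ge 0$ and no condition on $O(0)$ or $O(1)$. A map of operads is a weak equivalence if each $O(n)\to O'(n)$ is a weak equivalence of simplicial sets; the homotopy category of operads is the localization of the category of operads at these maps. A *tensor model category* is a model category $\mathcal D$ with a monoidal product $\otimes$ which satisfies the pushout product axiom, whose product with an initial object (in either variable) is initial, and such that $c\otimes-$ and $-\otimes c$ preserve weak equivalences if $c$ is cofibrant. An *operadic model category* is a simplicial model category $\mathcal D$ with a symmetric monoidal structure $(\otimes,\mathbb I)$ making it a tensor model category, such that: the product extends to maps $\mathrm{Map}(x,y)\times\mathrm{Map}(x',y')\to\mathrm{Map}(x\otimes x',y\otimes y')$, compatible with composition and with the associativity, unit and symmetry isomorphisms; for every finite simplicial set $K$ the resulting canonical maps from the simplicial tensor $K\cdot x$ to $(K\cdot\mathbb I)\otimes x$ and $x\otimes(K\cdot\mathbb I)$ are isomorphisms; and $\mathrm{Map}(\mathbb I,-)$ preserves fibrations and trivial fibrations. The endomorphism operad of $x\in\mathcal D$ is $\mathrm{End}_{\mathcal D}(x)(n)=\mathrm{Map}(x^{\otimes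 n},x)$, and for a map $p\colon y\to z$ the operad $\mathrm{End}_{\mathcal D}(p)$ has $$\mathrm{End}_{\mathcal D}(p)(n)=\mathrm{Map}(y^{\otimes n},y)\times_{\mathrm{Map}(y^{\otimes n},z)}\mathrm{Map}(z^{\otimes n},z).$$ An *operadic Quillen adjunction* $L\colon\mathcal D\rightleftarrows\mathcal D'\colon R$ between operadic model categories is a Quillen adjunction which is a simplicial adjunction of simplicial functors, together with a lax symmetric monoidal structure on $R$ which is natural with respect to all simplices of the mapping spaces, such that the induced map $L(a\otimes b)\to La\otimes Lb$ is a weak equivalence for cofibrant $a,b$, and such that $L(\mathbb I_c)\to L(\mathbb I)\to\mathbb I'$ is a weak equivalence for some weak equivalence $\mathbb I_c\to\mathbb I$ with $\mathbb I_c$ cofibrant. It is an *operadic Quillen equivalence* if, moreover, it is a Quillen equivalence: for cofibrant $a\in\mathcal D$ and fibrant $b\in\mathcal D'$, a map $a\to Rb$ is a weak equivalence if and only if its adjoint $La\to b$ is one. **Proposition.** Let $L\colon\mathcal D\rightleftarrows\mathcal D'\colon R$ be an operadic Quillen adjunction, let $y\in\mathcal D$ and $x\in\mathcal D'$ be objects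 which are both cofibrant and fibrant, and let $f\colon y\to Rx$ be a weak equivalence. Then $f$ induces a map $$\varphi\colon \mathrm{End}_{\mathcal D'}(x)\longrightarrow\mathrm{End}_{\mathcal D}(y)$$ in the homotopy category of operads. Precisely, there is a unique $\varphi$ with the following property: for every factorization of $f$ as a trivial cofibration $j\colon y\to z$ followed by a fibration $p\colon z\to Rx$, the projections $\mathrm{End}_{\mathcal D}(p)\to\mathrm{End}_{\mathcal D}(Rx)$ and $\mathrm{End}_{\mathcal D}(j)\to\mathrm{End}_{\mathcal D}(z)$ are weak equivalences of operads, and $\varphi$ is represented by the zigzag $$\mathrm{End}_{\mathcal D'}(x)\to\mathrm{End}_{\mathcal D}(Rx)\xleftarrow{\ \sim\ }\mathrm{End}_{\mathcal D}(p)\to\mathrm{End}_{\mathcal D}(z)\xleftarrow{\ \sim\ }\mathrm{End}_{\mathcal D}(j)\to\mathrm{End}_{\mathcal D}(y),$$ whose first map is induced by the lax monoidal simplicial functor $R$. (If $f$ is itself a trivial fibration, one may take $j=\mathrm{id}_y$, and $\varphi$ is the zigzag $\mathrm{End}_{\mathcal D'}(x)\to\mathrm{End}_{\mathcal D}(Rx)\xleftarrow{\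 \sim\ }\mathrm{End}_{\mathcal D}(f)\to\mathrm{End}_{\mathcal D}(y)$.) If, in addition, the adjunction is an operadic Quillen equivalence, then $\varphi$ is an isomorphism in the homotopy category of operads. -/

import Mathlib

open CategoryTheory MonoidalCategory

universe v v' u u'

namespace OperadicModel

section Swap
variable {C : Type u} [Category.{v} C] [MonoidalCategory C] [SymmetricCategory C]

/-- The symmetry exchanging the first two factors of `A ⊗ (B ⊗ Z)`. -/
def swap (A B Z : C) : A ⊗ (B ⊗ Z) ⟶ B ⊗ (A ⊗ Z) :=
  (α_ A B Z).inv ≫ (β_ A B).hom ▷ Z ≫ (α_ B A Z).hom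

lemma swap_swap (A B Z : C) : swap A B Z ≫ swap B A Z = 𝟙 _ := by
  simp [swap, ← comp_whiskerRight_assoc]

lemma swap_nat {A A' B B' Z Z' : C} (f : A ⟶ A') (g : B ⟶ B') (h : Z ⟶ Z') :
    (f ⊗ₘ (g ⊗ₘ h)) ≫ swap A' B' Z' = swap A B Z ≫ (g ⊗ₘ (f ⊗ₘ h)) := by
  simp only [swap, associator_inv_naturality_assoc, Category.assoc, ← associator_naturality]
  simp only [← tensorHom_id, tensorHom_comp_tensorHom_assoc,
    BraidedCategory.braiding_naturality, Category.id_comp, Category.comp_id]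

lemma swap_nat_right (A B : C) {Z Z' : C} (h : Z ⟶ Z') :
    A ◁ (B ◁ h) ≫ swap A B Z' = swap A B Z ≫ B ◁ (A ◁ h) := by
  simpa using swap_nat (𝟙 A) (𝟙 B) h

lemma swap_yang_baxter (A B D Z : C) :
    swap A B (D ⊗ Z) ≫ B ◁ swap A D Z ≫ swap B D (A ⊗ Z) =
      A ◁ swap B D Z ≫ swap A D (B ⊗ Z) ≫ D ◁ swap A B Z := by
  calc
    _ = 𝟙 _ ⊗≫ ((β_ A B).hom ▷ D ⊗≫ B ◁ (β_ A D).hom ⊗≫ (β_ B D).hom ▷ A) ▷ Z ⊗≫ 𝟙 _ := by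
      simp only [swap]; monoidal
    _ = _ := by
      rw [BraidedCategory.yang_baxter']
      simp only [swap]; monoidal

lemma swap_tensor_left (a A B R : C) :
    a ◁ swap A B R ≫ swap a B (A ⊗ R) ≫ B ◁ (α_ a A R).inv = (α_ a A (B ⊗ R)).inv ≫
      swap (a ⊗ A) B R := by
  simp only [swap, BraidedCategory.braiding_tensor_left_hom]
  monoidal

lemma swap_tensor_right (a b B R : C) :
    swap a b (B ⊗ R) ≫ b ◁ swap a B R ≫ (α_ b B (a ⊗ R)).inv = a ◁ (α_ b B R).inv ≫
      swap a (b ⊗ B) R := by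
  simp only [swap, BraidedCategory.braiding_tensor_right_hom]
  monoidal

lemma swap_whisker (a b T R : C) :
    swap a b (T ⊗ R) ≫ b ◁ (α_ a T R).inv ≫ (α_ b (a ⊗ T) R).inv =
      a ◁ (α_ b T R).inv ≫ (α_ a (b ⊗ T) R).inv ≫ swap a b T ▷ R := by
  simp only [swap]
  monoidal

lemma swap_unit_left (B R : C) : (λ_ (B ⊗ R)).inv ≫ swap (𝟙_ C) B R = B ◁ (λ_ R).inv := by
  simp only [swap, braiding_tensorUnit_left]
  monoidal

lemma swap_unit_right (a R : C) : a ◁ (λ_ R).inv ≫ swap a (𝟙_ C) R = (λ_ (a ⊗ R)).inv := by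
  simp only [swap, braiding_tensorUnit_right]
  monoidal

end Swap

section Monoidal
variable {C : Type u} [Category.{v} C] [MonoidalCategory C]

lemma tensor_split_left {A B D E F G : C} (f : A ⟶ B ⊗ D) (g : D ⟶ E) (h : F ⟶ G) :
    ((f ≫ B ◁ g) ⊗ₘ h) = f ▷ F ≫ (α_ B D F).hom ≫ B ◁ (g ⊗ₘ h) ≫ (α_ B E G).inv := by
  simp only [MonoidalCategory.tensorHom_def]
  monoidal

lemma tensor_split_right (A : C) {B D E : C} (f : B ⟶ D) (g : D ⟶ E) :
    A ◁ f ≫ A ◁ (λ_ D).inv ≫ (α_ A (𝟙_ C) D).inv ≫ (A ⊗ 𝟙_ C) ◁ g =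
      ((ρ_ A).inv ⊗ₘ (f ≫ g)) := by
  simp only [MonoidalCategory.tensorHom_def]
  monoidal

end Monoidal

section Tens
variable {C : Type u} [Category.{v} C] [MonoidalCategory C]

/-- The tensor product `X a₁ ⊗ (X a₂ ⊗ (⋯ ⊗ 𝟙))` of a family of objects along a list of indices. -/
@[reducible] def tens {ι : Type} (X : ι → C) : List ι → C
  | [] => 𝟙_ C
  | a :: l => X a ⊗ tens X l

/-- `Ins a t l`: a way of inserting `a` in the list `t` so as to obtain `l`. -/
inductive Ins {ι : Type} (a : ι) : List ι → List ι → Type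
  | here (t : List ι) : Ins a t (a :: t)
  | there (b : ι) {t l : List ι} (s : Ins a t l) : Ins a (b :: t) (b :: l)

/-- `Shuf σ l m`: a way of writing `m` as a rearrangement of the image of `l` under `σ`. -/
inductive Shuf {ι κ : Type} (σ : ι → κ) : List ι → List κ → Type
  | nil : Shuf σ [] []
  | cons {a : ι} {t : List ι} {u l : List κ} (s : Ins (σ a) u l) (p : Shuf σ t u) :
      Shuf σ (a :: t) l

variable [SymmetricCategory C]

/-- The morphism moving the first factor to the place prescribed by an insertion. -/
def Ins.ten {ι : Type} (X : ι → C) {a : ι} :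
    {t l : List ι} → Ins a t l → (X a ⊗ tens X t ⟶ tens X l)
  | _, _, .here _ => 𝟙 _
  | _, _, .there (t := t) b s => swap (X a) (X b) (tens X t) ≫ X b ◁ s.ten X

/-- The morphism of tensor products which applies `g i` to the `i`-th factor and which
rearranges the factors. -/
def Shuf.ten {ι κ : Type} {σ : ι → κ} {Y : ι → C} {X : κ → C} (g : ∀ i, Y i ⟶ X (σ i)) :
    {l : List ι} → {m : List κ} → Shuf σ l m → (tens Y l ⟶ tens X m)
  | _, _, .nil => 𝟙 _
  | _, _, .cons (a := a) s p => (g a ⊗ₘ p.ten g) ≫ s.ten X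

lemma Ins.exchange {ι : Type} (X : ι → C) {b c : ι} {t w l : List ι}
    (s0 : Ins b t w) (s1 : Ins c w l) :
    ∃ (u : List ι) (s2 : Ins c t u) (s3 : Ins b u l),
      X c ◁ s0.ten X ≫ s1.ten X = swap _ _ _ ≫ X b ◁ s2.ten X ≫ s3.ten X := by
  induction s1 generalizing t with
  | here w =>
    refine ⟨_, .here t, .there c s0, ?_⟩
    have := swap_swap (X c) (X b) (tens X t)
    simp only [Ins.ten, Category.comp_id, MonoidalCategory.whiskerLeft_id, Category.id_comp]
    rw [← Category.assoc, this, Category.id_comp]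
  | there e s1' ih =>
    cases s0 with
    | here =>
      refine ⟨_, s1', .here _, ?_⟩
      simp [Ins.ten]
    | there _ s0'' =>
      obtain ⟨u, s2, s3, h⟩ := ih s0''
      refine ⟨_, .there e s2, .there e s3, ?_⟩
      simp only [Ins.ten, MonoidalCategory.whiskerLeft_comp, Category.assoc]
      have h1 := swap_nat_right (X c) (X e) (s0''.ten X)
      have h2 := swap_nat_right (X b) (X e) (s2.ten X)
      have h3 := congrArg (fun k => X e ◁ k) h
      simp only [MonoidalCategory.whiskerLeft_comp] at h3
      rw [reassoc_of% h1, h3, reassoc_of% h2]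
      have h5 := congrArg (fun k => k ≫ X e ◁ X b ◁ s2.ten X ≫ X e ◁ s3.ten X)
        (swap_yang_baxter (X c) (X b) (X e) (tens X _))
      simp only [Category.assoc] at h5
      exact h5.symm

lemma Ins.split {κ μ : Type} {τ : κ → μ} {Y : κ → C} {X : μ → C} (h : ∀ i, Y i ⟶ X (τ i))
    {b : κ} {u m : List κ} {n : List μ} (s : Ins b u m) (q : Shuf τ m n) :
    ∃ (v : List μ) (s' : Ins (τ b) v n) (q' : Shuf τ u v),
      s.ten Y ≫ q.ten h = (h b ⊗ₘ q'.ten h) ≫ s'.ten X := by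
  induction s generalizing n with
  | here u =>
    cases q with
    | cons s' q' => exact ⟨_, s', q', by simp [Ins.ten, Shuf.ten]⟩
  | there c s0 ih =>
    cases q with
    | cons s1 q1 =>
      obtain ⟨v0, s0', q0, e0⟩ := ih q1
      obtain ⟨v, s2, s3, e1⟩ := Ins.exchange X s0' s1
      refine ⟨v, s3, .cons s2 q0, ?_⟩
      have h1 := swap_nat (h b) (h c) (q0.ten h)
      simp only [Ins.ten, Shuf.ten, Category.assoc]
      have e2 : Y c ◁ s0.ten Y ≫ (h c ⊗ₘ q1.ten h) =
          (h c ⊗ₘ (h b ⊗ₘ q0.ten h)) ≫ X (τ c) ◁ s0'.ten X := by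
        rw [← id_tensorHom, ← id_tensorHom, tensorHom_comp_tensorHom, tensorHom_comp_tensorHom, e0]
        simp
      have h2 := swap_swap (X (τ b)) (X (τ c)) (tens X v0)
      rw [reassoc_of% e2, e1, ← reassoc_of% h1, reassoc_of% h2]
      rw [show (h b ⊗ₘ (h c ⊗ₘ q0.ten h) ≫ s2.ten X) =
        (h b ⊗ₘ (h c ⊗ₘ q0.ten h)) ≫ X (τ b) ◁ s2.ten X by
          rw [← id_tensorHom, tensorHom_comp_tensorHom]; simp]
      simp

lemma Shuf.comp {ι κ μ : Type} {σ : ι → κ} {τ : κ → μ} {Z : ι → C} {Y : κ → C} {X : μ → C}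
    (g : ∀ i, Z i ⟶ Y (σ i)) (h : ∀ i, Y i ⟶ X (τ i))
    {l : List ι} {m : List κ} {n : List μ} (p : Shuf σ l m) (q : Shuf τ m n) :
    ∃ r : Shuf (fun i => τ (σ i)) l n,
      r.ten (fun i => g i ≫ h (σ i)) = p.ten g ≫ q.ten h := by
  induction p generalizing n with
  | nil => cases q; exact ⟨.nil, by simp [Shuf.ten]⟩
  | cons s p ih =>
    obtain ⟨v, s', q', e⟩ := Ins.split h s q
    obtain ⟨r, hr⟩ := ih q'
    refine ⟨.cons s' r, ?_⟩
    simp only [Shuf.ten, Category.assoc, e, hr]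
    rw [tensorHom_comp_tensorHom_assoc]

lemma Ins.perm {ι : Type} {a : ι} {t l : List ι} (s : Ins a t l) : l.Perm (a :: t) := by
  induction s with
  | here t => exact .refl _
  | there b s ih => exact (ih.cons b).trans (.swap _ _ _)

lemma Ins.unique {ι : Type} {a : ι} {t l : List ι} (s : Ins a t l) (hl : l.Nodup)
    {t' : List ι} (s' : Ins a t' l) :
    (⟨t, s⟩ : Σ t, Ins a t l) = ⟨t', s'⟩ := by
  induction s generalizing t' with
  | here t =>
    cases s' with
    | here => rfl
    | there _ s0 => exact absurd (s0.perm.mem_iff.2 (by simp)) (List.nodup_cons.1 hl).1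
  | there b s ih =>
    cases s' with
    | here => exact absurd (s.perm.mem_iff.2 (by simp)) (List.nodup_cons.1 hl).1
    | there _ s0 =>
      have := ih (List.nodup_cons.1 hl).2 s0
      cases this
      rfl

lemma Shuf.unique {ι κ : Type} {σ : ι → κ} {l : List ι} {m : List κ} (p q : Shuf σ l m)
    (hm : m.Nodup) : p = q := by
  induction p with
  | nil => cases q; rfl
  | cons s p ih =>
    cases q with
    | cons s' q =>
      have := s.unique hm s'
      cases this
      rw [ih q (List.nodup_cons.1 (s.perm.nodup_iff.1 hm)).2]

lemma Ins.exists_of_mem {ι : Type} {a : ι} {l : List ι} (h : a ∈ l) :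
    ∃ t, Nonempty (Ins a t l) := by
  induction l with
  | nil => simp at h
  | cons b l ih =>
    rcases List.mem_cons.1 h with rfl | h
    · exact ⟨_, ⟨.here l⟩⟩
    · obtain ⟨t, ⟨s⟩⟩ := ih h
      exact ⟨_, ⟨.there b s⟩⟩

lemma Shuf.exists_of_perm {ι κ : Type} (σ : ι → κ) {l : List ι} {m : List κ}
    (h : (l.map σ).Perm m) : Nonempty (Shuf σ l m) := by
  induction l generalizing m with
  | nil => rw [List.map_nil, List.nil_perm] at h; subst h; exact ⟨.nil⟩
  | cons a l ih =>
    obtain ⟨t, ⟨s⟩⟩ := Ins.exists_of_mem (h.mem_iff.1 (by simp : σ a ∈ (a :: l).map σ))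
    obtain ⟨p⟩ := ih ((List.perm_cons _).1 (h.trans s.perm))
    exact ⟨.cons s p⟩

/-- The trivial rearrangement of a list. -/
def Shuf.refl {ι : Type} : (l : List ι) → Shuf (fun i : ι => i) l l
  | [] => .nil
  | a :: l => .cons (.here l) (Shuf.refl l)

lemma Shuf.ten_refl {ι : Type} (X : ι → C) (l : List ι) :
    (Shuf.refl l).ten (X := X) (fun i => 𝟙 (X i)) = 𝟙 _ := by
  induction l with
  | nil => rfl
  | cons a l ih => simp [Shuf.refl, Shuf.ten, Ins.ten, ih]


/-- The list of the pairs `⟨i, s⟩` for `s` in a list, followed by another list. -/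
@[reducible] def block {ι : Type} {S : ι → Type} (i : ι) (r : List (Σ i, S i)) :
    List (S i) → List (Σ i, S i)
  | [] => r
  | s :: k => ⟨i, s⟩ :: block i r k

/-- The lexicographic list of pairs of indices. -/
@[reducible] def sigmaList {ι : Type} {S : ι → Type} (m : ∀ i, List (S i)) :
    List ι → List (Σ i, S i)
  | [] => []
  | i :: l => block i (sigmaList m l) (m i)

/-- The associativity isomorphism splitting off a first block of factors. -/
def splitBlock {ι : Type} {S : ι → Type} (X : (Σ i, S i) → C) (i : ι)
    (r : List (Σ i, S i)) : (k : List (S i)) →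
    (tens X (block i r k) ⟶ tens (fun s => X ⟨i, s⟩) k ⊗ tens X r)
  | [] => (λ_ _).inv
  | s :: k => X ⟨i, s⟩ ◁ splitBlock X i r k ≫ (α_ _ _ _).inv

/-- The associativity isomorphism grouping the factors of an iterated tensor product. -/
def splitBlocks {ι : Type} {S : ι → Type} (X : (Σ i, S i) → C) (m : ∀ i, List (S i)) :
    (l : List ι) → (tens X (sigmaList m l) ⟶ tens (fun i => tens (fun s => X ⟨i, s⟩) (m i)) l)
  | [] => 𝟙 _
  | i :: l => splitBlock X i _ (m i) ≫ _ ◁ splitBlocks X m l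

/-- The map of pairs of indices induced by maps of indices. -/
@[reducible] def sigmaMap {ι κ : Type} {S : ι → Type} {S' : κ → Type} (σ : ι → κ)
    (τ : ∀ i, S i → S' (σ i)) (p : Σ i, S i) : Σ i, S' i :=
  ⟨σ p.1, τ p.1 p.2⟩

section Blocks
variable {ι κ : Type} {S : ι → Type} {S' : κ → Type}

lemma Ins.append {X : (Σ i, S i) → C} (i : ι) (R : List (Σ i, S i)) {a : S i} {u k : List (S i)}
    (s : Ins a u k) :
    ∃ s' : Ins (⟨i, a⟩ : Σ i, S i) (block i R u) (block i R k),
      s'.ten X ≫ splitBlock X i R k =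
        X ⟨i, a⟩ ◁ splitBlock X i R u ≫ (α_ _ _ _).inv ≫ s.ten (fun s => X ⟨i, s⟩) ▷ _ := by
  induction s with
  | here t => exact ⟨.here _, by simp [Ins.ten, splitBlock]⟩
  | @there b t l s ih =>
    obtain ⟨s', h⟩ := ih
    refine ⟨.there _ s', ?_⟩
    have h1 := swap_nat_right (X ⟨i, a⟩) (X ⟨i, b⟩) (splitBlock X i R t)
    have h2 := swap_whisker (X ⟨i, a⟩) (X ⟨i, b⟩) (tens (fun s => X ⟨i, s⟩) t) (tens X R)
    have h3 := congrArg (fun k => X ⟨i, b⟩ ◁ k) h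
    simp only [MonoidalCategory.whiskerLeft_comp] at h3
    simp only [Ins.ten, splitBlock, Category.assoc, comp_whiskerRight,
      MonoidalCategory.whiskerLeft_comp]
    rw [reassoc_of% h3, ← reassoc_of% h1, ← reassoc_of% h2]
    simp

lemma Shuf.append {σ : ι → κ} {τ : ∀ i, S i → S' (σ i)} {Y : (Σ i, S i) → C} {X : (Σ i, S' i) → C}
    (g : ∀ p, Y p ⟶ X (sigmaMap σ τ p)) (i : ι) {k : List (S i)} {k' : List (S' (σ i))}
    {R : List (Σ i, S i)} {R' : List (Σ i, S' i)} (q : Shuf (τ i) k k')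
    (r : Shuf (sigmaMap σ τ) R R') :
    ∃ r' : Shuf (sigmaMap σ τ) (block i R k) (block (σ i) R' k'),
      r'.ten g ≫ splitBlock X (σ i) R' k' =
        splitBlock Y i R k ≫
          (q.ten (Y := fun s => Y ⟨i, s⟩) (X := fun s => X ⟨σ i, s⟩) (fun s => g ⟨i, s⟩) ⊗ₘ
            r.ten g) := by
  induction q with
  | nil => exact ⟨r, by simp [Shuf.ten, splitBlock]⟩
  | @cons a t u l s q ih =>
    obtain ⟨r', h⟩ := ih
    obtain ⟨s', h'⟩ := Ins.append (X := X) (σ i) R' s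
    refine ⟨.cons (a := ⟨i, a⟩) s' r', ?_⟩
    have h1 : (g ⟨i, a⟩ ⊗ₘ r'.ten g) ≫ X ⟨σ i, τ i a⟩ ◁ splitBlock X (σ i) R' u =
        Y ⟨i, a⟩ ◁ splitBlock Y i R t ≫ (g ⟨i, a⟩ ⊗ₘ
          (q.ten (Y := fun s => Y ⟨i, s⟩) (X := fun s => X ⟨σ i, s⟩) (fun s => g ⟨i, s⟩) ⊗ₘ
            r.ten g)) := by
      rw [← id_tensorHom, ← id_tensorHom, tensorHom_comp_tensorHom, tensorHom_comp_tensorHom, h]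
      simp
    simp only [Shuf.ten, Category.assoc, splitBlock]
    rw [h', reassoc_of% h1, associator_inv_naturality_assoc]
    simp only [← tensorHom_id, tensorHom_comp_tensorHom, Category.comp_id]

lemma Ins.past (X : (Σ i, S i) → C) (p : Σ i, S i) (j : ι) (B : List (S j)) (R : List (Σ i, S i)) :
    ∃ s : Ins p (block j R B) (block j (p :: R) B),
      s.ten X ≫ splitBlock X j (p :: R) B = X p ◁ splitBlock X j R B ≫ swap _ _ _ := by
  induction B with
  | nil =>
    refine ⟨.here _, ?_⟩
    have := swap_unit_right (X p) (tens X R)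
    simp only [Ins.ten, splitBlock, Category.id_comp]
    rw [this]
  | cons b B ih =>
    obtain ⟨s, h⟩ := ih
    refine ⟨.there _ s, ?_⟩
    have h1 := swap_nat_right (X p) (X ⟨j, b⟩) (splitBlock X j R B)
    have h2 := swap_tensor_right (X p) (X ⟨j, b⟩) (tens (fun s => X ⟨j, s⟩) B) (tens X R)
    have h3 := congrArg (fun k => X ⟨j, b⟩ ◁ k) h
    simp only [MonoidalCategory.whiskerLeft_comp] at h3
    simp only [Ins.ten, splitBlock, Category.assoc, MonoidalCategory.whiskerLeft_comp]
    rw [reassoc_of% h3, ← reassoc_of% h1, ← h2]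

lemma Shuf.blockSwap (X : (Σ i, S i) → C) (i j : ι) (A : List (S i)) (B : List (S j))
    (R : List (Σ i, S i)) :
    ∃ r : Shuf (fun p => p) (block i (block j R B) A)
        (block j (block i R A) B),
      r.ten (fun p => 𝟙 (X p)) ≫ splitBlock X j _ B ≫ _ ◁ splitBlock X i R A =
        splitBlock X i _ A ≫ _ ◁ splitBlock X j R B ≫ swap _ _ _ := by
  induction A with
  | nil =>
    refine ⟨.refl _, ?_⟩
    have h := swap_unit_left (tens (fun s => X ⟨j, s⟩) B) (tens X R)
    erw [Shuf.ten_refl]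
    simp only [splitBlock, Category.id_comp]
    rw [← h]
    simp
  | cons a A ih =>
    obtain ⟨r', h⟩ := ih
    obtain ⟨s, h'⟩ := Ins.past X ⟨i, a⟩ j B (block i R A)
    refine ⟨.cons s r', ?_⟩
    have h2 := congrArg (fun k => X ⟨i, a⟩ ◁ k) h
    simp only [MonoidalCategory.whiskerLeft_comp] at h2
    have h3 := swap_tensor_left (X ⟨i, a⟩) (tens (fun s => X ⟨i, s⟩) A)
      (tens (fun s => X ⟨j, s⟩) B) (tens X R)
    have h4 := swap_nat_right (X ⟨i, a⟩) (tens (fun s => X ⟨j, s⟩) B) (splitBlock X i R A)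
    simp only [Shuf.ten, Category.assoc, splitBlock, MonoidalCategory.whiskerLeft_comp,
      id_tensorHom]
    erw [reassoc_of% h', ← reassoc_of% h4, reassoc_of% h2, h3]
    simp

/-- Moving a whole block of factors. -/
lemma Ins.block (X : (Σ i, S i) → C) (m : ∀ i, List (S i)) {a : ι} {t l : List ι}
    (s : Ins a t l) :
    ∃ r : Shuf (fun p => p) (block a (sigmaList m t) (m a)) (sigmaList m l),
      r.ten (fun p => 𝟙 (X p)) ≫ splitBlocks X m l =
        splitBlock X a _ (m a) ≫ _ ◁ splitBlocks X m t ≫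
          s.ten (fun i => tens (fun s => X ⟨i, s⟩) (m i)) := by
  induction s with
  | here t =>
    refine ⟨.refl _, ?_⟩
    erw [Shuf.ten_refl]
    simp [Ins.ten, splitBlocks]
  | @there b t l s ih =>
    obtain ⟨r0, h0⟩ := ih
    obtain ⟨r1, h1⟩ := Shuf.blockSwap X a b (m a) (m b) (sigmaList m t)
    obtain ⟨r2, h2⟩ := Shuf.append (σ := fun i : ι => i) (τ := fun i (x : S i) => x)
      (fun p => 𝟙 (X p)) b (Shuf.refl (m b)) r0
    obtain ⟨r3, h3⟩ := Shuf.comp (fun p => 𝟙 (X p)) (fun p => 𝟙 (X p)) r1 r2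
    refine ⟨r3, ?_⟩
    have h4 : r2.ten (fun p => 𝟙 (X p)) ≫ splitBlock X b (sigmaList m l) (m b) ≫
        _ ◁ splitBlocks X m l = splitBlock X b _ (m b) ≫ _ ◁ splitBlock X a _ (m a) ≫
          _ ◁ _ ◁ splitBlocks X m t ≫ _ ◁ s.ten (fun i => tens (fun s => X ⟨i, s⟩) (m i)) := by
      rw [reassoc_of% h2, Shuf.ten_refl, id_tensorHom, ← MonoidalCategory.whiskerLeft_comp, h0]
      simp
    have h5 := swap_nat_right (tens (fun s => X ⟨a, s⟩) (m a)) (tens (fun s => X ⟨b, s⟩) (m b))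
      (splitBlocks X m t)
    simp only [Category.comp_id] at h3
    simp only [splitBlocks, h3, Category.assoc, h4, Ins.ten, MonoidalCategory.whiskerLeft_comp]
    rw [reassoc_of% h1, reassoc_of% h5]

lemma Shuf.blocks {σ : ι → κ} {τ : ∀ i, S i → S' (σ i)} {Y : (Σ i, S i) → C} {X : (Σ i, S' i) → C}
    (g : ∀ p, Y p ⟶ X (sigmaMap σ τ p)) (m : ∀ i, List (S i)) (m' : ∀ i, List (S' i))
    (q : ∀ i, Shuf (τ i) (m i) (m' (σ i))) {l : List ι} {l' : List κ} (p : Shuf σ l l') :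
    ∃ r : Shuf (sigmaMap σ τ) (sigmaList m l) (sigmaList m' l'),
      r.ten g ≫ splitBlocks X m' l' = splitBlocks Y m l ≫
        p.ten (Y := fun i => tens (fun s => Y ⟨i, s⟩) (m i))
          (X := fun i => tens (fun s => X ⟨i, s⟩) (m' i))
          (fun i => (q i).ten (Y := fun s => Y ⟨i, s⟩) (X := fun s => X ⟨σ i, s⟩)
            (fun s => g ⟨i, s⟩)) := by
  induction p with
  | nil => exact ⟨.nil, by simp [Shuf.ten, splitBlocks]⟩
  | @cons a t u l s p ih =>
    obtain ⟨r0, h0⟩ := ih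
    obtain ⟨r1, h1⟩ := Shuf.append g a (q a) r0
    obtain ⟨r2, h2⟩ := Ins.block X m' s
    obtain ⟨r3, h3⟩ := Shuf.comp g (fun p => 𝟙 (X p)) r1 r2
    refine ⟨r3, ?_⟩
    simp only [Category.comp_id] at h3
    simp only [splitBlocks, h3, Category.assoc, Shuf.ten, h2]
    rw [reassoc_of% h1]
    have h4 : ∀ {A B D E F : C} (f : A ⟶ B) (h : D ⟶ E) (k : E ⟶ F), (f ⊗ₘ h) ≫ B ◁ k =
        (f ⊗ₘ (h ≫ k)) := by
      intros; simp [← id_tensorHom]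
    have h5 : ∀ {A B D E F : C} (f : A ⟶ B) (h : D ⟶ E) (k : E ⟶ F), A ◁ h ≫ (f ⊗ₘ k) =
        (f ⊗ₘ (h ≫ k)) := by
      intros; simp [← id_tensorHom]
    rw [reassoc_of% h4, h0, reassoc_of% h5]


/-- The reassociation of triples of indices. -/
@[reducible] def sigmaReassoc {S : ι → Type} {U : (Σ i, S i) → Type} (q : Σ p : (Σ i, S i), U p) :
    Σ i, Σ s : S i, U ⟨i, s⟩ :=
  ⟨q.1.1, q.1.2, q.2⟩

lemma Shuf.reassoc_block {U : (Σ i, S i) → Type} (X : (Σ i, Σ s : S i, U ⟨i, s⟩) → C)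
    (i : ι) (s : S i) (w : List (U ⟨i, s⟩)) (Q : List (Σ p : (Σ i, S i), U p))
    (Q' : List (Σ s : S i, U ⟨i, s⟩)) (R' : List (Σ i, Σ s : S i, U ⟨i, s⟩))
    (q : Shuf sigmaReassoc Q (block i R' Q')) :
    ∃ r : Shuf sigmaReassoc (block ⟨i, s⟩ Q w) (block i R' (block s Q' w)),
      r.ten (Y := fun p => X (sigmaReassoc p)) (fun p => 𝟙 (X (sigmaReassoc p))) ≫
          splitBlock X i R' (block s Q' w) ≫
          splitBlock (fun q => X ⟨i, q⟩) s Q' w ▷ _ =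
        splitBlock (fun p => X (sigmaReassoc p)) ⟨i, s⟩ Q w ≫
          _ ◁ (q.ten (Y := fun p => X (sigmaReassoc p)) (fun p => 𝟙 (X (sigmaReassoc p))) ≫
            splitBlock X i R' Q') ≫ (α_ _ _ _).inv := by
  induction w with
  | nil => exact ⟨q, by simp [splitBlock]⟩
  | cons u w ih =>
    obtain ⟨r, h⟩ := ih
    refine ⟨.cons (a := ⟨⟨i, s⟩, u⟩) (.here _) r, ?_⟩
    have h1 := congrArg (fun k => X ⟨i, s, u⟩ ◁ k) h
    simp only [MonoidalCategory.whiskerLeft_comp] at h1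
    simp only [Shuf.ten, Ins.ten, splitBlock, Category.comp_id, id_tensorHom, comp_whiskerRight,
      Category.assoc, MonoidalCategory.whiskerLeft_comp]
    have h2 := associator_inv_naturality_middle (X ⟨i, s, u⟩)
      (splitBlock (fun q => X ⟨i, q⟩) s Q' w) (tens X R')
    rw [← reassoc_of% h2, reassoc_of% h1]
    simp

lemma Shuf.reassoc_blocks {U : (Σ i, S i) → Type} (X : (Σ i, Σ s : S i, U ⟨i, s⟩) → C)
    (k : ∀ p, List (U p)) (i : ι) (R : List (Σ i, S i)) (R' : List (Σ i, Σ s : S i, U ⟨i, s⟩))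
    (r₀ : Shuf sigmaReassoc (sigmaList k R) R') {Z : C} (h : tens X R' ⟶ Z)
    (h' : tens (fun p => tens (fun u => X (sigmaReassoc ⟨p, u⟩)) (k p)) R ⟶ Z)
    (e : r₀.ten (Y := fun p => X (sigmaReassoc p)) (fun p => 𝟙 (X (sigmaReassoc p))) ≫ h =
      splitBlocks (fun p => X (sigmaReassoc p)) k R ≫ h') (l : List (S i)) :
    ∃ r : Shuf sigmaReassoc (sigmaList k (block i R l))
        (block i R' (sigmaList (fun s => k ⟨i, s⟩) l)),
      r.ten (Y := fun p => X (sigmaReassoc p)) (fun p => 𝟙 (X (sigmaReassoc p))) ≫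
          splitBlock X i R' _ ≫
          (splitBlocks (fun q => X ⟨i, q⟩) (fun s => k ⟨i, s⟩) l ⊗ₘ h) =
        splitBlocks (fun p => X (sigmaReassoc p)) k (block i R l) ≫
          splitBlock (fun p => tens (fun u => X (sigmaReassoc ⟨p, u⟩)) (k p)) i R l ≫ _ ◁ h' := by
  induction l with
  | nil => exact ⟨r₀, by simp [splitBlock, splitBlocks, e]⟩
  | cons s l ih =>
    obtain ⟨r', h1⟩ := ih
    obtain ⟨r, h2⟩ := Shuf.reassoc_block X i s (k ⟨i, s⟩) _ _ R' r'
    refine ⟨r, ?_⟩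
    have h3 := congrArg (fun f => tens (fun u => X ⟨i, s, u⟩) (k ⟨i, s⟩) ◁ f) h1
    simp only [MonoidalCategory.whiskerLeft_comp] at h3
    have h4 : (splitBlock (fun q => X ⟨i, q⟩) s _ (k ⟨i, s⟩) ≫
        _ ◁ splitBlocks (fun q => X ⟨i, q⟩) (fun s => k ⟨i, s⟩) l ⊗ₘ h) =
        splitBlock (fun q => X ⟨i, q⟩) s _ (k ⟨i, s⟩) ▷ _ ≫ (α_ _ _ _).hom ≫
          _ ◁ (splitBlocks (fun q => X ⟨i, q⟩) (fun s => k ⟨i, s⟩) l ⊗ₘ h) ≫ (α_ _ _ _).inv :=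
      tensor_split_left _ _ _
    simp only [splitBlocks, splitBlock, Category.assoc, h4]
    rw [reassoc_of% h2]
    simp only [MonoidalCategory.whiskerLeft_comp, Category.assoc, Iso.inv_hom_id_assoc]
    rw [reassoc_of% h3]
    simp

lemma Shuf.reassoc {U : (Σ i, S i) → Type} (X : (Σ i, Σ s : S i, U ⟨i, s⟩) → C)
    (k : ∀ p, List (U p)) (m : ∀ i, List (S i)) (l : List ι) :
    ∃ r : Shuf sigmaReassoc (sigmaList k (sigmaList m l))
        (sigmaList (fun i => sigmaList (fun s => k ⟨i, s⟩) (m i)) l),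
      r.ten (Y := fun p => X (sigmaReassoc p)) (fun p => 𝟙 (X (sigmaReassoc p))) ≫
          splitBlocks X _ l ≫
          (Shuf.refl l).ten (fun i => splitBlocks (fun q => X ⟨i, q⟩) (fun s => k ⟨i, s⟩) (m i)) =
        splitBlocks (fun p => X (sigmaReassoc p)) k (sigmaList m l) ≫
          splitBlocks (fun p => tens (fun u => X (sigmaReassoc ⟨p, u⟩)) (k p)) m l := by
  induction l with
  | nil => exact ⟨.nil, by simp [Shuf.refl, Shuf.ten, splitBlocks]⟩
  | cons i l ih =>
    obtain ⟨r, h⟩ := ih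
    obtain ⟨r', h'⟩ := Shuf.reassoc_blocks X k i _ _ r _ _ h (m i)
    refine ⟨r', ?_⟩
    simp only [splitBlocks, Category.assoc, ← h', Shuf.refl, Shuf.ten, Ins.ten, Category.comp_id]
    simp [← id_tensorHom]

lemma Shuf.unit_left (X : (Σ i, S i) → C) (i : ι) (w : List (S i)) :
    ∃ r : Shuf (fun s => (⟨i, s⟩ : Σ i, S i)) w (block i [] w),
      r.ten (fun s => 𝟙 (X ⟨i, s⟩)) ≫ splitBlock X i [] w = (ρ_ _).inv := by
  induction w with
  | nil => exact ⟨.nil, by simp [Shuf.ten, splitBlock, unitors_inv_equal]⟩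
  | cons s w ih =>
    obtain ⟨r, h⟩ := ih
    refine ⟨.cons (.here _) r, ?_⟩
    have h1 := congrArg (fun k => X ⟨i, s⟩ ◁ k) h
    simp only [MonoidalCategory.whiskerLeft_comp] at h1
    simp only [Shuf.ten, Ins.ten, splitBlock, Category.comp_id, id_tensorHom]
    rw [reassoc_of% h1]
    simp

lemma Shuf.unit_right (X : (Σ _ : ι, Unit) → C) (l : List ι) :
    ∃ r : Shuf (fun i => (⟨i, ()⟩ : Σ _ : ι, Unit)) l (sigmaList (fun _ => [()]) l),
      r.ten (fun i => 𝟙 (X ⟨i, ()⟩)) ≫ splitBlocks X _ l =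
        (Shuf.refl l).ten (fun i => (ρ_ (X ⟨i, ()⟩)).inv) := by
  induction l with
  | nil => exact ⟨.nil, by simp [Shuf.ten, Shuf.refl, splitBlocks]⟩
  | cons s l ih =>
    obtain ⟨r, h⟩ := ih
    refine ⟨.cons (.here _) r, ?_⟩
    have h1 := congrArg (fun k => X ⟨s, ()⟩ ◁ k) h
    simp only [MonoidalCategory.whiskerLeft_comp] at h1
    simp only [Shuf.ten, Shuf.refl, Ins.ten, splitBlock, splitBlocks, Category.comp_id,
      id_tensorHom, Category.assoc]
    rw [← h]
    exact tensor_split_right (X ⟨s, ()⟩) _ _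

end Blocks

end Tens

/-- A finite type whose elements are listed in a chosen order. -/
class Enum (ι : Type) where
  list : List ι
  nodup : list.Nodup
  mem : ∀ i, i ∈ list

instance (n : ℕ) : Enum (Fin n) := ⟨List.finRange n, List.nodup_finRange n, List.mem_finRange⟩

instance : Enum Unit := ⟨[()], by simp, by simp⟩

lemma block_eq {ι : Type} {S : ι → Type} (i : ι) (r : List (Σ i, S i)) (k : List (S i)) :
    block i r k = k.map (Sigma.mk i) ++ r := by
  induction k with
  | nil => rfl
  | cons s k ih => simp [block, ih]

lemma mem_sigmaList {ι : Type} {S : ι → Type} (m : ∀ i, List (S i)) (l : List ι) (p : Σ i, S i) :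
    p ∈ sigmaList m l ↔ p.1 ∈ l ∧ p.2 ∈ m p.1 := by
  induction l with
  | nil => simp
  | cons i l ih =>
    obtain ⟨j, s⟩ := p
    simp only [sigmaList, block_eq, List.mem_append, List.mem_map, ih, List.mem_cons]
    constructor
    · rintro (⟨t, ht, h⟩ | h)
      · cases h; exact ⟨.inl rfl, ht⟩
      · exact ⟨.inr h.1, h.2⟩
    · rintro ⟨rfl | h, h'⟩
      · exact .inl ⟨s, h', rfl⟩
      · exact .inr ⟨h, h'⟩

lemma nodup_sigmaList {ι : Type} {S : ι → Type} (m : ∀ i, List (S i)) (hm : ∀ i, (m i).Nodup)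
    {l : List ι} (hl : l.Nodup) : (sigmaList m l).Nodup := by
  induction l with
  | nil => simp
  | cons i l ih =>
    rw [sigmaList, block_eq, List.nodup_append]
    refine ⟨(hm i).map (fun a b h => by cases h; rfl), ih (List.nodup_cons.1 hl).2, ?_⟩
    rintro a ha b hb rfl
    obtain ⟨t, -, h⟩ := List.mem_map.1 ha
    have h' := ((mem_sigmaList _ _ _).1 hb).1
    rw [← h] at h'
    exact (List.nodup_cons.1 hl).1 h'

instance {ι : Type} {S : ι → Type} [Enum ι] [∀ i, Enum (S i)] : Enum (Σ i, S i) where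
  list := sigmaList (fun _ => Enum.list) Enum.list
  nodup := nodup_sigmaList _ (fun _ => Enum.nodup) Enum.nodup
  mem p := (mem_sigmaList _ _ _).2 ⟨Enum.mem _, Enum.mem _⟩

lemma Enum.perm {ι κ : Type} [Enum ι] [Enum κ] {σ : ι → κ} (h : σ.Bijective) :
    ((Enum.list : List ι).map σ).Perm (Enum.list : List κ) :=
  (List.perm_ext_iff_of_nodup (Enum.nodup.map h.1) Enum.nodup).2 fun k => by
    simp only [List.mem_map, Enum.mem, true_and, iff_true]
    exact h.2 k

lemma sigmaMap_bijective {ι κ : Type} {S : ι → Type} {S' : κ → Type} {σ : ι → κ}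
    (hσ : σ.Bijective) {τ : ∀ i, S i → S' (σ i)} (hτ : ∀ i, (τ i).Bijective) :
    (sigmaMap σ τ).Bijective :=
  ⟨hσ.1.sigma_map fun i => (hτ i).1, hσ.2.sigma_map fun i => (hτ i).2⟩

lemma sigmaReassoc_bijective {ι : Type} {S : ι → Type} {U : (Σ i, S i) → Type} :
    (sigmaReassoc (U := U)).Bijective :=
  (Equiv.sigmaAssoc fun i s => U ⟨i, s⟩).bijective

section BigTensor
variable {C : Type u} [Category.{v} C] [MonoidalCategory C]

/-- The tensor product of a finite family of objects. -/
abbrev bigTensor {ι : Type} [Enum ι] (X : ι → C) : C := tens X Enum.list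

variable [SymmetricCategory C]

section
variable {ι κ μ : Type} [Enum ι] [Enum κ] [Enum μ]

/-- The morphism of tensor products induced by a bijection of the sets of indices and by morphisms
between the corresponding factors; the factors are permuted by means of the symmetry. -/
noncomputable def bigTensorMap {Y : ι → C} {X : κ → C} (σ : ι → κ) (hσ : σ.Bijective)
    (g : ∀ i, Y i ⟶ X (σ i)) : bigTensor Y ⟶ bigTensor X :=
  (Shuf.exists_of_perm σ (Enum.perm hσ)).some.ten g

lemma bigTensorMap_eq {Y : ι → C} {X : κ → C} {σ : ι → κ} (hσ : σ.Bijective)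
    (g : ∀ i, Y i ⟶ X (σ i)) (p : Shuf σ Enum.list Enum.list) :
    bigTensorMap σ hσ g = p.ten g := by
  rw [bigTensorMap, Shuf.unique (Shuf.exists_of_perm σ (Enum.perm hσ)).some p Enum.nodup]

lemma bigTensorMap_id (X : ι → C) (h : (fun i : ι => i).Bijective) :
    bigTensorMap (fun i => i) h (fun i => 𝟙 (X i)) = 𝟙 _ := by
  rw [bigTensorMap_eq _ _ (Shuf.refl _), Shuf.ten_refl]

lemma bigTensorMap_comp {Z : ι → C} {Y : κ → C} {X : μ → C} {σ : ι → κ} (hσ : σ.Bijective)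
    {τ : κ → μ} (hτ : τ.Bijective) (g : ∀ i, Z i ⟶ Y (σ i)) (h : ∀ i, Y i ⟶ X (τ i)) :
    bigTensorMap σ hσ g ≫ bigTensorMap τ hτ h =
      bigTensorMap (fun i => τ (σ i)) (hτ.comp hσ) (fun i => g i ≫ h (σ i)) := by
  obtain ⟨r, hr⟩ := Shuf.comp g h (Shuf.exists_of_perm σ (Enum.perm hσ)).some
    (Shuf.exists_of_perm τ (Enum.perm hτ)).some
  rw [bigTensorMap_eq _ _ r, hr]
  rfl

lemma bigTensorMap_congr {Y : ι → C} {x : C} {σ σ' : ι → κ} (hσ : σ.Bijective)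
    (hσ' : σ'.Bijective) (h : ∀ i, σ i = σ' i) (g : ∀ i, Y i ⟶ x) :
    bigTensorMap (X := fun _ => x) σ hσ g = bigTensorMap (X := fun _ => x) σ' hσ' g := by
  obtain rfl := funext h
  rfl

end

section
variable {ι κ : Type} {S : ι → Type} {S' : κ → Type} [Enum ι] [Enum κ] [∀ i, Enum (S i)]
  [∀ i, Enum (S' i)]

/-- The associativity isomorphism from a tensor product over a set of pairs to an iterated
tensor product. -/
def bigTensorSigma (X : (Σ i, S i) → C) :
    bigTensor X ⟶ bigTensor fun i => bigTensor fun s => X ⟨i, s⟩ :=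
  splitBlocks X (fun _ => Enum.list) Enum.list

lemma bigTensorMap_sigma {Y : (Σ i, S i) → C} {X : (Σ i, S' i) → C} {σ : ι → κ}
    (hσ : σ.Bijective) {τ : ∀ i, S i → S' (σ i)} (hτ : ∀ i, (τ i).Bijective)
    (g : ∀ p : (Σ i, S i), Y p ⟶ X (sigmaMap σ τ p)) :
    bigTensorMap _ (sigmaMap_bijective hσ hτ) g ≫ bigTensorSigma X =
      bigTensorSigma Y ≫ bigTensorMap σ hσ (fun i => bigTensorMap (τ i) (hτ i)
        (fun s => g ⟨i, s⟩)) := by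
  obtain ⟨r, hr⟩ := Shuf.blocks (σ := σ) (τ := fun i => τ i) (X := X) g (fun _ => Enum.list)
    (fun _ => Enum.list) (fun i => (Shuf.exists_of_perm (τ i) (Enum.perm (hτ i))).some)
    (Shuf.exists_of_perm σ (Enum.perm hσ)).some
  rw [bigTensorMap_eq _ _ r]
  exact hr

lemma bigTensorSigma_assoc {U : (Σ i, S i) → Type} [∀ p, Enum (U p)]
    (X : (Σ i, Σ s : S i, U ⟨i, s⟩) → C) (h : (fun i : ι => i).Bijective) :
    bigTensorMap (Y := fun p => X (sigmaReassoc p)) sigmaReassoc sigmaReassoc_bijective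
        (fun p => 𝟙 (X (sigmaReassoc p))) ≫ bigTensorSigma X ≫
      bigTensorMap (fun i => i) h (fun i => bigTensorSigma fun p => X ⟨i, p⟩) =
    bigTensorSigma (fun p : (Σ p, U p) => X (sigmaReassoc p)) ≫
      bigTensorSigma (fun p => bigTensor fun u => X (sigmaReassoc ⟨p, u⟩)) := by
  obtain ⟨r, hr⟩ := Shuf.reassoc X (fun _ => Enum.list) (fun _ => Enum.list) Enum.list
  rw [bigTensorMap_eq sigmaReassoc_bijective _ r, bigTensorMap_eq _ _ (Shuf.refl _)]
  exact hr

end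

lemma bigTensorSigma_unit_left {S : Unit → Type} [∀ i, Enum (S i)] (X : (Σ i, S i) → C)
    (h : (fun s : S () => (⟨(), s⟩ : Σ i, S i)).Bijective) :
    bigTensorMap _ h (fun s => 𝟙 (X ⟨(), s⟩)) ≫ bigTensorSigma X = (ρ_ _).inv := by
  obtain ⟨r, hr⟩ := Shuf.unit_left X () Enum.list
  rw [bigTensorMap_eq h _ r, ← hr, bigTensorSigma]
  change _ ≫ _ ≫ _ ◁ 𝟙 _ = _
  simp

lemma bigTensorSigma_unit_right {ι : Type} [Enum ι] (X : (Σ _ : ι, Unit) → C)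
    (h : (fun i => (⟨i, ()⟩ : Σ _ : ι, Unit)).Bijective) (h' : (fun i : ι => i).Bijective) :
    bigTensorMap _ h (fun i => 𝟙 (X ⟨i, ()⟩)) ≫ bigTensorSigma X =
      bigTensorMap (fun i => i) h' (fun i => (ρ_ (X ⟨i, ()⟩)).inv) := by
  obtain ⟨r, hr⟩ := Shuf.unit_right X Enum.list
  rw [bigTensorMap_eq h _ r, bigTensorMap_eq h' _ (Shuf.refl _)]
  exact hr

end BigTensor

/-- A symmetric operad in sets: sets `Op n` of `n`-ary operations for `n ≥ 0`, on which the
bijections `Fin m ≃ Fin n` act by relabelling the inputs (as such a bijection exists only for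
`m = n`, this is an action of the symmetric group on each `Op n`), a unit, and a composition
`γ (c; d₁, …, d_k)` which is associative, unital and equivariant. The inputs of a composite are
labelled by pairs `⟨i, j⟩`, where `j` is an input of `d i`, in lexicographic order. -/
structure Operad where
  Op : ℕ → Type v
  act {m n : ℕ} : Fin m ≃ Fin n → Op m → Op n
  one : Op 1
  comp {k : ℕ} (n : Fin k → ℕ) : Op k → (∀ i, Op (n i)) → Op (∑ i, n i)
  act_refl {n : ℕ} (c : Op n) : act (Equiv.refl _) c = c
  act_trans {l m n : ℕ} (e : Fin l ≃ Fin m) (e' : Fin m ≃ Fin n) (c : Op l) :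
    act (e.trans e') c = act e' (act e c)
  /-- Equivariance with respect to the permutations of the outer inputs. -/
  comp_act_left {k k' : ℕ} (σ : Fin k ≃ Fin k') (n : Fin k' → ℕ) (c : Op k)
    (d : ∀ i, Op (n i)) :
    comp n (act σ c) d =
      act (finSigmaFinEquiv.symm.trans ((σ.sigmaCongrLeft (β := fun i => Fin (n i))).trans
        finSigmaFinEquiv)) (comp (fun i => n (σ i)) c (fun i => d (σ i)))
  /-- Equivariance with respect to the permutations of the inner inputs. -/
  comp_act_right {k : ℕ} (n n' : Fin k → ℕ) (τ : ∀ i, Fin (n i) ≃ Fin (n' i)) (c : Op k)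
    (d : ∀ i, Op (n i)) :
    comp n' c (fun i => act (τ i) (d i)) =
      act (finSigmaFinEquiv.symm.trans ((Equiv.sigmaCongrRight τ).trans finSigmaFinEquiv))
        (comp n c d)
  one_comp (n : Fin 1 → ℕ) (d : ∀ i, Op (n i)) :
    comp n one d =
      act ((Equiv.uniqueSigma fun i => Fin (n i)).symm.trans finSigmaFinEquiv) (d default)
  comp_one {k : ℕ} (c : Op k) :
    comp (fun _ => 1) c (fun _ => one) =
      act ((Equiv.sigmaUnique (Fin k) fun _ => Fin 1).symm.trans finSigmaFinEquiv) c
  comp_assoc {k : ℕ} (n : Fin k → ℕ) (m : Fin (∑ i, n i) → ℕ) (c : Op k) (d : ∀ i, Op (n i))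
    (e : ∀ l, Op (m l)) :
    act (finSigmaFinEquiv.symm.trans
        ((finSigmaFinEquiv.sigmaCongrLeft (β := fun l => Fin (m l))).symm.trans
        ((Equiv.sigmaAssoc fun i j => Fin (m (finSigmaFinEquiv ⟨i, j⟩))).trans
        ((Equiv.sigmaCongrRight fun _ => finSigmaFinEquiv).trans finSigmaFinEquiv))))
        (comp m (comp n c d) e) =
      comp (fun i => ∑ j, m (finSigmaFinEquiv ⟨i, j⟩)) c
        (fun i => comp (fun j => m (finSigmaFinEquiv ⟨i, j⟩)) (d i)
          (fun j => e (finSigmaFinEquiv ⟨i, j⟩)))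

namespace Operad

/-- A morphism of operads in sets. -/
@[ext]
structure Hom (P Q : Operad.{v}) where
  app (n : ℕ) : P.Op n → Q.Op n
  app_act {m n : ℕ} (e : Fin m ≃ Fin n) (c : P.Op m) : app n (P.act e c) = Q.act e (app m c)
  app_one : app 1 P.one = Q.one
  app_comp {k : ℕ} (n : Fin k → ℕ) (c : P.Op k) (d : ∀ i, P.Op (n i)) :
    app _ (P.comp n c d) = Q.comp n (app k c) (fun i => app (n i) (d i))

instance : Category Operad.{v} where
  Hom := Hom
  id P := ⟨fun _ c => c, fun _ _ => rfl, rfl, fun _ _ _ => rfl⟩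
  comp f g := ⟨fun n c => g.app n (f.app n c), fun e c => by rw [f.app_act, g.app_act],
    by rw [f.app_one, g.app_one], fun n c d => by rw [f.app_comp, g.app_comp]⟩

/-- The functor sending an operad to its set of `n`-ary operations. -/
def arity (n : ℕ) : Operad.{v} ⥤ Type v where
  obj P := P.Op n
  map f := ↾(Hom.app f n)

end Operad

section Endo
variable {C : Type u} [Category.{v} C] [MonoidalCategory C] [SymmetricCategory C]

/-- The tensor power `x ^ n`. -/
abbrev power (x : C) (n : ℕ) : C := bigTensor fun _ : Fin n => x

/-- The morphism of tensor powers induced by a bijection of the sets of indices. -/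
noncomputable def powerMap (x : C) {ι κ : Type} [Enum ι] [Enum κ] (e : ι ≃ κ) :
    bigTensor (fun _ : ι => x) ⟶ bigTensor (fun _ : κ => x) :=
  bigTensorMap e e.bijective fun _ => 𝟙 x

/-- The tensor product of a family of morphisms. -/
noncomputable def bigTensorHom {ι : Type} [Enum ι] {Y X : ι → C} (g : ∀ i, Y i ⟶ X i) :
    bigTensor Y ⟶ bigTensor X :=
  bigTensorMap (fun i => i) Function.bijective_id g

lemma powerMap_comp (x : C) {ι κ μ : Type} [Enum ι] [Enum κ] [Enum μ] (e : ι ≃ κ) (f : κ ≃ μ) :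
    powerMap x e ≫ powerMap x f = powerMap x (e.trans f) := by
  simp only [powerMap, bigTensorMap_comp, Category.comp_id]
  rfl

lemma powerMap_refl (x : C) (ι : Type) [Enum ι] : powerMap x (Equiv.refl ι) = 𝟙 _ :=
  bigTensorMap_id _ _

lemma powerMap_sigmaCongrLeft (x : C) {ι κ : Type} [Enum ι] [Enum κ] (σ : ι ≃ κ) {S : κ → Type}
    [∀ k, Enum (S k)] :
    powerMap x (σ.sigmaCongrLeft (β := S)) ≫ bigTensorSigma (fun _ : (Σ k, S k) => x) =
      bigTensorSigma (fun _ : (Σ i, S (σ i)) => x) ≫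
        bigTensorMap (X := fun k => bigTensor fun _ : S k => x) σ σ.bijective (fun _ => 𝟙 _) := by
  have h := bigTensorMap_sigma (S := fun i => S (σ i)) (S' := S) (Y := fun _ => x)
    (X := fun _ => x) σ.bijective (τ := fun i s => s) (fun i => Function.bijective_id)
    (fun _ => 𝟙 x)
  simp only [bigTensorMap_id] at h
  rw [← h, powerMap]
  congr 1

lemma powerMap_sigmaCongrRight (x : C) {ι : Type} [Enum ι] {S S' : ι → Type}
    [∀ i, Enum (S i)] [∀ i, Enum (S' i)] (τ : ∀ i, S i ≃ S' i) :
    powerMap x (Equiv.sigmaCongrRight τ) ≫ bigTensorSigma (fun _ : (Σ i, S' i) => x) =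
      bigTensorSigma (fun _ : (Σ i, S i) => x) ≫ bigTensorHom (fun i => powerMap x (τ i)) := by
  have h := bigTensorMap_sigma (S := S) (S' := S') (Y := fun _ => x)
    (X := fun _ => x) (σ := fun i => i) Function.bijective_id (τ := fun i s => τ i s)
    (fun i => (τ i).bijective) (fun _ => 𝟙 x)
  rw [bigTensorHom]
  simp only [powerMap]
  rw [← h]
  rfl

lemma powerMap_comp_eq (x : C) {ι κ : Type} [Enum ι] [Enum κ] (e : ι ≃ κ) {Z : C}
    (f : bigTensor (fun _ : ι => x) ⟶ Z) (g : bigTensor (fun _ : κ => x) ⟶ Z) :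
    powerMap x e ≫ g = f ↔ g = powerMap x e.symm ≫ f := by
  constructor
  · rintro rfl
    rw [← Category.assoc, powerMap_comp, Equiv.symm_trans_self, powerMap_refl, Category.id_comp]
  · rintro rfl
    rw [← Category.assoc, powerMap_comp, Equiv.self_trans_symm, powerMap_refl, Category.id_comp]

lemma bigTensorHom_comp {ι : Type} [Enum ι] {Z Y X : ι → C} (g : ∀ i, Z i ⟶ Y i)
    (h : ∀ i, Y i ⟶ X i) :
    bigTensorHom g ≫ bigTensorHom h = bigTensorHom (fun i => g i ≫ h i) :=
  bigTensorMap_comp _ _ _ _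

lemma bigTensorHom_unit {Y X : Unit → C} (g : ∀ i, Y i ⟶ X i) :
    bigTensorHom g = g () ▷ _ := by
  rw [bigTensorHom, bigTensorMap_eq _ _ (Shuf.refl _)]
  change (g () ⊗ₘ 𝟙 _) ≫ 𝟙 _ = _
  simp

/-- The composition of operations of arbitrary finite arities on an object. -/
noncomputable def sigmaComp {x : C} {ι : Type} [Enum ι] {S : ι → Type} [∀ i, Enum (S i)]
    (c : bigTensor (fun _ : ι => x) ⟶ x) (d : ∀ i, bigTensor (fun _ : S i => x) ⟶ x) :
    bigTensor (fun _ : (Σ i, S i) => x) ⟶ x :=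
  bigTensorSigma (fun _ : (Σ i, S i) => x) ≫ bigTensorHom d ≫ c

section
variable {x : C} {ι κ : Type} [Enum ι] [Enum κ]

lemma sigmaComp_left (σ : ι ≃ κ) {S : κ → Type} [∀ i, Enum (S i)]
    (c : bigTensor (fun _ : ι => x) ⟶ x) (d : ∀ i, bigTensor (fun _ : S i => x) ⟶ x) :
    powerMap x (σ.sigmaCongrLeft (β := S)) ≫ sigmaComp (powerMap x σ.symm ≫ c) d =
      sigmaComp c (fun i => d (σ i)) := by
  have h := powerMap_sigmaCongrLeft x σ (S := S)
  rw [sigmaComp, reassoc_of% h, sigmaComp, bigTensorHom, powerMap]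
  have h1 := bigTensorMap_comp (X := fun _ => x) Function.bijective_id σ.symm.bijective d
    (fun _ => 𝟙 x)
  have h2 := bigTensorMap_comp (Z := fun i => bigTensor fun _ : S (σ i) => x)
    (Y := fun k => bigTensor fun _ : S k => x) (X := fun _ => x) σ.bijective
    σ.symm.bijective (fun _ => 𝟙 _) (fun i => d i ≫ 𝟙 x)
  erw [reassoc_of% h1, reassoc_of% h2]
  congr 2
  have h3 : (fun i => 𝟙 _ ≫ d (σ i) ≫ 𝟙 x) = fun i => d (σ i) := by
    funext i
    rw [Category.comp_id, Category.id_comp]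
  refine Eq.trans (bigTensorMap_congr (Y := fun i => bigTensor fun _ : S (σ i) => x) _
    Function.bijective_id (fun i => σ.symm_apply_apply i) _) ?_
  rw [← h3]
  rfl

lemma sigmaComp_right {S S' : ι → Type} [∀ i, Enum (S i)] [∀ i, Enum (S' i)]
    (τ : ∀ i, S i ≃ S' i) (c : bigTensor (fun _ : ι => x) ⟶ x)
    (d : ∀ i, bigTensor (fun _ : S' i => x) ⟶ x) :
    powerMap x (Equiv.sigmaCongrRight τ) ≫ sigmaComp c d =
      sigmaComp c (fun i => powerMap x (τ i) ≫ d i) := by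
  have h := powerMap_sigmaCongrRight x τ
  have h1 := bigTensorHom_comp (fun i => powerMap x (τ i)) d
  rw [sigmaComp, reassoc_of% h, reassoc_of% h1, sigmaComp]

lemma sigmaComp_unit_left {S : Unit → Type} [∀ i, Enum (S i)]
    (d : ∀ i, bigTensor (fun _ : S i => x) ⟶ x) :
    powerMap x (Equiv.uniqueSigma S).symm ≫ sigmaComp (ρ_ x).hom d = d () := by
  have h := bigTensorSigma_unit_left (fun _ : (Σ i, S i) => x)
    (Equiv.uniqueSigma S).symm.bijective
  have h1 : bigTensorHom d = d () ▷ _ := bigTensorHom_unit _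
  change powerMap x (Equiv.uniqueSigma S).symm ≫ _ = _ at h
  rw [sigmaComp, reassoc_of% h, h1]
  simp

lemma sigmaComp_unit_right (c : bigTensor (fun _ : ι => x) ⟶ x) :
    powerMap x (Equiv.sigmaUnique ι fun _ => Unit).symm ≫
      sigmaComp c (fun _ => (ρ_ x).hom) = c := by
  have h := bigTensorSigma_unit_right (fun _ : (Σ _ : ι, Unit) => x)
    (Equiv.sigmaUnique ι fun _ => Unit).symm.bijective Function.bijective_id
  change powerMap x (Equiv.sigmaUnique ι fun _ => Unit).symm ≫ _ = _ at h
  have h1 := bigTensorHom_comp (fun _ : ι => (ρ_ x).inv) (fun _ => (ρ_ x).hom)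
  rw [sigmaComp, reassoc_of% h]
  erw [reassoc_of% h1]
  simp only [Iso.inv_hom_id]
  have h2 := bigTensorMap_id (fun _ : ι => x) Function.bijective_id
  rw [bigTensorHom, h2, Category.id_comp]

lemma sigmaComp_assoc {S : ι → Type} [∀ i, Enum (S i)] {U : (Σ i, S i) → Type}
    [∀ p, Enum (U p)] (c : bigTensor (fun _ : ι => x) ⟶ x)
    (d : ∀ i, bigTensor (fun _ : S i => x) ⟶ x) (e : ∀ p, bigTensor (fun _ : U p => x) ⟶ x) :
    powerMap x (Equiv.sigmaAssoc fun i s => U ⟨i, s⟩) ≫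
        sigmaComp c (fun i => sigmaComp (d i) (fun s => e ⟨i, s⟩)) =
      sigmaComp (sigmaComp c d) e := by
  have h := bigTensorSigma_assoc (fun _ : (Σ i, Σ s : S i, U ⟨i, s⟩) => x)
    Function.bijective_id
  have h1 := bigTensorMap_sigma (S := S) (S' := S) (Y := fun p => bigTensor fun _ : U p => x)
    (X := fun _ => x) (σ := fun i : ι => i) Function.bijective_id (τ := fun i s => s)
    (fun i => Function.bijective_id) e
  change bigTensorHom e ≫ _ = _ at h1
  have h2 := bigTensorHom_comp
    (fun i => bigTensorSigma fun _ : (Σ s : S i, U ⟨i, s⟩) => x)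
    (fun i => bigTensorHom (fun s => e ⟨i, s⟩) ≫ d i)
  have h3 := bigTensorHom_comp (fun i => bigTensorHom (fun s => e ⟨i, s⟩)) d
  change powerMap x (Equiv.sigmaAssoc fun i s => U ⟨i, s⟩) ≫ _ ≫ bigTensorHom _ = _ at h
  change bigTensorHom _ ≫ bigTensorHom _ = bigTensorHom (fun i => sigmaComp _ _) at h2
  simp only [sigmaComp, Category.assoc]
  simp only [sigmaComp] at h2
  rw [← h2]
  simp only [Category.assoc]
  rw [reassoc_of% h, ← h3]
  rw [reassoc_of% h1]
  simp only [Category.assoc]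
  rfl

end

/-- The endomorphism operad of an object in a symmetric monoidal category. -/
noncomputable def endoSet (x : C) : Operad.{v} where
  Op n := power x n ⟶ x
  act e c := powerMap x e.symm ≫ c
  one := powerMap x (Equiv.ofUnique (Fin 1) Unit) ≫ (ρ_ x).hom
  comp {k} n c d := powerMap x finSigmaFinEquiv.symm ≫ sigmaComp c d
  act_refl c := by
    have := powerMap_refl x
    simp [this]
  act_trans e e' c := by
    rw [← Category.assoc, powerMap_comp]; rfl
  comp_act_left σ n c d := by
    have h := sigmaComp_left (S := fun i => Fin (n i)) σ c d
    rw [powerMap_comp_eq] at h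
    rw [h, ← Category.assoc, ← Category.assoc, powerMap_comp, powerMap_comp]
    congr 2
    refine Equiv.ext fun q => ?_
    simp
  comp_act_right n n' τ c d := by
    have h := sigmaComp_right (fun i => (τ i).symm) c d
    rw [← h, ← Category.assoc, ← Category.assoc, powerMap_comp, powerMap_comp]
    congr 2
    refine Equiv.ext fun q => ?_
    simp
    rfl
  one_comp n d := by
    have h := sigmaComp_left (x := x) (Equiv.ofUnique (Fin 1) Unit).symm
      (S := fun i => Fin (n i)) (ρ_ x).hom d
    have h1 := sigmaComp_unit_left (fun i => d ((Equiv.ofUnique (Fin 1) Unit).symm i))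
    rw [← h, ← Category.assoc, powerMap_comp, powerMap_comp_eq] at h1
    rw [Equiv.symm_symm] at h1
    rw [h1, ← Category.assoc, powerMap_comp]
    congr 2
  comp_one {k} c := by
    have h := sigmaComp_right (fun _ : Fin k => Equiv.ofUnique (Fin 1) Unit) c
      (fun _ => (ρ_ x).hom)
    have h1 := sigmaComp_unit_right c
    rw [powerMap_comp_eq] at h1
    rw [← h, h1, ← Category.assoc, powerMap_comp, ← Category.assoc, powerMap_comp]
    congr 2
  comp_assoc {k} n m c d e := by
    have h := sigmaComp_left (S := fun l => Fin (m l)) finSigmaFinEquiv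
      (sigmaComp (S := fun i => Fin (n i)) c d) e
    have h1 := sigmaComp_assoc (S := fun i => Fin (n i))
      (U := fun p => Fin (m (finSigmaFinEquiv p))) c d (fun p => e (finSigmaFinEquiv p))
    have h2 := sigmaComp_right (S := fun i => Fin (∑ j, m (finSigmaFinEquiv ⟨i, j⟩)))
      (fun i => (finSigmaFinEquiv (n := fun j => m (finSigmaFinEquiv ⟨i, j⟩))).symm) c
      (fun i => sigmaComp (d i) (fun j => e (finSigmaFinEquiv ⟨i, j⟩)))
    rw [powerMap_comp_eq] at h
    rw [h, ← h1, ← h2]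
    simp only [← Category.assoc, powerMap_comp]
    congr 2
    have h3 : ∀ {A₁ A₂ A₃ A₄ A₅ A₆ : Type} (a : A₁ ≃ A₂) (b : A₂ ≃ A₃) (c : A₃ ≃ A₄)
        (d : A₄ ≃ A₅) (e : A₅ ≃ A₆), (a.trans (b.trans (c.trans (d.trans e)))).symm.trans
          (a.trans (b.trans c)) = e.symm.trans d.symm := by
      intros
      ext
      simp
    exact h3 _ _ _ _ _

end Endo

section Lax
open Functor.LaxMonoidal
variable {C : Type u} [Category.{v} C] [MonoidalCategory C] [SymmetricCategory C]
  {C' : Type u'} [Category.{v} C'] [MonoidalCategory C'] [SymmetricCategory C']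
  (F : C ⥤ C') [F.LaxBraided]

/-- The canonical morphism `F (X a₁) ⊗ ⋯ ⊗ F (X aₙ) ⟶ F (X a₁ ⊗ ⋯ ⊗ X aₙ)` of a lax monoidal
functor. -/
noncomputable def laxTens {ι : Type} (X : ι → C) :
    (l : List ι) → (tens (fun i => F.obj (X i)) l ⟶ F.obj (tens X l))
  | [] => ε F
  | a :: l => F.obj (X a) ◁ laxTens X l ≫ μ F (X a) (tens X l)

lemma lax_swap (A B Z : C) :
    F.obj A ◁ μ F B Z ≫ μ F A (B ⊗ Z) ≫ F.map (swap A B Z) =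
      swap (F.obj A) (F.obj B) (F.obj Z) ≫ F.obj B ◁ μ F A Z ≫ μ F B (A ⊗ Z) := by
  simp only [swap, Functor.map_comp, Category.assoc]
  rw [associativity_inv_assoc, ← μ_natural_left_assoc, ← comp_whiskerRight_assoc,
    Functor.LaxBraided.braided, comp_whiskerRight_assoc, associativity]

lemma laxTens_ins {ι : Type} (X : ι → C) {a : ι} {t l : List ι} (s : Ins a t l) :
    F.obj (X a) ◁ laxTens F X t ≫ μ F (X a) (tens X t) ≫ F.map (s.ten X) =
      s.ten (fun i => F.obj (X i)) ≫ laxTens F X l := by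
  induction s with
  | here t => simp [Ins.ten, laxTens]
  | @there b t l s ih =>
    have h := lax_swap F (X a) (X b) (tens X t)
    have h1 := swap_nat_right (F.obj (X a)) (F.obj (X b)) (laxTens F X t)
    simp only [Ins.ten, laxTens, Functor.map_comp, Category.assoc,
      MonoidalCategory.whiskerLeft_comp]
    rw [reassoc_of% h, reassoc_of% h1, ← μ_natural_right]
    simp only [← MonoidalCategory.whiskerLeft_comp_assoc, ih]

lemma laxTens_shuf {ι κ : Type} {σ : ι → κ} {Y : ι → C} {X : κ → C} (g : ∀ i, Y i ⟶ X (σ i))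
    {l : List ι} {m : List κ} (p : Shuf σ l m) :
    laxTens F Y l ≫ F.map (p.ten g) =
      p.ten (Y := fun i => F.obj (Y i)) (X := fun i => F.obj (X i)) (fun i => F.map (g i)) ≫
        laxTens F X m := by
  induction p with
  | nil => simp [Shuf.ten, laxTens]
  | @cons a t u l s p ih =>
    simp only [Shuf.ten, laxTens, Functor.map_comp, Category.assoc]
    rw [← laxTens_ins, ← μ_natural_assoc, MonoidalCategory.tensorHom_def,
      MonoidalCategory.tensorHom_def]
    simp only [Category.assoc, whisker_exchange_assoc, ← MonoidalCategory.whiskerLeft_comp_assoc,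
      ih]

lemma laxTens_splitBlock {ι : Type} {S : ι → Type} (X : (Σ i, S i) → C) (i : ι)
    (r : List (Σ i, S i)) (k : List (S i)) :
    laxTens F X (block i r k) ≫ F.map (splitBlock X i r k) =
      splitBlock (fun p => F.obj (X p)) i r k ≫
        (laxTens F (fun s => X ⟨i, s⟩) k ⊗ₘ laxTens F X r) ≫ μ F _ _ := by
  induction k with
  | nil =>
    simp only [splitBlock, laxTens, MonoidalCategory.tensorHom_def, Category.assoc]
    rw [← whisker_exchange_assoc]
    simp
  | cons s k ih =>
    simp only [splitBlock, laxTens, Functor.map_comp, Category.assoc]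
    rw [← μ_natural_right_assoc]
    simp only [← MonoidalCategory.whiskerLeft_comp_assoc, ih]
    simp only [MonoidalCategory.tensorHom_def, MonoidalCategory.whiskerLeft_comp, Category.assoc,
      comp_whiskerRight, associativity_inv, whisker_exchange_assoc,
      associator_inv_naturality_middle_assoc, associator_inv_naturality_right_assoc]

lemma laxTens_splitBlocks {ι : Type} {S : ι → Type} (X : (Σ i, S i) → C)
    (m : ∀ i, List (S i)) (l : List ι) :
    laxTens F X (sigmaList m l) ≫ F.map (splitBlocks X m l) =
      splitBlocks (fun p => F.obj (X p)) m l ≫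
        (Shuf.refl l).ten (fun i => laxTens F (fun s => X ⟨i, s⟩) (m i)) ≫
          laxTens F (fun i => tens (fun s => X ⟨i, s⟩) (m i)) l := by
  induction l with
  | nil => simp [splitBlocks, Shuf.refl, Shuf.ten, laxTens]
  | cons i l ih =>
    have h := laxTens_splitBlock F X i (sigmaList m l) (m i)
    simp only [splitBlocks, Shuf.refl, Shuf.ten, Ins.ten, laxTens, Functor.map_comp,
      Category.assoc, Category.comp_id]
    rw [reassoc_of% h, ← μ_natural_right]
    simp only [MonoidalCategory.tensorHom_def, Category.assoc]
    simp only [← MonoidalCategory.whiskerLeft_comp_assoc, ih]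
    simp only [MonoidalCategory.whiskerLeft_comp, Category.assoc]
    simp only [whisker_exchange_assoc]

/-- The canonical morphism from the tensor product of the values of a lax monoidal functor to its
value at the tensor product. -/
noncomputable abbrev laxBigTensor {ι : Type} [Enum ι] (X : ι → C) :
    bigTensor (fun i => F.obj (X i)) ⟶ F.obj (bigTensor X) :=
  laxTens F X Enum.list

lemma laxBigTensor_map {ι κ : Type} [Enum ι] [Enum κ] {Y : ι → C} {X : κ → C} {σ : ι → κ}
    (hσ : σ.Bijective) (g : ∀ i, Y i ⟶ X (σ i)) :
    laxBigTensor F Y ≫ F.map (bigTensorMap σ hσ g) =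
      bigTensorMap σ hσ (fun i => F.map (g i)) ≫ laxBigTensor F X := by
  rw [bigTensorMap_eq _ _ (Shuf.exists_of_perm σ (Enum.perm hσ)).some,
    bigTensorMap_eq _ _ (Shuf.exists_of_perm σ (Enum.perm hσ)).some]
  exact laxTens_shuf F g _

lemma laxBigTensor_powerMap {ι κ : Type} [Enum ι] [Enum κ] (x : C) (e : ι ≃ κ) :
    laxBigTensor F (fun _ => x) ≫ F.map (powerMap x e) =
      powerMap (F.obj x) e ≫ laxBigTensor F (fun _ => x) := by
  simp only [powerMap, laxBigTensor_map, F.map_id]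

lemma laxBigTensor_sigma {ι : Type} [Enum ι] {S : ι → Type} [∀ i, Enum (S i)]
    (X : (Σ i, S i) → C) :
    laxBigTensor F X ≫ F.map (bigTensorSigma X) =
      bigTensorSigma (fun p => F.obj (X p)) ≫
        bigTensorHom (fun i => laxBigTensor F (fun s => X ⟨i, s⟩)) ≫
          laxBigTensor F (fun i => bigTensor fun s => X ⟨i, s⟩) := by
  rw [bigTensorHom, bigTensorMap_eq _ _ (Shuf.refl _)]
  exact laxTens_splitBlocks F X _ _

lemma laxBigTensor_sigmaComp {ι : Type} [Enum ι] {S : ι → Type} [∀ i, Enum (S i)] {x : C}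
    (c : bigTensor (fun _ : ι => x) ⟶ x) (d : ∀ i, bigTensor (fun _ : S i => x) ⟶ x) :
    laxBigTensor F (fun _ => x) ≫ F.map (sigmaComp c d) =
      sigmaComp (laxBigTensor F (fun _ => x) ≫ F.map c)
        (fun i => laxBigTensor F (fun _ => x) ≫ F.map (d i)) := by
  have h := laxBigTensor_sigma F (fun _ : (Σ i, S i) => x)
  have h1 := laxBigTensor_map F (X := fun _ => x) (σ := fun i : ι => i) Function.bijective_id d
  have h2 := bigTensorHom_comp (fun i => laxBigTensor F (fun _ : S i => x)) (fun i => F.map (d i))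
  change _ = bigTensorHom (fun i => F.map (d i)) ≫ _ at h1
  change _ ≫ F.map (bigTensorHom d) = _ at h1
  simp only [sigmaComp, F.map_comp]
  rw [reassoc_of% h, reassoc_of% h1, ← h2, Category.assoc]

/-- The morphism of endomorphism operads induced by a lax symmetric monoidal functor. -/
noncomputable def endoMap (x : C) : endoSet x ⟶ endoSet (F.obj x) where
  app n c := laxBigTensor F (fun _ => x) ≫ F.map c
  app_act e c := by
    have h := laxBigTensor_powerMap F x e.symm
    let c' : power x _ ⟶ x := c
    change laxBigTensor F _ ≫ F.map (powerMap x e.symm ≫ c') =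
      powerMap _ e.symm ≫ laxBigTensor F _ ≫ F.map c'
    rw [F.map_comp, reassoc_of% h]
  app_one := by
    have h := laxBigTensor_powerMap F x (Equiv.ofUnique (Fin 1) Unit)
    simp only [endoSet, F.map_comp]
    rw [reassoc_of% h]
    change _ ≫ (_ ◁ ε F ≫ μ F _ _) ≫ _ = _
    simp
  app_comp n c d := by
    have h := laxBigTensor_powerMap F x (finSigmaFinEquiv (n := n)).symm
    simp only [endoSet, F.map_comp]
    rw [reassoc_of% h]
    erw [laxBigTensor_sigmaComp]

end Lax

section Arrow
variable {C : Type u} [Category.{v} C] [MonoidalCategory C] [SymmetricCategory C]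
  {y z : C} (f : y ⟶ z)

/-- The tensor power `f ^ n` of a morphism. -/
noncomputable def powerHom (ι : Type) [Enum ι] :
    bigTensor (fun _ : ι => y) ⟶ bigTensor (fun _ : ι => z) :=
  bigTensorHom fun _ => f

lemma powerMap_powerHom {ι κ : Type} [Enum ι] [Enum κ] (e : ι ≃ κ) :
    powerMap y e ≫ powerHom f κ = powerHom f ι ≫ powerMap z e := by
  have h := bigTensorMap_comp (X := fun _ : κ => z) e.bijective Function.bijective_id
    (fun _ => 𝟙 y) (fun _ => f)
  have h1 := bigTensorMap_comp (X := fun _ : κ => z) Function.bijective_id e.bijective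
    (fun _ => f) (fun _ => 𝟙 z)
  rw [Category.comp_id] at h1
  rw [Category.id_comp] at h
  exact h.trans h1.symm

lemma sigmaComp_powerHom {ι : Type} [Enum ι] {S : ι → Type} [∀ i, Enum (S i)]
    {c : bigTensor (fun _ : ι => y) ⟶ y} {d : ∀ i, bigTensor (fun _ : S i => y) ⟶ y}
    {c' : bigTensor (fun _ : ι => z) ⟶ z} {d' : ∀ i, bigTensor (fun _ : S i => z) ⟶ z}
    (hc : c ≫ f = powerHom f ι ≫ c') (hd : ∀ i, d i ≫ f = powerHom f (S i) ≫ d' i) :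
    sigmaComp c d ≫ f = powerHom f (Σ i, S i) ≫ sigmaComp c' d' := by
  have h1 := bigTensorMap_sigma (S := S) (S' := S) (Y := fun _ => y)
    (X := fun _ => z) (σ := fun i : ι => i) Function.bijective_id (τ := fun i s => s)
    (fun i => Function.bijective_id) (fun _ => f)
  change powerHom f (Σ i, S i) ≫ _ = _ ≫ bigTensorHom (fun i => powerHom f (S i)) at h1
  have h2 := bigTensorHom_comp (fun i => powerHom f (S i)) d'
  have h3 := bigTensorHom_comp d (fun _ => f)
  simp only [sigmaComp, Category.assoc, hc]
  rw [reassoc_of% h1, reassoc_of% h2, powerHom, reassoc_of% h3]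
  simp only [hd]

/-- The endomorphism operad of a morphism `f : y ⟶ z`: its `n`-ary operations are the pairs of an
`n`-ary operation on `y` and an `n`-ary operation on `z` which are compatible with `f`. -/
noncomputable def endoArrow : Operad.{v} where
  Op n := { c : (endoSet y).Op n × (endoSet z).Op n // c.1 ≫ f = powerHom f (Fin n) ≫ c.2 }
  act e c := ⟨((endoSet y).act e c.1.1, (endoSet z).act e c.1.2), by
    have h := powerMap_powerHom f e.symm
    simp only [endoSet, Category.assoc, c.2]
    rw [reassoc_of% h]⟩
  one := ⟨((endoSet y).one, (endoSet z).one), by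
    have h := powerMap_powerHom f (Equiv.ofUnique (Fin 1) Unit)
    have h1 : powerHom f Unit = f ▷ _ := bigTensorHom_unit _
    simp only [endoSet, Category.assoc]
    rw [← reassoc_of% h, h1]
    simp⟩
  comp n c d := ⟨((endoSet y).comp n c.1.1 (fun i => (d i).1.1),
      (endoSet z).comp n c.1.2 (fun i => (d i).1.2)), by
    have h := powerMap_powerHom f (finSigmaFinEquiv (n := n)).symm
    have h1 := sigmaComp_powerHom f c.2 (fun i => (d i).2)
    simp only [endoSet, Category.assoc]
    erw [h1, reassoc_of% h]⟩
  act_refl c := Subtype.ext (Prod.ext ((endoSet y).act_refl _) ((endoSet z).act_refl _))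
  act_trans e e' c :=
    Subtype.ext (Prod.ext ((endoSet y).act_trans _ _ _) ((endoSet z).act_trans _ _ _))
  comp_act_left σ n c d :=
    Subtype.ext (Prod.ext ((endoSet y).comp_act_left _ _ _ _) ((endoSet z).comp_act_left _ _ _ _))
  comp_act_right n n' τ c d :=
    Subtype.ext (Prod.ext ((endoSet y).comp_act_right _ _ _ _ _)
      ((endoSet z).comp_act_right _ _ _ _ _))
  one_comp n d :=
    Subtype.ext (Prod.ext ((endoSet y).one_comp _ _) ((endoSet z).one_comp _ _))
  comp_one c := Subtype.ext (Prod.ext ((endoSet y).comp_one _) ((endoSet z).comp_one _))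
  comp_assoc n m c d e :=
    Subtype.ext (Prod.ext ((endoSet y).comp_assoc _ _ _ _ _) ((endoSet z).comp_assoc _ _ _ _ _))

/-- The projection to the endomorphism operad of the source. -/
noncomputable def endoArrowSource : endoArrow f ⟶ endoSet y where
  app _ c := c.1.1
  app_act _ _ := rfl
  app_one := rfl
  app_comp _ _ _ := rfl

/-- The projection to the endomorphism operad of the target. -/
noncomputable def endoArrowTarget : endoArrow f ⟶ endoSet z where
  app _ c := c.1.2
  app_act _ _ := rfl
  app_one := rfl
  app_comp _ _ _ := rfl

end Arrow

open SimplicialCategory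

section Simplices
variable {D : Type u} [Category.{v} D] [SimplicialCategory D]

/-- The composite of two `d`-simplices of mapping spaces. -/
def sComp {d : SimplexCategoryᵒᵖ} {x y z : D} (f : (sHom x y).obj d) (g : (sHom y z).obj d) :
    (sHom x z).obj d :=
  (sHomComp x y z).app d ⟨f, g⟩

/-- The degenerate `d`-simplex given by a morphism. -/
def sConst (d : SimplexCategoryᵒᵖ) {x y : D} (f : x ⟶ y) : (sHom x y).obj d :=
  (eHomEquiv SSet.{v} f).app d PUnit.unit

variable {d e : SimplexCategoryᵒᵖ} {w x y z : D}

lemma sConst_comp (f : x ⟶ y) (g : y ⟶ z) :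
    sConst d (f ≫ g) = sComp (sConst d f) (sConst d g) := by
  rw [sConst, eHomEquiv_comp]
  rfl

lemma sConst_map (θ : d ⟶ e) (f : x ⟶ y) : (sHom x y).map θ (sConst d f) = sConst e f :=
  (NatTrans.naturality_apply (eHomEquiv SSet.{v} f) θ PUnit.unit).symm

lemma sComp_map (θ : d ⟶ e) (f : (sHom x y).obj d) (g : (sHom y z).obj d) :
    (sHom x z).map θ (sComp f g) = sComp ((sHom x y).map θ f) ((sHom y z).map θ g) :=
  (NatTrans.naturality_apply (sHomComp x y z) θ (⟨f, g⟩ : (sHom x y ⊗ sHom y z).obj d)).symm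

lemma sConst_id_comp (f : (sHom x y).obj d) : sComp (sConst d (𝟙 x)) f = f := by
  have h := ConcreteCategory.congr_hom (congrArg (fun k => NatTrans.app k d)
    (e_id_comp SSet.{v} x y)) f
  rw [sConst, eHomEquiv_id]
  exact h

lemma sComp_const_id (f : (sHom x y).obj d) : sComp f (sConst d (𝟙 y)) = f := by
  have h := ConcreteCategory.congr_hom (congrArg (fun k => NatTrans.app k d)
    (e_comp_id SSet.{v} x y)) f
  rw [sConst, eHomEquiv_id]
  exact h

lemma sComp_assoc (f : (sHom w x).obj d) (g : (sHom x y).obj d) (h : (sHom y z).obj d) :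
    sComp (sComp f g) h = sComp f (sComp g h) :=
  ConcreteCategory.congr_hom (congrArg (fun k => NatTrans.app k d)
    (e_assoc SSet.{v} w x y z)) (⟨f, g, h⟩ : (sHom w x ⊗ sHom x y ⊗ sHom y z).obj d)

end Simplices

/-- A simplicial structure on the tensor product of a symmetric monoidal category with a
simplicial enrichment: maps `Map(x, y) × Map(x', y') ⟶ Map(x ⊗ x', y ⊗ y')` which extend the tensor
product of morphisms, which are compatible with the composition, and for which the associativity,
unit and symmetry isomorphisms are natural. -/
class SimplicialTensor (D : Type u) [Category.{v} D] [MonoidalCategory D] [SymmetricCategory D]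
    [SimplicialCategory D] where
  tensor (x y x' y' : D) : sHom x y ⊗ sHom x' y' ⟶ sHom (x ⊗ x') (y ⊗ y')
  tensor_const (d : SimplexCategoryᵒᵖ) {x y x' y' : D} (f : x ⟶ y) (f' : x' ⟶ y') :
    (tensor x y x' y').app d ⟨sConst d f, sConst d f'⟩ = sConst d (f ⊗ₘ f')
  tensor_comp (d : SimplexCategoryᵒᵖ) {x y z x' y' z' : D} (f : (sHom x y).obj d)
    (g : (sHom y z).obj d) (f' : (sHom x' y').obj d) (g' : (sHom y' z').obj d) :
    (tensor x z x' z').app d ⟨sComp f g, sComp f' g'⟩ =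
      sComp ((tensor x y x' y').app d ⟨f, f'⟩) ((tensor y z y' z').app d ⟨g, g'⟩)
  associator_natural (d : SimplexCategoryᵒᵖ) {x y x' y' x'' y'' : D} (f : (sHom x y).obj d)
    (f' : (sHom x' y').obj d) (f'' : (sHom x'' y'').obj d) :
    sComp ((tensor _ _ _ _).app d ⟨(tensor _ _ _ _).app d ⟨f, f'⟩, f''⟩)
        (sConst d (α_ y y' y'').hom) =
      sComp (sConst d (α_ x x' x'').hom)
        ((tensor _ _ _ _).app d ⟨f, (tensor _ _ _ _).app d ⟨f', f''⟩⟩)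
  leftUnitor_natural (d : SimplexCategoryᵒᵖ) {x y : D} (f : (sHom x y).obj d) :
    sComp ((tensor _ _ _ _).app d ⟨sConst d (𝟙 (𝟙_ D)), f⟩) (sConst d (λ_ y).hom) =
      sComp (sConst d (λ_ x).hom) f
  rightUnitor_natural (d : SimplexCategoryᵒᵖ) {x y : D} (f : (sHom x y).obj d) :
    sComp ((tensor _ _ _ _).app d ⟨f, sConst d (𝟙 (𝟙_ D))⟩) (sConst d (ρ_ y).hom) =
      sComp (sConst d (ρ_ x).hom) f
  braiding_natural (d : SimplexCategoryᵒᵖ) {x y x' y' : D} (f : (sHom x y).obj d)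
    (f' : (sHom x' y').obj d) :
    sComp ((tensor _ _ _ _).app d ⟨f, f'⟩) (sConst d (β_ y y').hom) =
      sComp (sConst d (β_ x x').hom) ((tensor _ _ _ _).app d ⟨f', f⟩)

/-- The category with the same objects as `D` whose morphisms are the `d`-simplices of the mapping
spaces of `D`. -/
def Level (D : Type u) (_ : SimplexCategoryᵒᵖ) : Type u := D

section Level
variable {D : Type u} [Category.{v} D] [SimplicialCategory D] {d e : SimplexCategoryᵒᵖ}

/-- An object of `D`, as an object of `Level D d`. -/
abbrev toLevel (d : SimplexCategoryᵒᵖ) (x : D) : Level D d := x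

/-- The object of `D` underlying an object of `Level D d`. -/
abbrev Level.under (x : Level D d) : D := x

instance : Category.{v} (Level D d) where
  Hom x y := (sHom x.under y.under).obj d
  id x := sConst d (𝟙 x.under)
  comp f g := sComp f g
  id_comp f := sConst_id_comp f
  comp_id f := sComp_const_id f
  assoc f g h := sComp_assoc f g h

/-- A morphism of `D`, as a morphism of `Level D d`. -/
def toLevelHom (d : SimplexCategoryᵒᵖ) {x y : D} (f : x ⟶ y) : toLevel d x ⟶ toLevel d y :=
  sConst d f

lemma toLevelHom_id (x : D) : toLevelHom d (𝟙 x) = 𝟙 _ := rfl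

lemma toLevelHom_comp {x y z : D} (f : x ⟶ y) (g : y ⟶ z) :
    toLevelHom d (f ≫ g) = toLevelHom d f ≫ toLevelHom d g :=
  sConst_comp f g

/-- An isomorphism of `D`, as an isomorphism of `Level D d`. -/
def toLevelIso (d : SimplexCategoryᵒᵖ) {x y : D} (f : x ≅ y) : toLevel d x ≅ toLevel d y where
  hom := toLevelHom d f.hom
  inv := toLevelHom d f.inv
  hom_inv_id := by rw [← toLevelHom_comp, f.hom_inv_id, toLevelHom_id]
  inv_hom_id := by rw [← toLevelHom_comp, f.inv_hom_id, toLevelHom_id]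

/-- The functor given by the simplicial structure maps of the mapping spaces. -/
def levelMap (D : Type u) [Category.{v} D] [SimplicialCategory D] {d e : SimplexCategoryᵒᵖ}
    (θ : d ⟶ e) : Level D d ⥤ Level D e where
  obj x := toLevel e x.under
  map {x y} f := (sHom x.under y.under).map θ f
  map_id x := sConst_map θ (𝟙 x.under)
  map_comp f g := sComp_map θ f g

lemma levelMap_toLevelHom (θ : d ⟶ e) {x y : D} (f : x ⟶ y) :
    (levelMap D θ).map (toLevelHom d f) = toLevelHom e f :=
  sConst_map θ f

variable [MonoidalCategory D] [SymmetricCategory D] [SimplicialTensor D]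

instance : MonoidalCategoryStruct (Level D d) where
  tensorObj x y := toLevel d (x.under ⊗ y.under)
  tensorHom {x y x' y'} f f' :=
    (SimplicialTensor.tensor x.under y.under x'.under y'.under).app d ⟨f, f'⟩
  whiskerLeft x y y' f :=
    (SimplicialTensor.tensor x.under x.under y.under y'.under).app d ⟨𝟙 x, f⟩
  whiskerRight {x x'} f y :=
    (SimplicialTensor.tensor x.under x'.under y.under y.under).app d ⟨f, 𝟙 y⟩
  tensorUnit := toLevel d (𝟙_ D)
  associator x y z := toLevelIso d (α_ x.under y.under z.under)
  leftUnitor x := toLevelIso d (λ_ x.under)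
  rightUnitor x := toLevelIso d (ρ_ x.under)

lemma toLevelHom_tensor {x y x' y' : D} (f : x ⟶ y) (f' : x' ⟶ y') :
    toLevelHom d (f ⊗ₘ f') = toLevelHom d f ⊗ₘ toLevelHom d f' :=
  (SimplicialTensor.tensor_const d f f').symm

instance : MonoidalCategory (Level D d) :=
  MonoidalCategory.ofTensorHom
    (id_tensorHom_id := fun x y =>
      (toLevelHom_tensor (d := d) (𝟙 x.under) (𝟙 y.under)).symm.trans
        (congrArg (toLevelHom d) (id_tensorHom_id _ _)))
    (id_tensorHom := fun _ _ _ _ => rfl)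
    (tensorHom_id := fun _ _ => rfl)
    (tensorHom_comp_tensorHom := fun f f' g g' => (SimplicialTensor.tensor_comp d f g f' g').symm)
    (associator_naturality := fun f f' f'' => SimplicialTensor.associator_natural d f f' f'')
    (leftUnitor_naturality := fun f => SimplicialTensor.leftUnitor_natural d f)
    (rightUnitor_naturality := fun f => SimplicialTensor.rightUnitor_natural d f)
    (pentagon := fun w x y z => by
      have h := congrArg (toLevelHom d) (pentagon w.under x.under y.under z.under)
      simp only [← tensorHom_id, ← id_tensorHom, toLevelHom_comp, toLevelHom_tensor] at h
      exact h)
    (triangle := fun x y => by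
      have h := congrArg (toLevelHom d) (triangle x.under y.under)
      simp only [← tensorHom_id, ← id_tensorHom, toLevelHom_comp, toLevelHom_tensor] at h
      exact h)

lemma toLevelHom_whiskerLeft (x : D) {y y' : D} (f : y ⟶ y') :
    toLevelHom d (x ◁ f) = toLevel d x ◁ toLevelHom d f := by
  rw [← id_tensorHom, toLevelHom_tensor]
  rfl

lemma toLevelHom_whiskerRight {x x' : D} (f : x ⟶ x') (y : D) :
    toLevelHom d (f ▷ y) = toLevelHom d f ▷ toLevel d y := by
  rw [← tensorHom_id, toLevelHom_tensor]
  rfl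

instance : BraidedCategory (Level D d) where
  braiding x y := toLevelIso d (β_ x.under y.under)
  braiding_naturality_right x _ _ f := SimplicialTensor.braiding_natural d (𝟙 x) f
  braiding_naturality_left f z := SimplicialTensor.braiding_natural d f (𝟙 z)
  hexagon_forward x y z := by
    have h := congrArg (toLevelHom d)
      (BraidedCategory.hexagon_forward x.under y.under z.under)
    simp only [toLevelHom_comp, toLevelHom_whiskerLeft, toLevelHom_whiskerRight] at h
    exact h
  hexagon_reverse x y z := by
    have h := congrArg (toLevelHom d)
      (BraidedCategory.hexagon_reverse x.under y.under z.under)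
    simp only [toLevelHom_comp, toLevelHom_whiskerLeft, toLevelHom_whiskerRight] at h
    exact h

instance : SymmetricCategory (Level D d) where
  symmetry x y := by
    have h := congrArg (toLevelHom d) (SymmetricCategory.symmetry x.under y.under)
    rw [toLevelHom_comp] at h
    exact h

lemma levelMap_tensor (θ : d ⟶ e) {x y x' y' : Level D d} (f : x ⟶ y) (f' : x' ⟶ y') :
    (levelMap D θ).map (f ⊗ₘ f') = (levelMap D θ).map f ⊗ₘ (levelMap D θ).map f' :=
  (NatTrans.naturality_apply (SimplicialTensor.tensor x.under y.under x'.under y'.under) θ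
    (⟨f, f'⟩ : (sHom x.under y.under ⊗ sHom x'.under y'.under).obj d)).symm

instance (θ : d ⟶ e) : (levelMap D θ).LaxMonoidal :=
  Functor.LaxMonoidal.ofTensorHom
    (ε := 𝟙 (toLevel e (𝟙_ D)))
    (μ := fun x y => 𝟙 (toLevel e (x.under ⊗ y.under)))
    (μ_natural := fun f g => by
      rw [levelMap_tensor]
      exact (Category.comp_id _).trans (Category.id_comp _).symm)
    (associativity := fun x y z => by
      erw [id_tensorHom_id, id_tensorHom_id, Category.id_comp, Category.id_comp, Category.comp_id,
        Category.comp_id]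
      exact levelMap_toLevelHom θ _)
    (left_unitality := fun x => by
      erw [id_tensorHom_id, Category.id_comp, Category.id_comp]
      exact (levelMap_toLevelHom θ _).symm)
    (right_unitality := fun x => by
      erw [id_tensorHom_id, Category.id_comp, Category.id_comp]
      exact (levelMap_toLevelHom θ _).symm)

instance (θ : d ⟶ e) : (levelMap D θ).LaxBraided where
  braided x y := by
    erw [Category.id_comp, Category.comp_id]
    exact levelMap_toLevelHom θ _


end Level

lemma comp_map_of_eq {C : Type u} [Category.{v} C] {C' : Type u'} [Category.{v'} C'] (G : C ⥤ C')
    {W : C'} {X Y Z : C} {l : W ⟶ G.obj Y} {l' : W ⟶ G.obj X} {f : X ⟶ Y} (h : l = l' ≫ G.map f)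
    {g : G.obj Y ⟶ G.obj Z} {g' : Y ⟶ Z} (h' : g = G.map g') :
    l ≫ g = l' ≫ G.map (f ≫ g') := by
  rw [h, h', G.map_comp, Category.assoc]

lemma comp_map_square {C : Type u} [Category.{v} C] {C' : Type u'} [Category.{v'} C'] (G : C ⥤ C')
    {W W' : C'} {X Y Z Z' : C} {l : W ⟶ G.obj X} {l' : W' ⟶ G.obj Y} {p : X ⟶ Y} {p' : W ⟶ W'}
    (h : l ≫ G.map p = p' ≫ l') {a : X ⟶ Z'} {f : Z' ⟶ Z} {b : Y ⟶ Z} (h' : a ≫ f = p ≫ b)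
    {f' : G.obj Z' ⟶ G.obj Z} (h'' : f' = G.map f) :
    (l ≫ G.map a) ≫ f' = p' ≫ l' ≫ G.map b := by
  rw [h'', Category.assoc, ← G.map_comp, h', G.map_comp, reassoc_of% h]

section Endo
variable {D : Type u} [Category.{v} D] [MonoidalCategory D] [SymmetricCategory D]
  [SimplicialCategory D] [SimplicialTensor D] {d e k : SimplexCategoryᵒᵖ}

lemma levelMap_whiskerLeft (θ : d ⟶ e) (a : Level D d) {x y : Level D d} (f : x ⟶ y) :
    (levelMap D θ).map (a ◁ f) = (levelMap D θ).obj a ◁ (levelMap D θ).map f := by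
  rw [← id_tensorHom, levelMap_tensor]
  erw [CategoryTheory.Functor.map_id, id_tensorHom]

lemma laxTens_levelMap_id {ι : Type} (X : ι → Level D d) (l : List ι) :
    laxTens (levelMap D (𝟙 d)) X l = 𝟙 (tens X l) := by
  induction l with
  | nil => rfl
  | cons a l ih =>
    rw [laxTens, ih]
    erw [MonoidalCategory.whiskerLeft_id, Category.id_comp]
    rfl

lemma laxTens_levelMap_comp (θ : d ⟶ e) (η : e ⟶ k) {ι : Type} (X : ι → Level D d)
    (l : List ι) :
    laxTens (levelMap D (θ ≫ η)) X l =
      laxTens (levelMap D η) (fun i => (levelMap D θ).obj (X i)) l ≫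
        (levelMap D η).map (laxTens (levelMap D θ) X l) := by
  induction l with
  | nil => exact ((Category.id_comp _).trans ((levelMap D η).map_id _)).symm
  | cons a l ih =>
    rw [laxTens, laxTens, laxTens, ih]
    erw [Category.comp_id, Category.comp_id, Category.comp_id, levelMap_whiskerLeft,
      MonoidalCategory.whiskerLeft_comp]
    rfl

/-- The endomorphism operad of an object: the simplicial operad whose space of `n`-ary operations is
the mapping space `Map(x ^ n, x)`. -/
noncomputable def endo (x : D) : SimplicialObject Operad.{v} where
  obj d := endoSet (toLevel d x)
  map {d e} θ := endoMap (levelMap D θ) (toLevel d x)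
  map_id d := by
    refine Operad.Hom.ext (funext fun n => funext fun c => ?_)
    change laxTens (levelMap D (𝟙 d)) (fun _ : Fin n => toLevel d x) Enum.list ≫
      (levelMap D (𝟙 d)).map (c : power (toLevel d x) n ⟶ toLevel d x) = c
    rw [laxTens_levelMap_id]
    refine (Category.id_comp _).trans ?_
    exact ConcreteCategory.congr_hom ((sHom (power (toLevel d x) n).under x).map_id d) c
  map_comp {d e k} θ η := by
    refine Operad.Hom.ext (funext fun n => funext fun c => ?_)
    let c' : power (toLevel d x) n ⟶ toLevel d x := c
    change laxTens (levelMap D (θ ≫ η)) (fun _ : Fin n => toLevel d x) Enum.list ≫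
        (levelMap D (θ ≫ η)).map c' =
      laxTens (levelMap D η) (fun _ : Fin n => toLevel e x) Enum.list ≫ (levelMap D η).map
        (laxTens (levelMap D θ) (fun _ : Fin n => toLevel d x) Enum.list ≫
          (levelMap D θ).map c')
    exact comp_map_of_eq (levelMap D η)
      (laxTens_levelMap_comp θ η (fun _ : Fin n => toLevel d x) Enum.list)
      (ConcreteCategory.congr_hom ((sHom (power (toLevel d x) n).under x).map_comp θ η) c)

lemma levelMap_powerHom (θ : d ⟶ e) {y z : D} (f : y ⟶ z) (n : ℕ) :
    laxBigTensor (levelMap D θ) (fun _ => toLevel d y) ≫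
      (levelMap D θ).map (powerHom (toLevelHom d f) (Fin n)) =
      powerHom (toLevelHom e f) (Fin n) ≫
        laxBigTensor (levelMap D θ) (fun _ => toLevel d z) := by
  have h := laxBigTensor_map (levelMap D θ) (Y := fun _ : Fin n => toLevel d y)
    (X := fun _ : Fin n => toLevel d z) Function.bijective_id (fun _ => toLevelHom d f)
  rw [levelMap_toLevelHom] at h
  exact h

/-- The endomorphism operad of a morphism `f : y ⟶ z`: the simplicial operad whose space of `n`-ary
operations is the fibre product of `Map(y ^ n, y)` and `Map(z ^ n, z)` over `Map(y ^ n, z)`. -/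
noncomputable def endoHom {y z : D} (f : y ⟶ z) : SimplicialObject Operad.{v} where
  obj d := endoArrow (toLevelHom d f)
  map {d e} θ :=
    { app n c := ⟨(((endo y).map θ).app n c.1.1, ((endo z).map θ).app n c.1.2), by
        obtain ⟨⟨a, b⟩, hab⟩ := c
        have h := levelMap_powerHom θ f n
        let a' : power (toLevel d y) n ⟶ toLevel d y := a
        let b' : power (toLevel d z) n ⟶ toLevel d z := b
        have h1 : a' ≫ toLevelHom d f = powerHom (toLevelHom d f) (Fin n) ≫ b' := hab
        exact comp_map_square (levelMap D θ) h h1 (levelMap_toLevelHom θ f).symm⟩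
      app_act a c := Subtype.ext (Prod.ext (((endo y).map θ).app_act a c.1.1)
        (((endo z).map θ).app_act a c.1.2))
      app_one := Subtype.ext (Prod.ext ((endo y).map θ).app_one ((endo z).map θ).app_one)
      app_comp n c b := Subtype.ext (Prod.ext
        (((endo y).map θ).app_comp n c.1.1 (fun i => (b i).1.1))
        (((endo z).map θ).app_comp n c.1.2 (fun i => (b i).1.2))) }
  map_id d := by
    refine Operad.Hom.ext (funext fun n => funext fun c => Subtype.ext (Prod.ext ?_ ?_))
    · exact congrArg (fun h => Operad.Hom.app h n c.1.1) ((endo y).map_id d)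
    · exact congrArg (fun h => Operad.Hom.app h n c.1.2) ((endo z).map_id d)
  map_comp θ η := by
    refine Operad.Hom.ext (funext fun n => funext fun c => Subtype.ext (Prod.ext ?_ ?_))
    · exact congrArg (fun h => Operad.Hom.app h n c.1.1) ((endo y).map_comp θ η)
    · exact congrArg (fun h => Operad.Hom.app h n c.1.2) ((endo z).map_comp θ η)

/-- The projection to the endomorphism operad of the source. -/
noncomputable def endoHomSource {y z : D} (f : y ⟶ z) : endoHom f ⟶ endo y where
  app d := endoArrowSource (toLevelHom d f)

/-- The projection to the endomorphism operad of the target. -/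
noncomputable def endoHomTarget {y z : D} (f : y ⟶ z) : endoHom f ⟶ endo z where
  app d := endoArrowTarget (toLevelHom d f)

end Endo

/-- A simplicial structure on a functor: an extension of its action on morphisms to maps of mapping
spaces, compatible with the composition. -/
class SimplicialFunctor {D : Type u} [Category.{v} D] [SimplicialCategory D] {D' : Type u'}
    [Category.{v} D'] [SimplicialCategory D'] (F : D ⥤ D') where
  sMap (x y : D) : sHom x y ⟶ sHom (F.obj x) (F.obj y)
  sMap_const (d : SimplexCategoryᵒᵖ) {x y : D} (f : x ⟶ y) :
    (sMap x y).app d (sConst d f) = sConst d (F.map f)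
  sMap_comp (d : SimplexCategoryᵒᵖ) {x y z : D} (f : (sHom x y).obj d) (g : (sHom y z).obj d) :
    (sMap x z).app d (sComp f g) = sComp ((sMap x y).app d f) ((sMap y z).app d g)

section Functors
variable {D : Type u} [Category.{v} D] [SimplicialCategory D] {D' : Type u'}
    [Category.{v} D'] [SimplicialCategory D'] (F : D ⥤ D') [SimplicialFunctor F]

/-- The functor given by the `d`-simplices of a simplicial functor. -/
def levelFunctor (d : SimplexCategoryᵒᵖ) : Level D d ⥤ Level D' d where
  obj x := toLevel d (F.obj x.under)
  map {x y} f := (SimplicialFunctor.sMap (F := F) x.under y.under).app d f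
  map_id x := by
    refine (SimplicialFunctor.sMap_const d (𝟙 x.under)).trans ?_
    rw [F.map_id]
    rfl
  map_comp f g := SimplicialFunctor.sMap_comp d f g

lemma levelFunctor_toLevelHom {d : SimplexCategoryᵒᵖ} {x y : D} (f : x ⟶ y) :
    (levelFunctor F d).map (toLevelHom d f) = toLevelHom d (F.map f) :=
  SimplicialFunctor.sMap_const d f

lemma levelFunctor_levelMap {d e : SimplexCategoryᵒᵖ} (θ : d ⟶ e) {x y : Level D d} (f : x ⟶ y) :
    (levelFunctor F e).map ((levelMap D θ).map f) =
      (levelMap D' θ).map ((levelFunctor F d).map f) :=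
  NatTrans.naturality_apply (SimplicialFunctor.sMap (F := F) x.under y.under) θ f

end Functors

section LaxFunctors
open Functor.LaxMonoidal
variable {D : Type u} [Category.{v} D] [MonoidalCategory D] [SymmetricCategory D]
  [SimplicialCategory D] [SimplicialTensor D] {D' : Type u'} [Category.{v} D']
  [MonoidalCategory D'] [SymmetricCategory D'] [SimplicialCategory D'] [SimplicialTensor D']

/-- A simplicial lax symmetric monoidal functor: the structure morphisms
`F x ⊗ F y ⟶ F (x ⊗ y)` of the lax symmetric monoidal functor `F` are natural with respect to the
simplices of the mapping spaces. -/
class SimplicialLaxFunctor (F : D ⥤ D') extends F.LaxBraided, SimplicialFunctor F where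
  sMap_tensor (d : SimplexCategoryᵒᵖ) {x y x' y' : D} (f : (sHom x y).obj d)
    (f' : (sHom x' y').obj d) :
    sComp ((SimplicialTensor.tensor _ _ _ _).app d ⟨(sMap x y).app d f, (sMap x' y').app d f'⟩)
        (sConst d (Functor.LaxMonoidal.μ F y y')) =
      sComp (sConst d (Functor.LaxMonoidal.μ F x x'))
        ((sMap _ _).app d ((SimplicialTensor.tensor _ _ _ _).app d ⟨f, f'⟩))

variable (F : D ⥤ D') [SimplicialLaxFunctor F]

instance (d : SimplexCategoryᵒᵖ) : (levelFunctor F d).LaxMonoidal :=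
  Functor.LaxMonoidal.ofTensorHom
    (ε := toLevelHom d (ε F))
    (μ := fun x y => toLevelHom d (μ F x.under y.under))
    (μ_natural := fun f g => SimplicialLaxFunctor.sMap_tensor d f g)
    (associativity := fun x y z => by
      have h := congrArg (toLevelHom d) (associativity F x.under y.under z.under)
      simp only [toLevelHom_comp, toLevelHom_whiskerLeft, toLevelHom_whiskerRight,
        ← levelFunctor_toLevelHom] at h
      exact h)
    (left_unitality := fun x => by
      have h := congrArg (toLevelHom d) (left_unitality F x.under)
      simp only [toLevelHom_comp, toLevelHom_whiskerLeft, toLevelHom_whiskerRight,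
        ← levelFunctor_toLevelHom] at h
      exact h)
    (right_unitality := fun x => by
      have h := congrArg (toLevelHom d) (right_unitality F x.under)
      simp only [toLevelHom_comp, toLevelHom_whiskerLeft, toLevelHom_whiskerRight,
        ← levelFunctor_toLevelHom] at h
      exact h)

instance (d : SimplexCategoryᵒᵖ) : (levelFunctor F d).LaxBraided where
  braided x y := by
    have h := congrArg (toLevelHom d) (Functor.LaxBraided.braided (F := F) x.under y.under)
    simp only [toLevelHom_comp, ← levelFunctor_toLevelHom] at h
    exact h

lemma laxTens_comp_cons {C C' C'' : Type*} [Category.{v} C] [MonoidalCategory C]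
    [SymmetricCategory C] [Category.{v} C'] [MonoidalCategory C'] [SymmetricCategory C']
    [Category.{v} C''] [MonoidalCategory C''] [SymmetricCategory C'']
    (G : C ⥤ C') [G.LaxBraided] (H : C' ⥤ C'') [H.LaxBraided] {ι : Type} (X : ι → C)
    (a : ι) (l : List ι) :
    laxTens H (fun i => G.obj (X i)) (a :: l) ≫ H.map (laxTens G X (a :: l)) =
      H.obj (G.obj (X a)) ◁
          (laxTens H (fun i => G.obj (X i)) l ≫ H.map (laxTens G X l)) ≫
        μ H (G.obj (X a)) (G.obj (tens X l)) ≫ H.map (μ G (X a) (tens X l)) := by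
  rw [laxTens, laxTens, H.map_comp, MonoidalCategory.whiskerLeft_comp]
  simp only [Category.assoc]
  rw [μ_natural_right_assoc]

lemma level_μ {d e : SimplexCategoryᵒᵖ} (θ : d ⟶ e) (x y : Level D d) :
    μ (levelFunctor F e) ((levelMap D θ).obj x) ((levelMap D θ).obj y) ≫
        (levelFunctor F e).map (μ (levelMap D θ) x y) =
      μ (levelMap D' θ) ((levelFunctor F d).obj x) ((levelFunctor F d).obj y) ≫
        (levelMap D' θ).map (μ (levelFunctor F d) x y) := by
  have h : (levelFunctor F e).map (𝟙 (toLevel e (x.under ⊗ y.under))) = 𝟙 _ :=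
    (levelFunctor F e).map_id _
  change toLevelHom e (μ F x.under y.under) ≫
      (levelFunctor F e).map (𝟙 (toLevel e (x.under ⊗ y.under))) =
    𝟙 _ ≫ (levelMap D' θ).map (toLevelHom d (μ F x.under y.under))
  rw [h, levelMap_toLevelHom]
  exact (Category.comp_id _).trans (Category.id_comp _).symm

lemma comp_map_assoc {C C' : Type*} [Category.{v} C] [Category.{v} C'] (G : C ⥤ C') {W : C'}
    {X Y Z : C} (l : W ⟶ G.obj X) (f : X ⟶ Y) (g : Y ⟶ Z) :
    (l ≫ G.map f) ≫ G.map g = l ≫ G.map (f ≫ g) := by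
  rw [G.map_comp, Category.assoc]

lemma laxTens_level {d e : SimplexCategoryᵒᵖ} (θ : d ⟶ e) {ι : Type} (X : ι → Level D d)
    (l : List ι) :
    laxTens (levelFunctor F e) (fun i => (levelMap D θ).obj (X i)) l ≫
        (levelFunctor F e).map (laxTens (levelMap D θ) X l) =
      laxTens (levelMap D' θ) (fun i => (levelFunctor F d).obj (X i)) l ≫
        (levelMap D' θ).map (laxTens (levelFunctor F d) X l) := by
  induction l with
  | nil =>
    have h : (levelFunctor F e).map (𝟙 (𝟙_ (Level D e))) = 𝟙 _ := (levelFunctor F e).map_id _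
    change toLevelHom e (ε F) ≫ (levelFunctor F e).map (𝟙 (𝟙_ (Level D e))) =
      𝟙 _ ≫ (levelMap D' θ).map (toLevelHom d (ε F))
    rw [h, levelMap_toLevelHom]
    exact (Category.comp_id _).trans (Category.id_comp _).symm
  | cons a l ih =>
    have h := laxTens_comp_cons (levelMap D θ) (levelFunctor F e) X a l
    have h' := laxTens_comp_cons (levelFunctor F d) (levelMap D' θ) X a l
    rw [h, h', ih]
    exact congrArg (fun k => _ ≫ k) (level_μ F θ (X a) (tens X l))

/-- The morphism of endomorphism operads induced by a simplicial lax symmetric monoidal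
functor. -/
noncomputable def endoFunctor (x : D) : endo x ⟶ endo (F.obj x) where
  app d := endoMap (levelFunctor F d) (toLevel d x)
  naturality d e θ := by
    refine Operad.Hom.ext (funext fun n => funext fun c => ?_)
    let c' : power (toLevel d x) n ⟶ toLevel d x := c
    change laxTens (levelFunctor F e) (fun _ : Fin n => toLevel e x) Enum.list ≫
        (levelFunctor F e).map (laxTens (levelMap D θ) (fun _ : Fin n => toLevel d x) Enum.list ≫
          (levelMap D θ).map c') =
      laxTens (levelMap D' θ) (fun _ : Fin n => toLevel d (F.obj x)) Enum.list ≫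
        (levelMap D' θ).map
          (laxTens (levelFunctor F d) (fun _ : Fin n => toLevel d x) Enum.list ≫
            (levelFunctor F d).map c')
    have h := laxTens_level F θ (fun _ : Fin n => toLevel d x) Enum.list
    exact (comp_map_assoc (levelFunctor F e) _ _ _).symm.trans
      ((congrArg₂ (fun k k' => k ≫ k') h (levelFunctor_levelMap F θ c')).trans
        (comp_map_assoc (levelMap D' θ) _ _ _))

end LaxFunctors

section Arity
open Functor.LaxMonoidal
variable {D : Type u} [Category.{v} D] [MonoidalCategory D] [SymmetricCategory D]
  [SimplicialCategory D] [SimplicialTensor D] {d e : SimplexCategoryᵒᵖ}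

/-- The functor sending morphisms to degenerate simplices. -/
def levelInclusion (D : Type u) [Category.{v} D] [SimplicialCategory D] (d : SimplexCategoryᵒᵖ) :
    D ⥤ Level D d where
  obj x := toLevel d x
  map f := toLevelHom d f
  map_id x := toLevelHom_id x
  map_comp f g := toLevelHom_comp f g

instance : (levelInclusion D d).LaxMonoidal :=
  Functor.LaxMonoidal.ofTensorHom
    (ε := 𝟙 (toLevel d (𝟙_ D)))
    (μ := fun x y => 𝟙 (toLevel d (x ⊗ y)))
    (μ_natural := fun f g =>
      (Category.comp_id _).trans ((toLevelHom_tensor f g).symm.trans (Category.id_comp _).symm))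
    (associativity := fun x y z => by
      erw [id_tensorHom_id, id_tensorHom_id, Category.id_comp, Category.id_comp, Category.comp_id,
        Category.comp_id]
      rfl)
    (left_unitality := fun x => by
      erw [id_tensorHom_id, Category.id_comp, Category.id_comp]
      rfl)
    (right_unitality := fun x => by
      erw [id_tensorHom_id, Category.id_comp, Category.id_comp]
      rfl)

instance : (levelInclusion D d).LaxBraided where
  braided x y := by
    erw [Category.id_comp, Category.comp_id]
    rfl

instance isIso_laxTens_levelInclusion {ι : Type} (X : ι → D) (l : List ι) :
    IsIso (laxTens (levelInclusion D d) X l) := by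
  induction l with
  | nil => exact inferInstanceAs (IsIso (𝟙 _))
  | cons a l ih =>
    have : IsIso (μ (levelInclusion D d) (X a) (tens X l)) := inferInstanceAs (IsIso (𝟙 _))
    rw [laxTens]
    infer_instance

lemma laxTens_levelInclusion (θ : d ⟶ e) {ι : Type} (X : ι → D) (l : List ι) :
    laxTens (levelMap D θ) (fun i => toLevel d (X i)) l ≫
        (levelMap D θ).map (laxTens (levelInclusion D d) X l) =
      laxTens (levelInclusion D e) X l := by
  induction l with
  | nil => exact (Category.id_comp _).trans ((levelMap D θ).map_id _)
  | cons a l ih =>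
    have h := laxTens_comp_cons (levelInclusion D d) (levelMap D θ) X a l
    refine h.trans ?_
    rw [laxTens, ← ih]
    refine congrArg (fun k => _ ≫ k) ?_
    exact (Category.id_comp _).trans ((levelMap D θ).map_id _)

/-- The space of `n`-ary operations of the endomorphism operad of `x` is `Map(x ^ n, x)`. -/
noncomputable def endoArityIso (x : D) (n : ℕ) :
    (endo x ⋙ Operad.arity n : SSet.{v}) ≅ sHom (power x n) x :=
  (NatIso.ofComponents (F := sHom (power x n) x) (G := endo x ⋙ Operad.arity n) (fun d =>
    Equiv.toIso
      { toFun c := laxTens (levelInclusion D d) (fun _ : Fin n => x) Enum.list ≫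
          (show toLevel d (power x n) ⟶ toLevel d x from c)
        invFun c := inv (laxTens (levelInclusion D d) (fun _ : Fin n => x) Enum.list) ≫
          (show power (toLevel d x) n ⟶ toLevel d x from c)
        left_inv c := IsIso.inv_hom_id_assoc
          (laxTens (levelInclusion D d) (fun _ : Fin n => x) Enum.list) _
        right_inv c := IsIso.hom_inv_id_assoc
          (laxTens (levelInclusion D d) (fun _ : Fin n => x) Enum.list) _ })
    (fun {d e} θ => by
      ext c
      let c' : toLevel d (power x n) ⟶ toLevel d x := c
      have h := laxTens_levelInclusion θ (fun _ : Fin n => x) Enum.list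
      change laxTens (levelInclusion D e) (fun _ : Fin n => x) Enum.list ≫
          (levelMap D θ).map c' =
        laxTens (levelMap D θ) (fun _ : Fin n => toLevel d x) Enum.list ≫ (levelMap D θ).map
          (laxTens (levelInclusion D d) (fun _ : Fin n => x) Enum.list ≫ c')
      rw [← h]
      exact comp_map_assoc (levelMap D θ) _ _ _)).symm

end Arity

open HomotopicalAlgebra Limits

section Spaces

/-- Maps of simplicial sets which are related by a simplicial homotopy. -/
def Homotopic {X K : SSet.{v}} (f g : X ⟶ K) : Prop :=
  Nonempty (SSet.Homotopy f g)

/-- Weak homotopy equivalences of simplicial sets: the maps `f : X ⟶ Y` which induce bijections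
`[Y, K] → [X, K]` between the sets of homotopy classes of maps to any Kan complex `K`. -/
def IsWeakHomotopyEquiv {X Y : SSet.{v}} (f : X ⟶ Y) : Prop :=
  ∀ (K : SSet.{v}) [SSet.KanComplex K],
    (∀ g : X ⟶ K, ∃ h : Y ⟶ K, Homotopic (f ≫ h) g) ∧
      ∀ h h' : Y ⟶ K, Homotopic (f ≫ h) (f ≫ h') → Homotopic h h'

/-- Kan fibrations: the right lifting property with respect to the horn inclusions. -/
def IsKanFibration {X Y : SSet.{v}} (f : X ⟶ Y) : Prop :=
  SSet.modelCategoryQuillen.J.rlp f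

/-- Trivial Kan fibrations (Kan fibrations which are weak equivalences): the right lifting property
with respect to the inclusions of the boundaries of simplices. -/
def IsTrivialKanFibration {X Y : SSet.{v}} (f : X ⟶ Y) : Prop :=
  SSet.modelCategoryQuillen.I.rlp f

end Spaces

section ModelCategories
variable (D : Type u) [Category.{v} D]

section
variable {D} [SimplicialCategory D]

/-- `t`, together with `η : K ⟶ Map(x, t)`, is a tensor `K ⊗ x`: composition with `η` gives natural
isomorphisms of simplicial sets `Map(t, y) ≅ Map(K, Map(x, y))`. -/
def IsTensor (K : SSet.{v}) (x t : D) (η : K ⟶ sHom x t) : Prop :=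
  ∀ (y : D) (A : SSet.{v}),
    (fun g : A ⟶ sHom t y => (η ⊗ₘ g) ≫ sHomComp x t y).Bijective

/-- `t`, together with `η : K ⟶ Map(t, y)`, is a cotensor of `y` with `K`: composition with `η`
gives natural isomorphisms of simplicial sets `Map(x, t) ≅ Map(K, Map(x, y))`. -/
def IsCotensor (K : SSet.{v}) (y t : D) (η : K ⟶ sHom t y) : Prop :=
  ∀ (x : D) (A : SSet.{v}),
    (fun g : A ⟶ sHom x t => (g ⊗ₘ η) ≫ sHomComp x t y).Bijective

/-- The map from `Map(b, x)` to the fibre product of `Map(a, x)` and `Map(b, y)` over `Map(a, y)`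
which is induced by `i : a ⟶ b` and `p : x ⟶ y`. -/
noncomputable def pullbackHom {a b x y : D} (i : a ⟶ b) (p : x ⟶ y) :
    sHom b x ⟶ pullback (eHomWhiskerLeft SSet a p) (eHomWhiskerRight SSet i y) :=
  pullback.lift (eHomWhiskerRight SSet i x) (eHomWhiskerLeft SSet b p)
    (eHom_whisker_exchange SSet i p).symm

end

/-- Simplicial model categories. -/
class IsSimplicialModelCategory [ModelCategory D] [SimplicialCategory D] : Prop where
  exists_tensor (K : SSet.{v}) (x : D) : ∃ (t : D) (η : K ⟶ sHom x t), IsTensor K x t η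
  exists_cotensor (K : SSet.{v}) (y : D) : ∃ (t : D) (η : K ⟶ sHom t y), IsCotensor K y t η
  isKanFibration_pullbackHom {a b x y : D} (i : a ⟶ b) (p : x ⟶ y) [Cofibration i]
    [Fibration p] : IsKanFibration (pullbackHom i p)
  isTrivialKanFibration_pullbackHom {a b x y : D} (i : a ⟶ b) (p : x ⟶ y) [Cofibration i]
    [Fibration p] (h : WeakEquivalence i ∨ WeakEquivalence p) :
    IsTrivialKanFibration (pullbackHom i p)

/-- The pushout product of two morphisms. -/
noncomputable def pushoutProduct {D : Type u} [Category.{v} D] [ModelCategory D]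
    [MonoidalCategory D] {a b a' b' : D} (i : a ⟶ b) (i' : a' ⟶ b') :
    pushout (i ▷ a') (a ◁ i') ⟶ b ⊗ b' :=
  pushout.desc (b ◁ i') (i ▷ b') (whisker_exchange i i').symm

/-- Tensor model categories: the monoidal product satisfies the pushout product axiom, its product
with an initial object is initial, and its product with a cofibrant object preserves weak
equivalences. -/
class IsTensorModelCategory [ModelCategory D] [MonoidalCategory D] : Prop where
  cofibration_pushoutProduct {a b a' b' : D} (i : a ⟶ b) (i' : a' ⟶ b') [Cofibration i]
    [Cofibration i'] : Cofibration (pushoutProduct i i')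
  weakEquivalence_pushoutProduct {a b a' b' : D} (i : a ⟶ b) (i' : a' ⟶ b') [Cofibration i]
    [Cofibration i'] (h : WeakEquivalence i ∨ WeakEquivalence i') :
    WeakEquivalence (pushoutProduct i i')
  initial_tensor (e x : D) (h : IsInitial e) : Nonempty (IsInitial (e ⊗ x))
  tensor_initial (x e : D) (h : IsInitial e) : Nonempty (IsInitial (x ⊗ e))
  weakEquivalence_whiskerLeft (x : D) {y z : D} (f : y ⟶ z) [IsCofibrant x]
    [WeakEquivalence f] : WeakEquivalence (x ◁ f)
  weakEquivalence_whiskerRight {y z : D} (f : y ⟶ z) (x : D) [IsCofibrant x]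
    [WeakEquivalence f] : WeakEquivalence (f ▷ x)

section
variable {D} [MonoidalCategory D] [SymmetricCategory D] [SimplicialCategory D]
  [SimplicialTensor D]

/-- The map `Map(𝟙, t) ⟶ Map(x, t ⊗ x)` which takes the product with `x`. -/
noncomputable def unitTensorRight (t x : D) : sHom (𝟙_ D) t ⟶ sHom x (t ⊗ x) :=
  (ρ_ _).inv ≫ _ ◁ eId SSet x ≫ SimplicialTensor.tensor (𝟙_ D) t x x ≫
    eHomWhiskerRight SSet (λ_ x).inv (t ⊗ x)

/-- The map `Map(𝟙, t) ⟶ Map(x, x ⊗ t)` which takes the product with `x`. -/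
noncomputable def unitTensorLeft (x t : D) : sHom (𝟙_ D) t ⟶ sHom x (x ⊗ t) :=
  (λ_ _).inv ≫ eId SSet x ▷ _ ≫ SimplicialTensor.tensor x x (𝟙_ D) t ≫
    eHomWhiskerRight SSet (ρ_ x).inv (x ⊗ t)

end

/-- Operadic model categories, i.e. simplicial symmetric tensor model categories. The axioms
`isTensor_tensor_left` and `isTensor_tensor_right` say that the canonical morphisms from `K ⊗ x` to
`(K ⊗ 𝟙) ⊗ x` and `x ⊗ (K ⊗ 𝟙)` are isomorphisms if `K` is a finite simplicial set. The last two
axioms say that `Map(𝟙, -)` is a right Quillen functor. -/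
class IsOperadicModelCategory [ModelCategory D] [MonoidalCategory D] [SymmetricCategory D]
    [SimplicialCategory D] [SimplicialTensor D] : Prop extends IsSimplicialModelCategory D,
    IsTensorModelCategory D where
  isTensor_tensor_left (K : SSet.{v}) [K.Finite] (t : D) (η : K ⟶ sHom (𝟙_ D) t)
    (h : IsTensor K (𝟙_ D) t η) (x : D) : IsTensor K x (t ⊗ x) (η ≫ unitTensorRight t x)
  isTensor_tensor_right (K : SSet.{v}) [K.Finite] (t : D) (η : K ⟶ sHom (𝟙_ D) t)
    (h : IsTensor K (𝟙_ D) t η) (x : D) : IsTensor K x (x ⊗ t) (η ≫ unitTensorLeft x t)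
  isKanFibration_unit {x y : D} (p : x ⟶ y) [Fibration p] :
    IsKanFibration (eHomWhiskerLeft SSet (𝟙_ D) p)
  isTrivialKanFibration_unit {x y : D} (p : x ⟶ y) [Fibration p] [WeakEquivalence p] :
    IsTrivialKanFibration (eHomWhiskerLeft SSet (𝟙_ D) p)

end ModelCategories

section QuillenAdjunctions
variable {D : Type u} [Category.{v} D] [ModelCategory D] [MonoidalCategory D]
  [SymmetricCategory D] [SimplicialCategory D] [SimplicialTensor D]
  {D' : Type u'} [Category.{v} D'] [ModelCategory D'] [MonoidalCategory D']
  [SymmetricCategory D'] [SimplicialCategory D'] [SimplicialTensor D']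
  {L : D ⥤ D'} {R : D' ⥤ D}

/-- The natural morphism `L (x ⊗ y) ⟶ L x ⊗ L y` which corresponds to a lax monoidal structure on
the right adjoint `R`. -/
def comparison [R.LaxMonoidal] (adj : L ⊣ R) (x y : D) : L.obj (x ⊗ y) ⟶ L.obj x ⊗ L.obj y :=
  (adj.homEquiv _ _).symm ((adj.unit.app x ⊗ₘ adj.unit.app y) ≫
    Functor.LaxMonoidal.μ R (L.obj x) (L.obj y))

/-- The morphism `L 𝟙 ⟶ 𝟙` which corresponds to a lax monoidal structure on the right adjoint
`R`. -/
def unitComparison [R.LaxMonoidal] (adj : L ⊣ R) : L.obj (𝟙_ D) ⟶ 𝟙_ D' :=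
  (adj.homEquiv _ _).symm (Functor.LaxMonoidal.ε R)

/-- Operadic Quillen adjunctions: Quillen adjunctions `L ⊣ R` which are simplicial adjunctions
between simplicial functors, whose right adjoint is a simplicial lax symmetric monoidal functor, and
for which the morphisms `L (x ⊗ y) ⟶ L x ⊗ L y`, for `x` and `y` cofibrant, and `L 𝟙ᶜ ⟶ 𝟙`, for some
cofibrant replacement `𝟙ᶜ` of the unit, are weak equivalences. -/
class IsOperadicQuillenAdjunction [SimplicialFunctor L] [SimplicialLaxFunctor R]
    (adj : L ⊣ R) : Prop where
  cofibration_map {x y : D} (f : x ⟶ y) [Cofibration f] : Cofibration (L.map f)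
  fibration_map {x y : D'} (f : x ⟶ y) [Fibration f] : Fibration (R.map f)
  unit_natural (d : SimplexCategoryᵒᵖ) {x y : D} (f : (sHom x y).obj d) :
    sComp f (sConst d (adj.unit.app y)) =
      sComp (sConst d (adj.unit.app x)) ((SimplicialFunctor.sMap (F := R) _ _).app d
        ((SimplicialFunctor.sMap (F := L) _ _).app d f))
  counit_natural (d : SimplexCategoryᵒᵖ) {x y : D'} (f : (sHom x y).obj d) :
    sComp ((SimplicialFunctor.sMap (F := L) _ _).app d
        ((SimplicialFunctor.sMap (F := R) _ _).app d f)) (sConst d (adj.counit.app y)) =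
      sComp (sConst d (adj.counit.app x)) f
  weakEquivalence_comparison (x y : D) [IsCofibrant x] [IsCofibrant y] :
    WeakEquivalence (comparison adj x y)
  exists_weakEquivalence_unitComparison : ∃ (c : D) (q : c ⟶ 𝟙_ D), IsCofibrant c ∧
    WeakEquivalence q ∧ WeakEquivalence (L.map q ≫ unitComparison adj)

/-- Quillen equivalences. -/
def IsQuillenEquivalence (adj : L ⊣ R) : Prop :=
  ∀ (y : D) (x : D') [IsCofibrant y] [IsFibrant x] (g : y ⟶ R.obj x),
    WeakEquivalence g ↔ WeakEquivalence ((adj.homEquiv y x).symm g)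

end QuillenAdjunctions

/-- Weak equivalences of simplicial operads: the morphisms which are weak equivalences on the spaces
of `n`-ary operations for all `n ≥ 0`. -/
def operadWeakEquivalences : MorphismProperty (SimplicialObject Operad.{v}) :=
  fun P Q f => ∀ n, IsWeakHomotopyEquiv (X := P ⋙ Operad.arity n) (Y := Q ⋙ Operad.arity n)
    (Functor.whiskerRight f (Operad.arity n))

/-- The homotopy category of simplicial operads: the localization at the weak equivalences. -/
abbrev OperadHomotopyCategory := operadWeakEquivalences.{v}.Localization

/-- The functor from simplicial operads to their homotopy category. -/
noncomputable abbrev toHo : SimplicialObject Operad.{v} ⥤ OperadHomotopyCategory.{v} :=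
  operadWeakEquivalences.{v}.Q

/-- The isomorphism in the homotopy category given by a weak equivalence. -/
noncomputable def hoIso {P Q : SimplicialObject Operad.{v}} (f : P ⟶ Q)
    (h : operadWeakEquivalences f) : toHo.obj P ≅ toHo.obj Q :=
  Localization.isoOfHom toHo operadWeakEquivalences f h

section Induced
variable {D : Type u} [Category.{v} D] [ModelCategory D] [MonoidalCategory D]
  [SymmetricCategory D] [SimplicialCategory D] [SimplicialTensor D]
  {D' : Type u'} [Category.{v} D'] [MonoidalCategory D']
  [SymmetricCategory D'] [SimplicialCategory D'] [SimplicialTensor D']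

/-- `φ` is the map of endomorphism operads induced by `R` and by the equivalence `f : y ⟶ R x`: for
any factorization of `f` into a trivial cofibration `j : y ⟶ z` and a fibration `p : z ⟶ R x`, the
projections `End(p) ⟶ End(R x)` and `End(j) ⟶ End(z)` are weak equivalences, and `φ` is the zigzag
`End(x) ⟶ End(R x) ⟵ End(p) ⟶ End(z) ⟵ End(j) ⟶ End(y)`. If `f` is a trivial fibration, then
`j = 𝟙` is allowed, and the zigzag amounts to `End(x) ⟶ End(R x) ⟵ End(f) ⟶ End(y)`. -/
def IsInducedMap (R : D' ⥤ D) [SimplicialLaxFunctor R] {x : D'} {y : D} (f : y ⟶ R.obj x)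
    (φ : toHo.obj (endo x) ⟶ toHo.obj (endo y)) : Prop :=
  ∀ (z : D) (j : y ⟶ z) (p : z ⟶ R.obj x) [Cofibration j] [WeakEquivalence j] [Fibration p],
    j ≫ p = f →
      ∃ (hp : operadWeakEquivalences (endoHomTarget p))
        (hj : operadWeakEquivalences (endoHomTarget j)),
        φ = toHo.map (endoFunctor R x) ≫ (hoIso (endoHomTarget p) hp).inv ≫
          toHo.map (endoHomSource p) ≫ (hoIso (endoHomTarget j) hj).inv ≫
            toHo.map (endoHomSource j)

end Induced

end OperadicModel

open HomotopicalAlgebra OperadicModel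

/-! A morphism `f : a ⟶ b` gives a span `End(b) ⟵ End(f) ⟶ End(a)`, and `End(f)(n)` is the pullback
of `Map(a^n, a) ⟶ Map(a^n, b) ⟵ Map(b^n, b)` (`isPullback_endoHom`). Whenever one of the two maps in
this cospan is a trivial Kan fibration, so is the opposite projection.

If `p` is a trivial fibration with cofibrant source, `Map(a^n, p)` is a trivial Kan fibration, hence
so is `End(p) ⟶ End(b)`. If `j` is a trivial cofibration with cofibrant source and fibrant target,
`j^n` is again a trivial cofibration, hence `End(j) ⟶ End(a)` is a trivial Kan fibration. If the
source is fibrant too, `j` is a simplicial homotopy equivalence, and two-out-of-three in the square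
makes `End(j) ⟶ End(b)` a weak equivalence. So all backward arrows of the zigzag can be inverted. As
a factorization of `f` exists, `φ` is forced by any one of them; the content of the first claim is
that different factorizations give the same `φ`.

For independence, the span of a composite is the composite of the spans as soon as the operad of the
composable pair is weakly equivalent to the operad of the composite (`hoSpan_comp`). The fibre of
this comparison is the choice of an operation on the middle object, which the pullback-corner axiom
controls (`endoPairComp_trivialFibration`); for two trivial cofibrations two-out-of-three suffices
(`endoPairComp_weakEquivalence`). Hence refining a factorization by a trivial cofibration does not
change the zigzag, and any two factorizations have a common refinement, obtained by factoring the
map out of their pushout under `y`.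

For a Quillen equivalence, the operad `End(R x)` itself may have the wrong homotopy type, since `R
x` need not be cofibrant. One therefore compares `End(x)` and `End(z)` through the fibre product of
`End(x)` and `End(p)` over `End(R x)`. Everything reduces to the map `Map(x^n, x) ⟶ Map(z^n, R x) ≅
Map(L(z^n), x)`, which is precomposition with `L(z^n) ⟶ x^n`. This is a weak equivalence of
cofibrant objects because `L` is monoidal up to weak equivalence and the adjoint `L z ⟶ x` of `p` is
a weak equivalence (`weakEquivalence_homEquiv_symm_laxTens`, `isIso_endoFunctor_hoSpan`).

About simplicial sets one only needs two-out-of-three, homotopy equivalences, and that trivial Kan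
fibrations are weak equivalences stable under base change and composition. -/

namespace OperadicModel

/-! ### Homotopies, weak equivalences and trivial Kan fibrations of simplicial sets -/

section SimplicialSets
open Limits CartesianMonoidalCategory Simplicial SSet.modelCategoryQuillen

variable {X Y Z K : SSet.{v}}

/-- The library notion is a homotopy relative to the empty subcomplex, so its extra condition is
vacuous. -/
lemma homotopic_iff {f g : X ⟶ K} :
    Homotopic f g ↔ ∃ h : X ⊗ Δ[1] ⟶ K, SSet.ι₀ ≫ h = f ∧ SSet.ι₁ ≫ h = g := by
  constructor
  · rintro ⟨H⟩
    exact ⟨H.h, H.h₀, H.h₁⟩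
  · rintro ⟨h, h₀, h₁⟩
    exact ⟨⟨h, h₀, h₁, by
      ext n x
      exact x.1.2.elim⟩⟩

lemma Homotopic.refl (f : X ⟶ K) : Homotopic f f :=
  ⟨SSet.RelativeMorphism.Homotopy.refl _⟩

lemma Homotopic.precomp {g g' : Y ⟶ K} (h : Homotopic g g') (f : X ⟶ Y) :
    Homotopic (f ≫ g) (f ≫ g') := by
  obtain ⟨H, rfl, rfl⟩ := homotopic_iff.1 h
  exact homotopic_iff.2 ⟨f ▷ _ ≫ H, by simp, by simp⟩

lemma Homotopic.postcomp {f f' : X ⟶ Y} (h : Homotopic f f') (g : Y ⟶ K) :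
    Homotopic (f ≫ g) (f' ≫ g) := by
  obtain ⟨H, rfl, rfl⟩ := homotopic_iff.1 h
  exact homotopic_iff.2 ⟨H ≫ g, by simp, by simp⟩

/-- The product with a vertex. -/
noncomputable def tensorPoint (X : SSet.{v}) : X ⟶ X ⊗ Δ[0] :=
  lift (𝟙 X) (SSet.stdSimplex.isTerminalObj₀.from X)

/-- The coface `δ i` omits the vertex `i`, so the end at `0` is given by `δ 1` and the end at `1` by
`δ 0`. Rewriting the ends in this way lets the cosimplicial identities act on homotopies. -/
lemma tensorPoint_δ_one : tensorPoint X ≫ X ◁ SSet.stdSimplex.δ 1 = SSet.ι₀ := by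
  rw [tensorPoint, lift_whiskerLeft]
  refine CartesianMonoidalCategory.hom_ext _ _ (by simp) ?_
  simp only [lift_snd]
  ext n x
  apply SSet.stdSimplex.objEquiv.injective
  ext i
  rfl

lemma tensorPoint_δ_zero : tensorPoint X ≫ X ◁ SSet.stdSimplex.δ 0 = SSet.ι₁ := by
  rw [tensorPoint, lift_whiskerLeft]
  refine CartesianMonoidalCategory.hom_ext _ _ (by simp) ?_
  simp only [lift_snd]
  ext n x
  apply SSet.stdSimplex.objEquiv.injective
  ext i
  rfl

instance : Epi (tensorPoint X) := by
  have h : fst X Δ[0] ≫ tensorPoint X = 𝟙 _ :=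
    CartesianMonoidalCategory.hom_ext _ _ (by simp [tensorPoint]) SSet.stdSimplex.ext₀
  exact (SplitEpi.mk (fst X Δ[0]) h).epi

/-- The two homotopies form a map from `X ⊗ Λ[2, 0]`. It extends to `X ⊗ Δ[2]` because a product
with a horn inclusion is anodyne and `K` is Kan; the third edge of the filler is the desired
homotopy. Symmetry and transitivity both follow from this one horn. -/
lemma Homotopic.euclidean [SSet.KanComplex K] {f g h : X ⟶ K} (hfg : Homotopic f g)
    (hfh : Homotopic f h) : Homotopic g h := by
  obtain ⟨H, h₀, rfl⟩ := homotopic_iff.1 hfg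
  obtain ⟨H', h₀', rfl⟩ := homotopic_iff.1 hfh
  -- The horn is the union of the edges `01` and `02` along the vertex `0`, and the product with `X`
  -- preserves this pushout. The edge `01` (opposite to `2`) carries `H`, the edge `02` carries
  -- `H'`.
  have sq := SSet.horn₂₀.isPushout.{v}.map (tensorLeft X)
  have e : X ◁ SSet.stdSimplex.δ (1 : Fin 2) ≫ H = X ◁ SSet.stdSimplex.δ (1 : Fin 2) ≫ H' := by
    rw [← cancel_epi (tensorPoint X), ← Category.assoc, ← Category.assoc, tensorPoint_δ_one,
      h₀, h₀']
  have hl := SSet.anodyneExtensions.whiskerLeft (SSet.anodyneExtensions.horn_ι.{v} (0 : Fin 3)) X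
  have : HasLiftingProperty (X ◁ Λ[2, (0 : Fin 3)].ι) (terminal.from K) :=
    hl _ (mem_fibrations _)
  have sq' : CommSq (sq.desc H H' e) (X ◁ Λ[2, (0 : Fin 3)].ι) (terminal.from K)
    (terminal.from _) := ⟨Subsingleton.elim _ _⟩
  have fac : X ◁ Λ[2, (0 : Fin 3)].ι ≫ sq'.lift = sq.desc H H' e := sq'.fac_left
  have hH : X ◁ SSet.stdSimplex.δ (2 : Fin 3) ≫ sq'.lift = H := by
    rw [← SSet.horn.ι_ι (0 : Fin 3) 2 (by simp), whiskerLeft_comp, Category.assoc, fac]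
    exact sq.inl_desc _ _ _
  have hH' : X ◁ SSet.stdSimplex.δ (1 : Fin 3) ≫ sq'.lift = H' := by
    rw [← SSet.horn.ι_ι (0 : Fin 3) 1 (by simp), whiskerLeft_comp, Category.assoc, fac]
    exact sq.inr_desc _ _ _
  generalize sq'.lift = F at hH hH'
  subst hH hH'
  -- The edge `12` runs from the end of `H` to the end of `H'`; its endpoints are identified by the
  -- cosimplicial identities.
  refine homotopic_iff.2 ⟨X ◁ SSet.stdSimplex.δ (0 : Fin 3) ≫ F, ?_, ?_⟩
  · rw [← tensorPoint_δ_one, ← tensorPoint_δ_zero]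
    simp only [Category.assoc, ← whiskerLeft_comp_assoc]
    exact congrArg (fun k => tensorPoint X ≫ X ◁ k ≫ F)
      (SSet.stdSimplex.δ_comp_δ (i := (0 : Fin 2)) (j := 1) (by simp)).symm
  · rw [← tensorPoint_δ_zero]
    simp only [Category.assoc, ← whiskerLeft_comp_assoc]
    exact congrArg (fun k => tensorPoint X ≫ X ◁ k ≫ F)
      (SSet.stdSimplex.δ_comp_δ (i := (0 : Fin 2)) (j := 0) (by simp)).symm

lemma Homotopic.symm [SSet.KanComplex K] {f g : X ⟶ K} (h : Homotopic f g) : Homotopic g f :=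
  h.euclidean (.refl f)

lemma Homotopic.trans [SSet.KanComplex K] {f g h : X ⟶ K} (hfg : Homotopic f g)
    (hgh : Homotopic g h) : Homotopic f h :=
  hfg.symm.euclidean hgh

lemma IsWeakHomotopyEquiv.comp {f : X ⟶ Y} {g : Y ⟶ Z} (hf : IsWeakHomotopyEquiv f)
    (hg : IsWeakHomotopyEquiv g) : IsWeakHomotopyEquiv (f ≫ g) := by
  refine fun K _ => ⟨fun k => ?_, fun h h' e => ?_⟩
  · obtain ⟨l, hl⟩ := (hf K).1 k
    obtain ⟨m, hm⟩ := (hg K).1 l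
    exact ⟨m, by simpa using (hm.precomp f).trans hl⟩
  · exact (hg K).2 _ _ ((hf K).2 _ _ (by simpa using e))

lemma IsWeakHomotopyEquiv.of_precomp {f : X ⟶ Y} {g : Y ⟶ Z} (hf : IsWeakHomotopyEquiv f)
    (hfg : IsWeakHomotopyEquiv (f ≫ g)) : IsWeakHomotopyEquiv g := by
  refine fun K _ => ⟨fun k => ?_, fun h h' e => ?_⟩
  · obtain ⟨l, hl⟩ := (hfg K).1 (f ≫ k)
    exact ⟨l, (hf K).2 _ _ (by simpa using hl)⟩
  · exact (hfg K).2 _ _ (by simpa using e.precomp f)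

lemma IsWeakHomotopyEquiv.of_postcomp {f : X ⟶ Y} {g : Y ⟶ Z} (hg : IsWeakHomotopyEquiv g)
    (hfg : IsWeakHomotopyEquiv (f ≫ g)) : IsWeakHomotopyEquiv f := by
  refine fun K _ => ⟨fun k => ?_, fun h h' e => ?_⟩
  · obtain ⟨l, hl⟩ := (hfg K).1 k
    exact ⟨g ≫ l, by simpa using hl⟩
  · obtain ⟨l, hl⟩ := (hg K).1 h
    obtain ⟨l', hl'⟩ := (hg K).1 h'
    have h1 : Homotopic ((f ≫ g) ≫ l) ((f ≫ g) ≫ l') := by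
      simpa using ((hl.precomp f).trans e).trans (hl'.precomp f).symm
    exact (hl.symm.trans (((hfg K).2 _ _ h1).precomp g)).trans hl'

/-- The given homotopies take place in `X` and `Y`, which need not be Kan; they are reversed and
concatenated only after composition with a map to a Kan complex. -/
lemma isWeakHomotopyEquiv_of_homotopic {f : X ⟶ Y} {s : Y ⟶ X} (h : Homotopic (f ≫ s) (𝟙 X))
    (h' : Homotopic (s ≫ f) (𝟙 Y)) : IsWeakHomotopyEquiv f := by
  refine fun K _ => ⟨fun k => ⟨s ≫ k, ?_⟩, fun k k' e => ?_⟩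
  · simpa using h.postcomp k
  · have h1 := h'.postcomp k
    have h2 := h'.postcomp k'
    have h3 := e.precomp s
    simp only [Category.assoc, Category.id_comp] at h1 h2
    exact (h1.symm.trans h3).trans h2

lemma isWeakHomotopyEquiv_of_isIso (f : X ⟶ Y) [IsIso f] : IsWeakHomotopyEquiv f :=
  isWeakHomotopyEquiv_of_homotopic (s := inv f) (by simpa using .refl _) (by simpa using .refl _)

/-- The disjoint union of two copies of a simplicial set. -/
def twoCopies (X : SSet.{v}) : SSet.{v} where
  obj d := X.obj d ⊕ X.obj d
  map θ := ↾(Sum.map (X.map θ) (X.map θ))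
  map_id d := by ext (x | x) <;> simp
  map_comp θ η := by ext (x | x) <;> simp

/-- The morphism from the disjoint union given by two morphisms. -/
def twoCopiesDesc (f g : X ⟶ Y) : twoCopies X ⟶ Y where
  app d := ↾(Sum.elim (f.app d) (g.app d))
  naturality d e θ := by
    ext (x | x)
    · exact NatTrans.naturality_apply f θ x
    · exact NatTrans.naturality_apply g θ x

instance mono_twoCopiesDesc : Mono (twoCopiesDesc (SSet.ι₀ (X := X)) SSet.ι₁) := by
  have : ∀ d, Mono ((twoCopiesDesc (SSet.ι₀ (X := X)) SSet.ι₁).app d) := by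
    intro d
    rw [mono_iff_injective]
    -- The two ends are disjoint: the `Δ[1]`-coordinate is constant at `0` on one and at `1` on the
    -- other.
    have h0 (x y : X.obj d) : SSet.ι₀.app d x ≠ SSet.ι₁.app d y := fun h => by
      have h1 := congrArg (fun z : (X ⊗ Δ[1]).obj d => z.2) h
      have h2 := congrArg (fun z : (Δ[1] : SSet.{v}).obj d =>
        (SSet.stdSimplex.objEquiv z).toOrderHom 0) h1
      exact zero_ne_one h2
    rintro (x | x) (y | y) h
    · exact congrArg Sum.inl (congrArg (fun z : (X ⊗ Δ[1]).obj d => z.1) h)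
    · exact (h0 _ _ h).elim
    · exact (h0 _ _ h.symm).elim
    · exact congrArg Sum.inr (congrArg (fun z : (X ⊗ Δ[1]).obj d => z.1) h)
  exact NatTrans.mono_of_mono_app _

/-- The monomorphisms and the boundary inclusions have the same right lifting property. -/
lemma IsTrivialKanFibration.hasLiftingProperty {p : X ⟶ Y} (hp : IsTrivialKanFibration p)
    {A B : SSet.{v}} (i : A ⟶ B) [Mono i] : HasLiftingProperty i p := by
  rw [IsTrivialKanFibration, ← SSet.rlp_monomorphisms] at hp
  exact hp i (.infer_property i)

/-- Lift the constant homotopy of the common composite along the inclusion of the two ends of the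
cylinder. No Kan condition on the target is involved. -/
lemma IsTrivialKanFibration.homotopic {p : X ⟶ Y} (hp : IsTrivialKanFibration p)
    {A : SSet.{v}} {f g : A ⟶ X} (h : f ≫ p = g ≫ p) : Homotopic f g := by
  have := hp.hasLiftingProperty (twoCopiesDesc (SSet.ι₀ (X := A)) SSet.ι₁)
  have sq : CommSq (twoCopiesDesc f g) (twoCopiesDesc (SSet.ι₀ (X := A)) SSet.ι₁) p
      (fst _ _ ≫ f ≫ p) := ⟨by
    ext d (x | x)
    · rfl
    · exact (ConcreteCategory.congr_hom (congrArg (fun k => NatTrans.app k d) h) x).symm⟩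
  refine homotopic_iff.2 ⟨sq.lift, ?_, ?_⟩
  · ext d x
    exact ConcreteCategory.congr_hom (congrArg (fun k => NatTrans.app k d) sq.fac_left) (.inl x)
  · ext d x
    exact ConcreteCategory.congr_hom (congrArg (fun k => NatTrans.app k d) sq.fac_left) (.inr x)

lemma IsTrivialKanFibration.exists_section {p : X ⟶ Y} (hp : IsTrivialKanFibration p) :
    ∃ s : Y ⟶ X, s ≫ p = 𝟙 Y := by
  have := hp.hasLiftingProperty (initial.to Y)
  have sq : CommSq (initial.to X) (initial.to Y) p (𝟙 Y) := ⟨Subsingleton.elim _ _⟩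
  exact ⟨sq.lift, sq.fac_right⟩

/-- A section `s` exists by lifting, and `p ≫ s` is homotopic to the identity because both have the
same composite with `p`. -/
lemma IsTrivialKanFibration.isWeakHomotopyEquiv {p : X ⟶ Y} (hp : IsTrivialKanFibration p) :
    IsWeakHomotopyEquiv p := by
  obtain ⟨s, hs⟩ := hp.exists_section
  exact isWeakHomotopyEquiv_of_homotopic (s := s) (hp.homotopic (by simp [hs]))
    (by rw [hs]; exact .refl _)

lemma IsTrivialKanFibration.of_isPullback {f : X ⟶ Y} {g : Z ⟶ K} {t : X ⟶ Z} {b : Y ⟶ K}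
    (sq : IsPullback t f g b) (hg : IsTrivialKanFibration g) : IsTrivialKanFibration f :=
  MorphismProperty.of_isPullback (P := I.rlp) sq hg

lemma isTrivialKanFibration_comp {f : X ⟶ Y} {g : Y ⟶ Z} (hf : IsTrivialKanFibration f)
    (hg : IsTrivialKanFibration g) : IsTrivialKanFibration (f ≫ g) :=
  I.rlp.comp_mem _ _ hf hg

lemma isTrivialKanFibration_of_isIso (f : X ⟶ Y) [IsIso f] : IsTrivialKanFibration f :=
  MorphismProperty.rlp_of_isIso I f

/-- Pullback squares of simplicial sets can be recognized on simplices. -/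
lemma isPullback_of_app {f : X ⟶ Y} {g : Z ⟶ K} {t : X ⟶ Z} {b : Y ⟶ K} (w : t ≫ g = f ≫ b)
    (inj : ∀ d (x x' : X.obj d), t.app d x = t.app d x' → f.app d x = f.app d x' → x = x')
    (surj : ∀ d (z : Z.obj d) (y : Y.obj d), g.app d z = b.app d y →
      ∃ x, t.app d x = z ∧ f.app d x = y) : IsPullback t f g b := by
  refine IsPullback.of_forall_isPullback_app fun d => ?_
  rw [Types.isPullback_iff]
  exact ⟨congrArg (fun k => NatTrans.app k d) w, fun x x' h => inj d x x' h.1 h.2,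
    fun z y h => surj d z y h⟩

end SimplicialSets

/-! ### Homotopy invariance of mapping spaces -/

section MappingSpaces
open Limits CartesianMonoidalCategory Simplicial SimplicialCategory

variable {D : Type u} [Category.{v} D] [SimplicialCategory D]

/-- Composition with homotopic vertices of a mapping space gives homotopic maps. -/
lemma homotopic_eHomWhiskerLeft (c : D) {x y : D} {g g' : x ⟶ y}
    (h : Homotopic (eHomEquiv SSet.{v} g) (eHomEquiv SSet.{v} g')) :
    Homotopic (eHomWhiskerLeft SSet.{v} c g) (eHomWhiskerLeft SSet.{v} c g') := by
  obtain ⟨H, h₀, h₁⟩ := homotopic_iff.1 h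
  -- The path `Δ[1] ⟶ Map(x, y)` is fed into the second variable of the enriched composition.
  refine homotopic_iff.2 ⟨_ ◁ ((λ_ _).inv ≫ H) ≫ sHomComp c x y, ?_, ?_⟩
  · rw [eHomWhiskerLeft, ← h₀]
    rfl
  · rw [eHomWhiskerLeft, ← h₁]
    rfl

variable [ModelCategory D] [IsSimplicialModelCategory D]

/-- The mapping space to a terminal object is terminal. -/
lemma nonempty_unique_hom_sHom_terminal (A : SSet.{v}) (x : D) {t : D} (ht : IsTerminal t) :
    Nonempty (Unique (A ⟶ sHom x t)) := by
  obtain ⟨k, η, hη⟩ := IsSimplicialModelCategory.exists_tensor A x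
  -- On vertices, the tensor identifies the maps `A ⟶ Map(x, t)` with the morphisms from the tensor
  -- of `A` and `x` to `t`, and there is exactly one of these.
  have e := Equiv.ofBijective _ (hη t (𝟙_ _))
  have : Unique (k ⟶ t) := ⟨⟨ht.from k⟩, fun _ => ht.hom_ext _ _⟩
  exact ⟨(((eHomEquiv SSet.{v}).trans e).trans
    ((ρ_ A).homCongr (Iso.refl (sHom x t)))).symm.unique⟩

/-- The mapping space from an initial object is terminal. -/
lemma nonempty_unique_hom_sHom_initial (A : SSet.{v}) {i : D} (hi : IsInitial i) (x : D) :
    Nonempty (Unique (A ⟶ sHom i x)) := by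
  obtain ⟨k, η, hη⟩ := IsSimplicialModelCategory.exists_cotensor A x
  have e := Equiv.ofBijective _ (hη i (𝟙_ _))
  have : Unique (i ⟶ k) := ⟨⟨hi.to k⟩, fun _ => hi.hom_ext _ _⟩
  exact ⟨(((eHomEquiv SSet.{v}).trans e).trans
    ((λ_ A).homCongr (Iso.refl (sHom i x)))).symm.unique⟩

lemma isIso_sHom_terminal {x x' t t' : D} (ht : IsTerminal t) (ht' : IsTerminal t')
    (f : sHom x t ⟶ sHom x' t') : IsIso f := by
  have h (A : SSet.{v}) := (nonempty_unique_hom_sHom_terminal A x ht).some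
  have h' (A : SSet.{v}) := (nonempty_unique_hom_sHom_terminal A x' ht').some
  exact ⟨(h _).default, (h _).instSubsingleton.elim _ _, (h' _).instSubsingleton.elim _ _⟩

lemma isIso_sHom_initial {x x' i i' : D} (hi : IsInitial i) (hi' : IsInitial i')
    (f : sHom i x ⟶ sHom i' x') : IsIso f := by
  have h (A : SSet.{v}) := (nonempty_unique_hom_sHom_initial A hi x).some
  have h' (A : SSet.{v}) := (nonempty_unique_hom_sHom_initial A hi' x').some
  exact ⟨(h _).default, (h _).instSubsingleton.elim _ _, (h' _).instSubsingleton.elim _ _⟩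

/-- This is the pullback-corner axiom for `∅ ⟶ c`: mapping spaces out of the initial object are
terminal, so the fibre product reduces to `Map(c, y)`. The next lemma is the dual case of a map to
the terminal object. -/
lemma isTrivialKanFibration_eHomWhiskerLeft (c : D) [IsCofibrant c] {x y : D} (p : x ⟶ y)
    [Fibration p] [WeakEquivalence p] :
    IsTrivialKanFibration (eHomWhiskerLeft SSet.{v} c p) := by
  have := isIso_sHom_initial initialIsInitial initialIsInitial
    (eHomWhiskerLeft SSet.{v} (⊥_ D) p)
  have h := IsSimplicialModelCategory.isTrivialKanFibration_pullbackHom (initial.to c) p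
    (.inr inferInstance)
  have e : eHomWhiskerLeft SSet.{v} c p = pullbackHom (initial.to c) p ≫ pullback.snd _ _ :=
    (pullback.lift_snd _ _ _).symm
  rw [e]
  exact isTrivialKanFibration_comp h (isTrivialKanFibration_of_isIso _)

lemma isTrivialKanFibration_eHomWhiskerRight {a b : D} (i : a ⟶ b) [Cofibration i]
    [WeakEquivalence i] (x : D) [IsFibrant x] :
    IsTrivialKanFibration (eHomWhiskerRight SSet.{v} i x) := by
  have := isIso_sHom_terminal terminalIsTerminal terminalIsTerminal
    (eHomWhiskerRight SSet.{v} i (⊤_ D))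
  have h := IsSimplicialModelCategory.isTrivialKanFibration_pullbackHom i (terminal.from x)
    (.inl inferInstance)
  have e : eHomWhiskerRight SSet.{v} i x =
      pullbackHom i (terminal.from x) ≫ pullback.fst _ _ :=
    (pullback.lift_fst _ _ _).symm
  rw [e]
  exact isTrivialKanFibration_comp h (isTrivialKanFibration_of_isIso _)

/-- A trivial cofibration between fibrant objects is a simplicial homotopy equivalence, and `Map(c,
-)` preserves these for every `c`, cofibrant or not. -/
lemma isWeakHomotopyEquiv_eHomWhiskerLeft (c : D) {y z : D} (j : y ⟶ z) [Cofibration j]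
    [WeakEquivalence j] [IsFibrant y] [IsFibrant z] :
    IsWeakHomotopyEquiv (eHomWhiskerLeft SSet.{v} c j) := by
  have sq : CommSq (𝟙 y) j (terminal.from y) (terminal.from z) := ⟨Subsingleton.elim _ _⟩
  have hr : j ≫ sq.lift = 𝟙 y := sq.fac_left
  -- These vertices of `Map(z, z)` have the same image in `Map(y, z)` as `sq.lift` retracts `j`, and
  -- restriction along `j` is a trivial Kan fibration; so they are joined by a path.
  have h : Homotopic (eHomEquiv SSet.{v} (sq.lift ≫ j)) (eHomEquiv SSet.{v} (𝟙 z)) := by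
    refine (isTrivialKanFibration_eHomWhiskerRight j z).homotopic ?_
    have e {g : z ⟶ z} : eHomEquiv SSet.{v} g ≫ eHomWhiskerRight SSet j z =
        eHomEquiv SSet.{v} (j ≫ g) := by
      ext d x
      exact (ConcreteCategory.congr_hom (congrArg (fun k => NatTrans.app k d)
        (eHomEquiv_comp SSet.{v} j g)) x).symm
    rw [e, e, reassoc_of% hr, Category.comp_id]
  refine isWeakHomotopyEquiv_of_homotopic (s := eHomWhiskerLeft SSet.{v} c sq.lift) ?_ ?_
  · rw [← eHomWhiskerLeft_comp, hr, eHomWhiskerLeft_id]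
    exact .refl _
  · rw [← eHomWhiskerLeft_comp, ← eHomWhiskerLeft_id SSet.{v} c z]
    exact homotopic_eHomWhiskerLeft c h

/-- Ken Brown's argument: `f` is a trivial cofibration followed by a retraction of a trivial
cofibration, and the case of trivial cofibrations is known. -/
lemma isWeakHomotopyEquiv_eHomWhiskerRight {a b : D} (f : a ⟶ b) [IsCofibrant a] [IsCofibrant b]
    [WeakEquivalence f] (x : D) [IsFibrant x] :
    IsWeakHomotopyEquiv (eHomWhiskerRight SSet.{v} f x) := by
  obtain ⟨h⟩ : Nonempty (CofibrantBrownFactorization f) := inferInstance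
  have hp : IsWeakHomotopyEquiv (eHomWhiskerRight SSet.{v} h.p x) := by
    refine .of_postcomp
      (isTrivialKanFibration_eHomWhiskerRight h.s x).isWeakHomotopyEquiv ?_
    rw [← eHomWhiskerRight_comp, h.s_p, eHomWhiskerRight_id]
    exact isWeakHomotopyEquiv_of_isIso _
  rw [← h.fac, eHomWhiskerRight_comp]
  exact hp.comp (isTrivialKanFibration_eHomWhiskerRight h.i x).isWeakHomotopyEquiv

end MappingSpaces

/-! ### Tensor products of cofibrant objects and cofibrations -/

section TensorModel
open Limits

variable {D : Type u} [Category.{v} D] [ModelCategory D] [MonoidalCategory D]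
  [IsTensorModelCategory D]

/-- The pushout product of `i` with `∅ ⟶ c` is `i ▷ c` up to isomorphism, since products with the
initial object are initial and hence `i ▷ ∅` is invertible. -/
instance cofibration_whiskerRight {a b : D} (i : a ⟶ b) [Cofibration i] (c : D)
    [IsCofibrant c] : Cofibration (i ▷ c) := by
  have := IsTensorModelCategory.cofibration_pushoutProduct i (initial.to c)
  obtain ⟨h⟩ := IsTensorModelCategory.tensor_initial a _ (initialIsInitial (C := D))
  obtain ⟨h'⟩ := IsTensorModelCategory.tensor_initial b _ (initialIsInitial (C := D))
  have : IsIso (i ▷ ⊥_ D) := isIso_of_isInitial h h' _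
  have e : i ▷ c = pushout.inr (i ▷ ⊥_ D) (a ◁ initial.to c) ≫
    pushoutProduct i (initial.to c) := (pushout.inr_desc _ _ _).symm
  rw [e]
  infer_instance

instance cofibration_whiskerLeft (c : D) [IsCofibrant c] {a b : D} (i : a ⟶ b) [Cofibration i] :
    Cofibration (c ◁ i) := by
  have := IsTensorModelCategory.cofibration_pushoutProduct (initial.to c) i
  obtain ⟨h⟩ := IsTensorModelCategory.initial_tensor _ a (initialIsInitial (C := D))
  obtain ⟨h'⟩ := IsTensorModelCategory.initial_tensor _ b (initialIsInitial (C := D))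
  have : IsIso ((⊥_ D) ◁ i) := isIso_of_isInitial h h' _
  have e : c ◁ i = pushout.inl (initial.to c ▷ a) ((⊥_ D) ◁ i) ≫
    pushoutProduct (initial.to c) i := (pushout.inl_desc _ _ _).symm
  rw [e]
  infer_instance

instance isCofibrant_tensor (a b : D) [IsCofibrant a] [IsCofibrant b] : IsCofibrant (a ⊗ b) := by
  obtain ⟨h⟩ := IsTensorModelCategory.initial_tensor _ b (initialIsInitial (C := D))
  rw [isCofibrant_iff_of_isInitial (initial.to a ▷ b) h]
  infer_instance

instance weakEquivalence_whiskerLeft_of_isCofibrant (c : D) [IsCofibrant c] {a b : D} (f : a ⟶ b)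
    [WeakEquivalence f] : WeakEquivalence (c ◁ f) :=
  IsTensorModelCategory.weakEquivalence_whiskerLeft c f

instance weakEquivalence_whiskerRight_of_isCofibrant {a b : D} (f : a ⟶ b) [WeakEquivalence f]
    (c : D) [IsCofibrant c] : WeakEquivalence (f ▷ c) :=
  IsTensorModelCategory.weakEquivalence_whiskerRight f c

end TensorModel

/-! ### Tensor powers in operadic model categories -/

lemma powerHom_eq_ten {C : Type u} [Category.{v} C] [MonoidalCategory C] [SymmetricCategory C]
    {y z : C} (j : y ⟶ z) (n : ℕ) :
    powerHom j (Fin n) = (Shuf.refl Enum.list).ten (fun _ => j) :=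
  bigTensorMap_eq Function.bijective_id _ _

section OperadicModelCategories
open Limits SimplicialCategory

variable {D : Type u} [Category.{v} D] [ModelCategory D] [MonoidalCategory D]
  [SymmetricCategory D] [SimplicialCategory D] [SimplicialTensor D] [IsOperadicModelCategory D]

variable (D) in
-- `Map(𝟙, -)` sends trivial fibrations to trivial Kan fibrations. These are surjective on vertices,
-- so every morphism from the unit lifts through a trivial fibration. In particular the power `x^0`
-- is cofibrant, and nullary operations need no separate treatment.
lemma isCofibrant_tensorUnit : IsCofibrant (𝟙_ D) := by
  rw [isCofibrant_iff, cofibration_iff, ← trivialFibrations_llp]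
  intro x y p hp
  rw [mem_trivialFibrations_iff] at hp
  obtain ⟨_, _⟩ := hp
  obtain ⟨s, hs⟩ :=
    (IsOperadicModelCategory.isTrivialKanFibration_unit (D := D) p).exists_section
  refine ⟨fun {t b} sq => ⟨⟨⟨(eHomEquiv SSet.{v}).symm (eHomEquiv SSet.{v} b ≫ s),
    Subsingleton.elim _ _, ?_⟩⟩⟩⟩
  apply (eHomEquiv SSet.{v}).injective
  have e {g : 𝟙_ D ⟶ x} : eHomEquiv SSet.{v} (g ≫ p) =
      eHomEquiv SSet.{v} g ≫ eHomWhiskerLeft SSet (𝟙_ D) p := by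
    ext d x
    exact ConcreteCategory.congr_hom (congrArg (fun k => NatTrans.app k d)
      (eHomEquiv_comp SSet.{v} g p)) x
  rw [e, Equiv.apply_symm_apply, Category.assoc, hs, Category.comp_id]

instance isCofibrant_tens {ι : Type} (X : ι → D) [∀ i, IsCofibrant (X i)] (l : List ι) :
    IsCofibrant (tens X l) := by
  induction l with
  | nil => exact isCofibrant_tensorUnit D
  | cons a l ih => exact isCofibrant_tensor _ _

/-- By induction, `j ⊗ j^n` is a composite of `j` and `j^n` each multiplied by a cofibrant object,
which preserves both cofibrations and weak equivalences. -/
lemma cofibration_ten_refl {y z : D} (j : y ⟶ z) [IsCofibrant y] [Cofibration j]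
    [WeakEquivalence j] {ι : Type} (l : List ι) :
    Cofibration ((Shuf.refl l).ten (Y := fun _ => y) (X := fun _ => z) (fun _ => j)) ∧
      WeakEquivalence ((Shuf.refl l).ten (Y := fun _ => y) (X := fun _ => z) (fun _ => j)) := by
  have : IsCofibrant z := isCofibrant_of_cofibration j
  induction l with
  | nil =>
    change Cofibration (𝟙 (𝟙_ D)) ∧ WeakEquivalence (𝟙 (𝟙_ D))
    exact ⟨inferInstance, inferInstance⟩
  | cons a l ih =>
    obtain ⟨_, _⟩ := ih
    simp only [Shuf.refl, Shuf.ten, Ins.ten, Category.comp_id, MonoidalCategory.tensorHom_def]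
    exact ⟨inferInstance, inferInstance⟩

instance cofibration_powerHom {y z : D} (j : y ⟶ z) [IsCofibrant y] [Cofibration j]
    [WeakEquivalence j] (n : ℕ) : Cofibration (powerHom j (Fin n)) := by
  rw [powerHom_eq_ten]
  exact (cofibration_ten_refl j _).1

instance weakEquivalence_powerHom {y z : D} (j : y ⟶ z) [IsCofibrant y] [Cofibration j]
    [WeakEquivalence j] (n : ℕ) : WeakEquivalence (powerHom j (Fin n)) := by
  rw [powerHom_eq_ten]
  exact (cofibration_ten_refl j _).2

end OperadicModelCategories

/-! ### Fibre products and trivial fibrations of operads -/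

section OperadPullback

variable {P Q R : Operad.{v}}

/-- The fibre product of operads in sets. -/
def Operad.fiberProduct (f : P ⟶ R) (g : Q ⟶ R) : Operad.{v} where
  Op n := { c : P.Op n × Q.Op n // Operad.Hom.app f n c.1 = Operad.Hom.app g n c.2 }
  act e c := ⟨(P.act e c.1.1, Q.act e c.1.2), by
    rw [Operad.Hom.app_act, Operad.Hom.app_act, c.2]⟩
  one := ⟨(P.one, Q.one), by rw [Operad.Hom.app_one, Operad.Hom.app_one]⟩
  comp n c d := ⟨(P.comp n c.1.1 (fun i => (d i).1.1), Q.comp n c.1.2 (fun i => (d i).1.2)), by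
    rw [Operad.Hom.app_comp, Operad.Hom.app_comp, c.2]
    simp only [(d _).2]⟩
  act_refl _ := Subtype.ext (Prod.ext (P.act_refl _) (Q.act_refl _))
  act_trans _ _ _ := Subtype.ext (Prod.ext (P.act_trans _ _ _) (Q.act_trans _ _ _))
  comp_act_left _ _ _ _ :=
    Subtype.ext (Prod.ext (P.comp_act_left _ _ _ _) (Q.comp_act_left _ _ _ _))
  comp_act_right _ _ _ _ _ :=
    Subtype.ext (Prod.ext (P.comp_act_right _ _ _ _ _) (Q.comp_act_right _ _ _ _ _))
  one_comp _ _ := Subtype.ext (Prod.ext (P.one_comp _ _) (Q.one_comp _ _))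
  comp_one _ := Subtype.ext (Prod.ext (P.comp_one _) (Q.comp_one _))
  comp_assoc _ _ _ _ _ :=
    Subtype.ext (Prod.ext (P.comp_assoc _ _ _ _ _) (Q.comp_assoc _ _ _ _ _))

end OperadPullback

section SimplicialOperadPullback

variable {P Q R : SimplicialObject Operad.{v}}

/-- The fibre product of simplicial operads. -/
def operadPullback (f : P ⟶ R) (g : Q ⟶ R) : SimplicialObject Operad.{v} where
  obj d := Operad.fiberProduct (f.app d) (g.app d)
  map {d e} θ :=
    { app n c := ⟨((P.map θ).app n c.1.1, (Q.map θ).app n c.1.2), by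
        have h := congrArg (fun k => Operad.Hom.app k n c.1.1) (f.naturality θ)
        have h' := congrArg (fun k => Operad.Hom.app k n c.1.2) (g.naturality θ)
        exact h.trans ((congrArg (Operad.Hom.app (R.map θ) n) c.2).trans h'.symm)⟩
      app_act a c := Subtype.ext (Prod.ext ((P.map θ).app_act a c.1.1)
        ((Q.map θ).app_act a c.1.2))
      app_one := Subtype.ext (Prod.ext (P.map θ).app_one (Q.map θ).app_one)
      app_comp n c b := Subtype.ext (Prod.ext
        ((P.map θ).app_comp n c.1.1 (fun i => (b i).1.1))
        ((Q.map θ).app_comp n c.1.2 (fun i => (b i).1.2))) }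
  map_id d := by
    refine Operad.Hom.ext (funext fun n => funext fun c => Subtype.ext (Prod.ext ?_ ?_))
    · exact congrArg (fun h => Operad.Hom.app h n c.1.1) (P.map_id d)
    · exact congrArg (fun h => Operad.Hom.app h n c.1.2) (Q.map_id d)
  map_comp θ η := by
    refine Operad.Hom.ext (funext fun n => funext fun c => Subtype.ext (Prod.ext ?_ ?_))
    · exact congrArg (fun h => Operad.Hom.app h n c.1.1) (P.map_comp θ η)
    · exact congrArg (fun h => Operad.Hom.app h n c.1.2) (Q.map_comp θ η)

/-- The first projection of a fibre product of simplicial operads. -/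
def operadPullbackFst (f : P ⟶ R) (g : Q ⟶ R) : operadPullback f g ⟶ P where
  app _ := ⟨fun _ c => c.1.1, fun _ _ => rfl, rfl, fun _ _ _ => rfl⟩

/-- The second projection of a fibre product of simplicial operads. -/
def operadPullbackSnd (f : P ⟶ R) (g : Q ⟶ R) : operadPullback f g ⟶ Q where
  app _ := ⟨fun _ c => c.1.2, fun _ _ => rfl, rfl, fun _ _ _ => rfl⟩

lemma operadPullback_condition (f : P ⟶ R) (g : Q ⟶ R) :
    operadPullbackFst f g ≫ f = operadPullbackSnd f g ≫ g := by
  ext d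
  exact Operad.Hom.ext (funext fun n => funext fun c => c.2)

/-- The map induced by a morphism of simplicial operads on the spaces of `n`-ary operations. -/
abbrev arityMap (f : P ⟶ Q) (n : ℕ) : (P ⋙ Operad.arity n : SSet.{v}) ⟶ Q ⋙ Operad.arity n :=
  Functor.whiskerRight f (Operad.arity n)

lemma arityMap_comp (f : P ⟶ Q) (g : Q ⟶ R) (n : ℕ) :
    arityMap (f ≫ g) n = arityMap f n ≫ arityMap g n := rfl

/-- Fibre products of operads are formed arity by arity, so that base change of weak equivalences
becomes a question about simplicial sets. -/
lemma isPullback_arity (f : P ⟶ R) (g : Q ⟶ R) (n : ℕ) :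
    IsPullback (arityMap (operadPullbackFst f g) n) (arityMap (operadPullbackSnd f g) n)
      (arityMap f n) (arityMap g n) := by
  refine isPullback_of_app ?_ (fun d c c' h h' => Subtype.ext (Prod.ext h h'))
    (fun d c c' h => ⟨⟨(c, c'), h⟩, rfl, rfl⟩)
  rw [← arityMap_comp, operadPullback_condition, arityMap_comp]

/-- Morphisms of simplicial operads which are trivial Kan fibrations on the spaces of
operations. -/
def IsOperadTrivialFibration (f : P ⟶ Q) : Prop :=
  ∀ n, IsTrivialKanFibration (arityMap f n)

lemma IsOperadTrivialFibration.weakEquivalence {f : P ⟶ Q} (h : IsOperadTrivialFibration f) :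
    operadWeakEquivalences f :=
  fun n => (h n).isWeakHomotopyEquiv

/-- This base change property is the only fibration-theoretic fact about operads that is used; it
replaces a model structure on operads. -/
lemma IsOperadTrivialFibration.pullbackFst (f : P ⟶ R) {g : Q ⟶ R}
    (h : IsOperadTrivialFibration g) : IsOperadTrivialFibration (operadPullbackFst f g) :=
  fun n => (h n).of_isPullback (isPullback_arity f g n).flip

instance : operadWeakEquivalences.{v}.HasTwoOutOfThreeProperty where
  comp_mem _ _ h h' n := (h n).comp (h' n)
  of_postcomp _ _ h h' n := (h n).of_postcomp (h' n)
  of_precomp _ _ h h' n := (h n).of_precomp (h' n)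

lemma isIso_toHo_map {f : P ⟶ Q} (h : operadWeakEquivalences f) : IsIso (toHo.map f) :=
  (hoIso f h).isIso_hom

end SimplicialOperadPullback

/-! ### Spaces of operations of endomorphism operads -/

section EndArity
open SimplicialCategory

variable {D : Type u} [Category.{v} D] [MonoidalCategory D] [SymmetricCategory D]
  [SimplicialCategory D] [SimplicialTensor D] {d : SimplexCategoryᵒᵖ}

/-- The identification of tensor powers in `D` and in `Level D d`. -/
noncomputable def powerComparison (d : SimplexCategoryᵒᵖ) (x : D) (n : ℕ) :
    power (toLevel d x) n ⟶ toLevel d (power x n) :=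
  laxTens (levelInclusion D d) (fun _ : Fin n => x) Enum.list

instance isIso_powerComparison (x : D) (n : ℕ) : IsIso (powerComparison d x n) :=
  isIso_laxTens_levelInclusion (fun _ : Fin n => x) Enum.list

lemma powerComparison_powerHom {y z : D} (f : y ⟶ z) (n : ℕ) :
    powerComparison d y n ≫ toLevelHom d (powerHom f (Fin n)) =
      powerHom (toLevelHom d f) (Fin n) ≫ powerComparison d z n :=
  laxBigTensor_map (levelInclusion D d) (Y := fun _ : Fin n => y) (X := fun _ : Fin n => z)
    Function.bijective_id (fun _ => f)

lemma comp_map_id_eq {C : Type u} [Category.{v} C] {C' : Type u'} [Category.{v'} C'] (G : C ⥤ C')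
    {W : C'} {X : C} (m : W ⟶ G.obj X) : m ≫ G.map (𝟙 X) = 𝟙 W ≫ m := by
  simp

lemma comp_map_eq {C : Type u} [Category.{v} C] {C' : Type u'} [Category.{v'} C'] (G : C ⥤ C')
    {U W : C'} {X Y Z : C} {l : W ⟶ G.obj X} {f : X ⟶ Y} {k : W ⟶ U} {m : U ⟶ G.obj Y}
    (h : l ≫ G.map f = k ≫ m) (g : Y ⟶ Z) : l ≫ G.map (f ≫ g) = k ≫ m ≫ G.map g := by
  rw [G.map_comp, reassoc_of% h]

lemma comp_eq_iff_of_isIso {C : Type u} [Category.{v} C] {p q a b y z : C} (i : p ⟶ a) (j : q ⟶ b)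
    [IsIso i] [IsIso j] {F : p ⟶ q} {G : a ⟶ b} (e : i ≫ G = F ≫ j) (c : p ⟶ y) (f : y ⟶ z)
    (c' : q ⟶ z) :
    (inv i ≫ c) ≫ f = G ≫ inv j ≫ c' ↔ c ≫ f = F ≫ c' := by
  rw [Category.assoc, ← cancel_epi i, IsIso.hom_inv_id_assoc, reassoc_of% e,
    IsIso.hom_inv_id_assoc]

/-- The operads are built from tensor powers in `Level D d`, whereas mapping spaces use the powers
in `D`. The isomorphisms `powerComparison` are compatible with `f^n`, so the two forms of the
compatibility condition with `f` are equivalent. This square carries all homotopical information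
about `End(f)` into mapping spaces. -/
lemma isPullback_endoHom {y z : D} (f : y ⟶ z) (n : ℕ) :
    IsPullback (arityMap (endoHomSource f) n) (arityMap (endoHomTarget f) n)
      ((endoArityIso y n).hom ≫ eHomWhiskerLeft SSet.{v} (power y n) f)
      ((endoArityIso z n).hom ≫ eHomWhiskerRight SSet.{v} (powerHom f (Fin n)) z) := by
  have key (d) (c : power (toLevel d y) n ⟶ toLevel d y) (c' : power (toLevel d z) n ⟶ toLevel d z) :
      ((endoArityIso y n).hom ≫ eHomWhiskerLeft SSet.{v} (power y n) f).app d c =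
        ((endoArityIso z n).hom ≫ eHomWhiskerRight SSet.{v} (powerHom f (Fin n)) z).app d c' ↔
      c ≫ toLevelHom d f = powerHom (toLevelHom d f) (Fin n) ≫ c' :=
    comp_eq_iff_of_isIso (powerComparison d y n) (powerComparison d z n)
      (powerComparison_powerHom f n) c (toLevelHom d f) c'
  refine isPullback_of_app ?_ (fun d c c' h h' => Subtype.ext (Prod.ext h h'))
    (fun d c c' h => ⟨⟨(c, c'), (key d c c').1 h⟩, rfl, rfl⟩)
  ext d c
  exact (key d _ _).2 c.2

variable {D' : Type u'} [Category.{v} D'] [MonoidalCategory D'] [SymmetricCategory D']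
  [SimplicialCategory D'] [SimplicialTensor D'] (R : D' ⥤ D) [SimplicialLaxFunctor R]

open Functor.LaxMonoidal in
-- The two sides are the lax structure maps of the two composites in the square formed by `R` and
-- the inclusions of degenerate simplices. They agree because the inclusions have identities as
-- structure maps.
lemma laxTens_levelFunctor {ι : Type} (X : ι → D') (l : List ι) :
    laxTens (levelFunctor R d) (fun i => toLevel d (X i)) l ≫
        (levelFunctor R d).map (laxTens (levelInclusion D' d) X l) =
      laxTens (levelInclusion D d) (fun i => R.obj (X i)) l ≫
        (levelInclusion D d).map (laxTens R X l) := by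
  induction l with
  | nil =>
    change toLevelHom d (ε R) ≫ (levelFunctor R d).map (𝟙 (toLevel d (𝟙_ D'))) =
      𝟙 _ ≫ toLevelHom d (ε R)
    exact comp_map_id_eq (levelFunctor R d) _
  | cons a l ih =>
    have h := laxTens_comp_cons (levelInclusion D' d) (levelFunctor R d) X a l
    have h' := laxTens_comp_cons R (levelInclusion D d) X a l
    refine h.trans (Eq.trans ?_ h'.symm)
    refine congrArg₂ (fun k k' => (toLevel d (R.obj (X a)) ◁ k) ≫ k') ih ?_
    change toLevelHom d (μ R (X a) (tens X l)) ≫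
        (levelFunctor R d).map (𝟙 (toLevel d (X a ⊗ tens X l))) =
      𝟙 _ ≫ toLevelHom d (μ R (X a) (tens X l))
    exact comp_map_id_eq (levelFunctor R d) _

/-- The action of a simplicial lax monoidal functor on the spaces of operations. -/
lemma arityMap_endoFunctor (x : D') (n : ℕ) :
    arityMap (endoFunctor R x) n ≫ (endoArityIso (R.obj x) n).hom =
      (endoArityIso x n).hom ≫ SimplicialFunctor.sMap (F := R) (power x n) x ≫
        eHomWhiskerRight SSet.{v} (laxTens R (fun _ : Fin n => x) Enum.list) (R.obj x) := by
  rw [← Iso.inv_comp_eq]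
  ext d c
  let c' : toLevel d (power x n) ⟶ toLevel d x := c
  change inv (powerComparison d (R.obj x) n) ≫
    laxTens (levelFunctor R d) (fun _ : Fin n => toLevel d x) Enum.list ≫
      (levelFunctor R d).map (powerComparison d x n ≫ c') =
    toLevelHom d (laxTens R (fun _ : Fin n => x) Enum.list) ≫ (levelFunctor R d).map c'
  have h := laxTens_levelFunctor (d := d) R (fun _ : Fin n => x) Enum.list
  rw [IsIso.inv_comp_eq]
  exact comp_map_eq (levelFunctor R d) h c'

end EndArity

/-! ### Spans of endomorphism operads and their composition -/

section Spans
open SimplicialCategory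

lemma powerHom_comp {C : Type u} [Category.{v} C] [MonoidalCategory C] [SymmetricCategory C]
    {a b c : C} (f : a ⟶ b) (g : b ⟶ c) (ι : Type) [Enum ι] :
    powerHom (f ≫ g) ι = powerHom f ι ≫ powerHom g ι :=
  (bigTensorHom_comp _ _).symm

lemma comp_comp_eq {C : Type u} [Category.{v} C] {A B E X Y Z : C} {a : A ⟶ X} {b : B ⟶ Y}
    {c : E ⟶ Z} {f : X ⟶ Y} {g : Y ⟶ Z} {F : A ⟶ B} {G : B ⟶ E} (h : a ≫ f = F ≫ b)
    (h' : b ≫ g = G ≫ c) : a ≫ f ≫ g = (F ≫ G) ≫ c := by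
  rw [reassoc_of% h, h', Category.assoc]

variable {D : Type u} [Category.{v} D] [MonoidalCategory D] [SymmetricCategory D]
  [SimplicialCategory D] [SimplicialTensor D] {a b c : D}

/-- The endomorphism operad of a pair of composable morphisms. -/
noncomputable abbrev endoPair (f : a ⟶ b) (g : b ⟶ c) : SimplicialObject Operad.{v} :=
  operadPullback (endoHomTarget f) (endoHomSource g)

/-- The projection to the endomorphism operad of the composite. -/
noncomputable def endoPairComp (f : a ⟶ b) (g : b ⟶ c) : endoPair f g ⟶ endoHom (f ≫ g) where
  app d :=
    { app n c := ⟨(c.1.1.1.1, c.1.2.1.2), by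
        rw [toLevelHom_comp, powerHom_comp]
        have h := c.2
        refine comp_comp_eq (a := c.1.1.1.1) c.1.1.2 ?_
        rw [show c.1.1.1.2 = c.1.2.1.1 from h]
        exact c.1.2.2⟩
      app_act _ _ := rfl
      app_one := rfl
      app_comp _ _ _ := rfl }

lemma endoPairComp_target (f : a ⟶ b) (g : b ⟶ c) :
    endoPairComp f g ≫ endoHomTarget (f ≫ g) = operadPullbackSnd _ _ ≫ endoHomTarget g := rfl

lemma endoPairComp_source (f : a ⟶ b) (g : b ⟶ c) :
    endoPairComp f g ≫ endoHomSource (f ≫ g) = operadPullbackFst _ _ ≫ endoHomSource f := rfl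

/-- The morphism in the homotopy category given by the zigzag `End(b) ⟵ End(f) ⟶ End(a)`. -/
noncomputable def hoSpan (f : a ⟶ b) (h : operadWeakEquivalences (endoHomTarget f)) :
    toHo.obj (endo b) ⟶ toHo.obj (endo a) :=
  (hoIso (endoHomTarget f) h).inv ≫ toHo.map (endoHomSource f)

lemma map_comp_hoSpan (f : a ⟶ b) (h : operadWeakEquivalences (endoHomTarget f)) :
    toHo.map (endoHomTarget f) ≫ hoSpan f h = toHo.map (endoHomSource f) :=
  (hoIso (endoHomTarget f) h).hom_inv_id_assoc _

/-- The spans of `f` and `g` are composed over the fibre product `endoPair f g`, and forgetting the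
operation on the middle object maps this composite span to the span of `f ≫ g`. Both arrows
cancelled in the proof are invertible in the homotopy category, so it suffices to compare after
restriction to `endoPair f g`, where the equality is the commutativity of the fibre square. -/
lemma hoSpan_comp (f : a ⟶ b) (g : b ⟶ c) (hf : operadWeakEquivalences (endoHomTarget f))
    (hg : operadWeakEquivalences (endoHomTarget g))
    (hfg : operadWeakEquivalences (endoHomTarget (f ≫ g)))
    (h : operadWeakEquivalences (endoPairComp f g)) :
    hoSpan (f ≫ g) hfg = hoSpan g hg ≫ hoSpan f hf := by
  have := isIso_toHo_map h
  have := isIso_toHo_map hfg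
  rw [← cancel_epi (toHo.map (endoHomTarget (f ≫ g))), ← cancel_epi (toHo.map (endoPairComp f g)),
    map_comp_hoSpan, ← Functor.map_comp, endoPairComp_source, ← Functor.map_comp_assoc,
    endoPairComp_target, Functor.map_comp_assoc, reassoc_of% map_comp_hoSpan g hg,
    ← Functor.map_comp_assoc, ← operadPullback_condition, Functor.map_comp_assoc,
    map_comp_hoSpan, ← Functor.map_comp]

end Spans

lemma exists_of_isPullback_app {X Y Z K : SSet.{v}} {f : X ⟶ Y} {g : Z ⟶ K} {t : X ⟶ Z} {b : Y ⟶ K}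
    (sq : IsPullback t f g b) (d : SimplexCategoryᵒᵖ) (z : Z.obj d) (y : Y.obj d)
    (h : g.app d z = b.app d y) : ∃ x, t.app d x = z ∧ f.app d x = y :=
  Limits.Types.exists_of_isPullback (sq.map ((evaluation _ _).obj d)) z y h

/-! ### Trivial fibrations, trivial cofibrations and independence of the factorization -/

section EndomorphismOperads
open SimplicialCategory Limits

variable {D : Type u} [Category.{v} D] [ModelCategory D] [MonoidalCategory D]
  [SymmetricCategory D] [SimplicialCategory D] [SimplicialTensor D] [IsOperadicModelCategory D]
  {w y z z' : D}

/-- It is a base change of `Map(y^n, y) ⟶ Map(y^n, z)`, and `y^n` is cofibrant. -/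
lemma endoHomTarget_trivialFibration (p : y ⟶ z) [IsCofibrant y] [Fibration p]
    [WeakEquivalence p] : IsOperadTrivialFibration (endoHomTarget p) := fun n =>
  .of_isPullback (isPullback_endoHom p n)
    (isTrivialKanFibration_comp (isTrivialKanFibration_of_isIso _)
      (isTrivialKanFibration_eHomWhiskerLeft _ p))

/-- It is a base change of the restriction `Map(z^n, z) ⟶ Map(y^n, z)` along the trivial cofibration
`j^n`. -/
lemma endoHomSource_trivialFibration (j : y ⟶ z) [IsCofibrant y] [Cofibration j]
    [WeakEquivalence j] [IsFibrant z] : IsOperadTrivialFibration (endoHomSource j) := fun n =>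
  .of_isPullback (isPullback_endoHom j n).flip
    (isTrivialKanFibration_comp (isTrivialKanFibration_of_isIso _)
      (isTrivialKanFibration_eHomWhiskerRight _ z))

/-- Two-out-of-three in the pullback square: the projection to the source and both maps of the
cospan are weak equivalences, the map `Map(y^n, y) ⟶ Map(y^n, z)` because `j` is a simplicial
homotopy equivalence. -/
lemma endoHomTarget_weakEquivalence (j : y ⟶ z) [IsCofibrant y] [Cofibration j]
    [WeakEquivalence j] [IsFibrant y] [IsFibrant z] :
    operadWeakEquivalences (endoHomTarget j) := by
  intro n
  refine .of_postcomp (g := (endoArityIso z n).hom ≫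
    eHomWhiskerRight SSet.{v} (powerHom j (Fin n)) z) ?_ ?_
  · exact (isWeakHomotopyEquiv_of_isIso _).comp
      (isTrivialKanFibration_eHomWhiskerRight _ z).isWeakHomotopyEquiv
  · rw [← (isPullback_endoHom j n).w]
    exact (endoHomSource_trivialFibration j).weakEquivalence n |>.comp
      ((isWeakHomotopyEquiv_of_isIso _).comp (isWeakHomotopyEquiv_eHomWhiskerLeft _ j))

lemma pullback_lift_app_eq {A B X Y Z : SSet.{v}} {f : X ⟶ Z} {g : Y ⟶ Z} {a : A ⟶ X} {b : A ⟶ Y}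
    {a' : B ⟶ X} {b' : B ⟶ Y} (e : a ≫ f = b ≫ g) (e' : a' ≫ f = b' ≫ g) {d : SimplexCategoryᵒᵖ}
    {s : A.obj d} {t : B.obj d}
    (h : (pullback.lift a b e).app d s = (pullback.lift a' b' e').app d t) :
    a.app d s = a'.app d t ∧ b.app d s = b'.app d t := by
  have h1 := congrArg ((pullback.fst f g).app d) h
  have h2 := congrArg ((pullback.snd f g).app d) h
  simp only [← NatTrans.comp_app_apply, pullback.lift_fst, pullback.lift_snd] at h1 h2
  exact ⟨h1, h2⟩

/-- Given operations on `y` and `w` compatible with `k ≫ p`, the missing datum is an operation on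
`z` with prescribed restriction along `k^n` and prescribed composite with `p`. Such operations form
a fibre of the corner map `Map(z^n, z) ⟶ Map(y^n, z) ×_{Map(y^n, w)} Map(z^n, w)`, which is a
trivial Kan fibration since `k^n` is a trivial cofibration and `p` a fibration. -/
lemma endoPairComp_trivialFibration (k : y ⟶ z) (p : z ⟶ w) [IsCofibrant y] [Cofibration k]
    [WeakEquivalence k] [Fibration p] : IsOperadTrivialFibration (endoPairComp k p) := by
  intro n
  have hw := (isPullback_endoHom (k ≫ p) n).w
  rw [powerHom_comp, eHomWhiskerLeft_comp, eHomWhiskerRight_comp] at hw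
  -- The top map of the square extracts the operation on `z`. The bottom map sends a compatible pair
  -- on `y` and `w` to its composites with `k` and `p^n`, which agree in `Map(y^n, w)` by `hw`.
  refine .of_isPullback
    (t := arityMap (operadPullbackFst _ _) n ≫ arityMap (endoHomTarget k) n ≫
      (endoArityIso z n).hom)
    (b := pullback.lift
      (arityMap (endoHomSource (k ≫ p)) n ≫ (endoArityIso y n).hom ≫
        eHomWhiskerLeft SSet.{v} (power y n) k)
      (arityMap (endoHomTarget (k ≫ p)) n ≫ (endoArityIso w n).hom ≫
        eHomWhiskerRight SSet.{v} (powerHom p (Fin n)) w) (by simpa using hw))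
    ?_ (IsSimplicialModelCategory.isTrivialKanFibration_pullbackHom (powerHom k (Fin n)) p
      (.inl inferInstance))
  have hk := isPullback_endoHom k n
  have hp := isPullback_endoHom p n
  refine isPullback_of_app ?_ ?_ ?_
  · apply pullback.hom_ext
    · simp only [Category.assoc, pullbackHom, pullback.lift_fst]
      rw [← hk.w]
      rfl
    · simp only [Category.assoc, pullbackHom, pullback.lift_snd]
      rw [← reassoc_of% arityMap_comp, operadPullback_condition, arityMap_comp, Category.assoc,
        hp.w]
      rfl
  · intro d c c' h h'
    have h1 : c.1.1.1.2 = c'.1.1.1.2 := by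
      have : Function.Injective ((endoArityIso z n).hom.app d) :=
        ((isIso_iff_bijective _).1 inferInstance).1
      exact this h
    have h2 : c.1.1.1.1 = c'.1.1.1.1 := congrArg (fun e => e.1.1) h'
    have h3 : c.1.2.1.2 = c'.1.2.1.2 := congrArg (fun e => e.1.2) h'
    have h4 : c.1.2.1.1 = c'.1.2.1.1 := c.2.symm.trans (h1.trans c'.2)
    exact Subtype.ext (Prod.ext (Subtype.ext (Prod.ext h2 h1)) (Subtype.ext (Prod.ext h4 h3)))
  · intro d m e h
    obtain ⟨β, rfl⟩ : ∃ β, (endoArityIso z n).hom.app d β = m :=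
      ((isIso_iff_bijective ((endoArityIso z n).hom.app d)).1 inferInstance).2 m
    obtain ⟨h1, h2⟩ := pullback_lift_app_eq _ _ h
    -- The two components of the equality in the fibre product say that `β` is compatible with the
    -- operation on `y` along `k` and with the operation on `w` along `p`.
    obtain ⟨a, ha, ha'⟩ := exists_of_isPullback_app hk d _ β h1.symm
    obtain ⟨b, hb, hb'⟩ := exists_of_isPullback_app hp d β _ h2
    exact ⟨⟨(a, b), ha'.trans hb.symm⟩, congrArg ((endoArityIso z n).hom.app d) ha',
      Subtype.ext (Prod.ext ha hb')⟩

/-- All projections to endomorphism operads of sources are trivial fibrations here, so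
two-out-of-three applies to the triangle over `End(y)`. -/
lemma endoPairComp_weakEquivalence (j : y ⟶ z) (k : z ⟶ z') [IsCofibrant y] [Cofibration j]
    [WeakEquivalence j] [Cofibration k] [WeakEquivalence k] [IsFibrant z] [IsFibrant z'] :
    operadWeakEquivalences (endoPairComp j k) := by
  have : IsCofibrant z := isCofibrant_of_cofibration j
  refine operadWeakEquivalences.of_postcomp _ (endoHomSource (j ≫ k))
    (endoHomSource_trivialFibration _).weakEquivalence ?_
  rw [endoPairComp_source]
  exact operadWeakEquivalences.comp_mem _ _
    (IsOperadTrivialFibration.pullbackFst _ (endoHomSource_trivialFibration k)).weakEquivalence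
    (endoHomSource_trivialFibration j).weakEquivalence

/-- The zigzags of two factorizations which are related by a trivial cofibration agree. -/
lemma hoSpan_comp_hoSpan_eq [IsCofibrant y] [IsFibrant y] [IsFibrant w] (j : y ⟶ z) (k : z ⟶ z')
    {p : z ⟶ w} (p' : z' ⟶ w) {j' : y ⟶ z'} [Cofibration j] [WeakEquivalence j] [Cofibration k]
    [WeakEquivalence k] [Fibration p] [Fibration p'] [WeakEquivalence p]
    (hp : k ≫ p' = p) (hj : j ≫ k = j') (h₁ : operadWeakEquivalences (endoHomTarget p))
    (h₂ : operadWeakEquivalences (endoHomTarget j))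
    (h₃ : operadWeakEquivalences (endoHomTarget p'))
    (h₄ : operadWeakEquivalences (endoHomTarget j')) :
    hoSpan p h₁ ≫ hoSpan j h₂ = hoSpan p' h₃ ≫ hoSpan j' h₄ := by
  subst hp hj
  have : IsCofibrant z := isCofibrant_of_cofibration j
  have : IsFibrant z := isFibrant_of_fibration (k ≫ p')
  have : IsFibrant z' := isFibrant_of_fibration p'
  have hk := endoHomTarget_weakEquivalence k
  -- The span of `k` can be absorbed into that of `p'`, giving `p = k ≫ p'`, or into that of `j`,
  -- giving `j ≫ k`; both sides equal the triple composite.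
  rw [hoSpan_comp k p' hk h₃ h₁ (endoPairComp_trivialFibration k p').weakEquivalence,
    hoSpan_comp j k h₂ hk h₄ (endoPairComp_weakEquivalence j k), Category.assoc]

/-- Both factorizations are refined by a third one, whose middle object receives trivial
cofibrations from `z` and `z'` that agree on `y`. -/
lemma hoSpan_comp_hoSpan_unique [IsCofibrant y] [IsFibrant y] [IsFibrant w] {f : y ⟶ w}
    [WeakEquivalence f] (j : y ⟶ z) (p : z ⟶ w) (j' : y ⟶ z') (p' : z' ⟶ w) [Cofibration j]
    [WeakEquivalence j] [Cofibration j'] [WeakEquivalence j'] [Fibration p] [Fibration p']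
    (hp : j ≫ p = f) (hp' : j' ≫ p' = f) (h₁ : operadWeakEquivalences (endoHomTarget p))
    (h₂ : operadWeakEquivalences (endoHomTarget j))
    (h₃ : operadWeakEquivalences (endoHomTarget p'))
    (h₄ : operadWeakEquivalences (endoHomTarget j')) :
    hoSpan p h₁ ≫ hoSpan j h₂ = hoSpan p' h₃ ≫ hoSpan j' h₄ := by
  have : WeakEquivalence p := weakEquivalence_of_precomp_of_fac hp
  have : WeakEquivalence p' := weakEquivalence_of_precomp_of_fac hp'
  -- The coprojections into the pushout of `j` and `j'` are trivial cofibrations by cobase change;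
  -- factoring the map from the pushout to `w` makes the target side a fibration again.
  have F := MorphismProperty.factorizationData (trivialCofibrations D) (fibrations D)
    (pushout.desc p p' (hp.trans hp'.symm))
  have e : (pushout.inl j j' ≫ F.i) ≫ F.p = p := by
    rw [Category.assoc, F.fac]
    exact pushout.inl_desc _ _ _
  have e' : (pushout.inr j j' ≫ F.i) ≫ F.p = p' := by
    rw [Category.assoc, F.fac]
    exact pushout.inr_desc _ _ _
  have : WeakEquivalence F.p := weakEquivalence_of_precomp_of_fac e
  have : IsFibrant F.Z := isFibrant_of_fibration F.p
  have : IsCofibrant z := isCofibrant_of_cofibration j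
  have : IsCofibrant F.Z := isCofibrant_of_cofibration (pushout.inl j j' ≫ F.i)
  have h₅ := (endoHomTarget_trivialFibration F.p).weakEquivalence
  have h₆ := endoHomTarget_weakEquivalence (j ≫ pushout.inl j j' ≫ F.i)
  exact (hoSpan_comp_hoSpan_eq j _ F.p e rfl h₁ h₂ h₅ h₆).trans
    (hoSpan_comp_hoSpan_eq j' _ F.p e' (by simp [pushout.condition_assoc]) h₃ h₄ h₅ h₆).symm

end EndomorphismOperads

/-! ### Operadic Quillen adjunctions and the case of a Quillen equivalence -/

section Adjunctions
open SimplicialCategory Limits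

section
variable {D : Type u} [Category.{v} D] [SimplicialCategory D] {D' : Type u'} [Category.{v} D']
  [SimplicialCategory D'] (F : D ⥤ D') [SimplicialFunctor F]

lemma sMap_eHomWhiskerRight {x y : D} (f : x ⟶ y) (z : D) :
    eHomWhiskerRight SSet.{v} f z ≫ SimplicialFunctor.sMap (F := F) x z =
      SimplicialFunctor.sMap (F := F) y z ≫ eHomWhiskerRight SSet.{v} (F.map f) (F.obj z) := by
  ext d c
  refine (SimplicialFunctor.sMap_comp (F := F) d (sConst d f) c).trans ?_
  rw [SimplicialFunctor.sMap_const]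
  rfl

lemma sMap_eHomWhiskerLeft (x : D) {y z : D} (f : y ⟶ z) :
    eHomWhiskerLeft SSet.{v} x f ≫ SimplicialFunctor.sMap (F := F) x z =
      SimplicialFunctor.sMap (F := F) x y ≫ eHomWhiskerLeft SSet.{v} (F.obj x) (F.map f) := by
  ext d c
  refine (SimplicialFunctor.sMap_comp (F := F) d c (sConst d f)).trans ?_
  rw [SimplicialFunctor.sMap_const]
  rfl

end

section
variable {D : Type u} [Category.{v} D] [MonoidalCategory D]
  [SymmetricCategory D] [SimplicialCategory D] [SimplicialTensor D]
  {D' : Type u'} [Category.{v} D'] [MonoidalCategory D']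
  [SymmetricCategory D'] [SimplicialCategory D'] [SimplicialTensor D']
  {L : D ⥤ D'} {R : D' ⥤ D} [SimplicialLaxFunctor R] (adj : L ⊣ R)

/-- Naturality of the enriched adjunction in the first variable. Applied to `z^n ⟶ R(x^n)`, it
trades the action of `R` on mapping spaces for precomposition with the adjoint `L(z^n) ⟶ x^n`. -/
lemma sMap_eHomWhiskerRight_homEquiv {a : D} {b : D'} (θ : L.obj a ⟶ b) (x : D') :
    SimplicialFunctor.sMap (F := R) b x ≫
        eHomWhiskerRight SSet.{v} (adj.homEquiv a b θ) (R.obj x) =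
      eHomWhiskerRight SSet.{v} θ x ≫ SimplicialFunctor.sMap (F := R) (L.obj a) x ≫
        eHomWhiskerRight SSet.{v} (adj.unit.app a) (R.obj x) := by
  rw [Adjunction.homEquiv_unit, eHomWhiskerRight_comp, reassoc_of% sMap_eHomWhiskerRight R]

lemma homEquiv_symm_tensor {a b : D} {x y : D'} (f : a ⟶ R.obj x) (g : b ⟶ R.obj y) :
    (adj.homEquiv _ _).symm ((f ⊗ₘ g) ≫ Functor.LaxMonoidal.μ R x y) =
      comparison adj a b ≫ ((adj.homEquiv _ _).symm f ⊗ₘ (adj.homEquiv _ _).symm g) := by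
  rw [comparison, ← Adjunction.homEquiv_naturality_right_symm, Category.assoc,
    ← Functor.LaxMonoidal.μ_natural, tensorHom_comp_tensorHom_assoc,
    ← Adjunction.homEquiv_unit, ← Adjunction.homEquiv_unit, Equiv.apply_symm_apply,
    Equiv.apply_symm_apply]

end

variable {D : Type u} [Category.{v} D] [ModelCategory D] [MonoidalCategory D]
  [SymmetricCategory D] [SimplicialCategory D] [SimplicialTensor D]
  {D' : Type u'} [Category.{v} D'] [ModelCategory D'] [MonoidalCategory D']
  [SymmetricCategory D'] [SimplicialCategory D'] [SimplicialTensor D']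
  {L : D ⥤ D'} {R : D' ⥤ D} [SimplicialFunctor L] [SimplicialLaxFunctor R] (adj : L ⊣ R)
  [IsOperadicQuillenAdjunction adj]

include adj in
lemma isFibrant_rightAdjoint_obj (x : D') [IsFibrant x] : IsFibrant (R.obj x) := by
  have := IsOperadicQuillenAdjunction.fibration_map adj (terminal.from x)
  have := adj.rightAdjoint_preservesLimits
  exact (isFibrant_iff_of_isTerminal (R.map (terminal.from x))
    (terminalIsTerminal.isTerminalObj R _)).2 inferInstance

include adj in
lemma isCofibrant_leftAdjoint_obj (a : D) [IsCofibrant a] : IsCofibrant (L.obj a) := by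
  have := IsOperadicQuillenAdjunction.cofibration_map adj (initial.to a)
  have := adj.leftAdjoint_preservesColimits
  exact (isCofibrant_iff_of_isInitial (L.map (initial.to a))
    (initialIsInitial.isInitialObj L _)).2 inferInstance

include adj in
-- Trivial cofibrations are detected by lifting against fibrations, and `R` preserves fibrations.
-- Ken Brown's argument then extends this to weak equivalences between cofibrant objects.
lemma weakEquivalence_leftAdjoint_map_of_cofibration {a b : D} (i : a ⟶ b) [Cofibration i]
    [WeakEquivalence i] : WeakEquivalence (L.map i) := by
  have h : trivialCofibrations D' (L.map i) := by
    rw [← fibrations_llp]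
    intro x y p hp
    rw [← fibration_iff] at hp
    have := IsOperadicQuillenAdjunction.fibration_map adj p
    rw [adj.hasLiftingProperty_iff]
    infer_instance
  exact (weakEquivalence_iff _).2 h.2

include adj in
lemma weakEquivalence_leftAdjoint_map {a b : D} (f : a ⟶ b) [IsCofibrant a] [IsCofibrant b]
    [WeakEquivalence f] : WeakEquivalence (L.map f) := by
  obtain ⟨h⟩ : Nonempty (CofibrantBrownFactorization f) := inferInstance
  have := weakEquivalence_leftAdjoint_map_of_cofibration adj h.i
  have := weakEquivalence_leftAdjoint_map_of_cofibration adj h.s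
  have : WeakEquivalence (L.map h.p) :=
    weakEquivalence_of_precomp_of_fac (f := L.map h.s) (fg := 𝟙 _)
      (by rw [← L.map_comp, h.s_p, L.map_id])
  rw [← h.fac, L.map_comp]
  infer_instance

/-- The adjunction isomorphism of mapping spaces. -/
lemma isIso_sMap_unit (a : D) (x : D') :
    IsIso (SimplicialFunctor.sMap (F := R) (L.obj a) x ≫
      eHomWhiskerRight SSet.{v} (adj.unit.app a) (R.obj x)) := by
  let η : a ⟶ R.obj (L.obj a) := adj.unit.app a
  let ε : L.obj (R.obj x) ⟶ x := adj.counit.app x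
  -- The inverse applies `L` and composes with the counit. Simplicial naturality of the unit and
  -- counit reduces the two composites to the triangle identities.
  refine ⟨SimplicialFunctor.sMap (F := L) a (R.obj x) ≫ eHomWhiskerLeft SSet.{v} (L.obj a) ε,
    ?_, ?_⟩
  · have h : SimplicialFunctor.sMap (F := R) (L.obj a) x ≫
        SimplicialFunctor.sMap (F := L) (R.obj (L.obj a)) (R.obj x) ≫
          eHomWhiskerLeft SSet.{v} _ ε =
        eHomWhiskerRight SSet.{v} (adj.counit.app (L.obj a)) x := by
      ext d c
      exact IsOperadicQuillenAdjunction.counit_natural (adj := adj) d c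
    change (SimplicialFunctor.sMap (F := R) (L.obj a) x ≫
      eHomWhiskerRight SSet.{v} η (R.obj x)) ≫ _ = 𝟙 (sHom (L.obj a) x)
    rw [Category.assoc, reassoc_of% sMap_eHomWhiskerRight L η, ← eHom_whisker_exchange,
      reassoc_of% h]
    refine (eHomWhiskerRight_comp SSet.{v} (L.map η) (adj.counit.app (L.obj a)) x).symm.trans ?_
    rw [adj.left_triangle_components]
    exact eHomWhiskerRight_id SSet.{v} _ _
  · have h : SimplicialFunctor.sMap (F := L) a (R.obj x) ≫
        SimplicialFunctor.sMap (F := R) (L.obj a) (L.obj (R.obj x)) ≫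
          eHomWhiskerRight SSet.{v} η _ =
        eHomWhiskerLeft SSet.{v} a (adj.unit.app (R.obj x)) := by
      ext d c
      exact (IsOperadicQuillenAdjunction.unit_natural (adj := adj) d c).symm
    change (SimplicialFunctor.sMap (F := L) a (R.obj x) ≫ _) ≫
      SimplicialFunctor.sMap (F := R) (L.obj a) x ≫ eHomWhiskerRight SSet.{v} η (R.obj x) =
      𝟙 (sHom a (R.obj x))
    rw [Category.assoc, reassoc_of% sMap_eHomWhiskerLeft R, eHom_whisker_exchange,
      reassoc_of% h]
    refine (eHomWhiskerLeft_comp SSet.{v} a (adj.unit.app (R.obj x)) (R.map ε)).symm.trans ?_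
    rw [adj.right_triangle_components]
    exact eHomWhiskerLeft_id SSet.{v} _ _

variable [IsOperadicModelCategory D]

/-- As the unit of `D` is already cofibrant, `L` preserves the weak equivalence from its cofibrant
replacement, which can therefore be cancelled. -/
lemma weakEquivalence_unitComparison : WeakEquivalence (unitComparison adj) := by
  obtain ⟨c, q, _, _, h⟩ :=
    IsOperadicQuillenAdjunction.exists_weakEquivalence_unitComparison (adj := adj)
  have := isCofibrant_tensorUnit D
  have := weakEquivalence_leftAdjoint_map adj q
  exact weakEquivalence_of_precomp (L.map q) _

variable [IsOperadicModelCategory D']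

/-- The adjoint of the canonical morphism `z ^ n ⟶ (R x) ^ n ⟶ R (x ^ n)`. -/
lemma weakEquivalence_homEquiv_symm_laxTens {z : D} {x : D'} [IsCofibrant z] [IsCofibrant x]
    (p : z ⟶ R.obj x) (hp : WeakEquivalence ((adj.homEquiv z x).symm p)) {ι : Type}
    (l : List ι) :
    WeakEquivalence ((adj.homEquiv _ _).symm
      ((Shuf.refl l).ten (Y := fun _ => z) (X := fun _ => R.obj x) (fun _ => p) ≫
        laxTens R (fun _ => x) l)) := by
  induction l with
  | nil =>
    have := weakEquivalence_unitComparison adj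
    rw [show (Shuf.refl ([] : List ι)).ten (Y := fun _ => z) (X := fun _ => R.obj x) (fun _ => p) ≫
      laxTens R (fun _ => x) [] = Functor.LaxMonoidal.ε R from Category.id_comp _]
    exact this
  | cons i l ih =>
    have e : (Shuf.refl (i :: l)).ten (Y := fun _ => z) (X := fun _ => R.obj x) (fun _ => p) ≫
        laxTens R (fun _ => x) (i :: l) =
        (p ⊗ₘ ((Shuf.refl l).ten (Y := fun _ => z) (X := fun _ => R.obj x) (fun _ => p) ≫
          laxTens R (fun _ => x) l)) ≫ Functor.LaxMonoidal.μ R _ _ := by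
      simp only [Shuf.refl, Shuf.ten, Ins.ten, laxTens, Category.comp_id]
      rw [← id_tensorHom, tensorHom_comp_tensorHom_assoc, Category.comp_id]
    -- The adjoint becomes `L(z ⊗ z^l) ⟶ L z ⊗ L(z^l) ⟶ x ⊗ x^l`. The first map is a weak
    -- equivalence by hypothesis on the adjunction; the second is the tensor product of two weak
    -- equivalences, taken one factor at a time against the cofibrant objects `L(z^l)` and `x`.
    rw [e, homEquiv_symm_tensor, MonoidalCategory.tensorHom_def]
    have := isCofibrant_leftAdjoint_obj adj (tens (fun _ : ι => z) l)
    have := IsOperadicQuillenAdjunction.weakEquivalence_comparison (adj := adj) z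
      (tens (fun _ : ι => z) l)
    infer_instance

/-- Under `Map(z^n, R x) ≅ Map(L(z^n), x)` the map becomes precomposition with the weak equivalence
`L(z^n) ⟶ x^n` of cofibrant objects, and `x` is fibrant. -/
lemma isWeakHomotopyEquiv_sMap_power {z : D} {x : D'} [IsCofibrant z] [IsCofibrant x]
    [IsFibrant x] (p : z ⟶ R.obj x) (hp : WeakEquivalence ((adj.homEquiv z x).symm p)) (n : ℕ) :
    IsWeakHomotopyEquiv (SimplicialFunctor.sMap (F := R) (power x n) x ≫
      eHomWhiskerRight SSet.{v}
        (powerHom p (Fin n) ≫ laxTens R (fun _ : Fin n => x) Enum.list) (R.obj x)) := by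
  have h := weakEquivalence_homEquiv_symm_laxTens adj p hp (Enum.list : List (Fin n))
  rw [← powerHom_eq_ten] at h
  rw [← (adj.homEquiv _ _).apply_symm_apply (powerHom p (Fin n) ≫ _),
    sMap_eHomWhiskerRight_homEquiv]
  have := isCofibrant_leftAdjoint_obj adj (power z n)
  have := isIso_sMap_unit adj (power z n) x
  exact (isWeakHomotopyEquiv_eHomWhiskerRight _ x).comp (isWeakHomotopyEquiv_of_isIso _)

/-- The zigzag is rewritten as a span from the fibre product of `End(x)` and `End(p)` over `End(R
x)`, both of whose legs are weak equivalences. The leg to `End(x)` is a base change of the trivial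
fibration `End(p) ⟶ End(R x)`. The map `End(x) ⟶ End(R x)` need not itself be a weak equivalence. -/
lemma isIso_endoFunctor_hoSpan {z : D} {x : D'} [IsCofibrant z] [IsCofibrant x] [IsFibrant x]
    (p : z ⟶ R.obj x) [Fibration p] [WeakEquivalence p]
    (hp : WeakEquivalence ((adj.homEquiv z x).symm p))
    (h : operadWeakEquivalences (endoHomTarget p)) :
    IsIso (toHo.map (endoFunctor R x) ≫ hoSpan p h) := by
  have h₁ : operadWeakEquivalences (operadPullbackFst (endoFunctor R x) (endoHomTarget p)) :=
    (IsOperadTrivialFibration.pullbackFst _ (endoHomTarget_trivialFibration p)).weakEquivalence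
  have h₂ : operadWeakEquivalences
      (operadPullbackSnd (endoFunctor R x) (endoHomTarget p) ≫ endoHomSource p) := by
    intro n
    -- The leg to `End(z)` is tested in `Map(z^n, R x)`, to which `Map(z^n, z)` maps by a trivial
    -- Kan fibration. There it agrees with the leg to `End(x)` followed by `Map(x^n, x) ⟶ Map(z^n, R
    -- x)`.
    refine .of_postcomp (g := (endoArityIso z n).hom ≫
      eHomWhiskerLeft SSet.{v} (power z n) p)
      ((isWeakHomotopyEquiv_of_isIso _).comp
        (isTrivialKanFibration_eHomWhiskerLeft _ p).isWeakHomotopyEquiv) ?_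
    have e : arityMap (operadPullbackSnd (endoFunctor R x) (endoHomTarget p) ≫ endoHomSource p) n ≫
        (endoArityIso z n).hom ≫ eHomWhiskerLeft SSet.{v} (power z n) p =
        arityMap (operadPullbackFst (endoFunctor R x) (endoHomTarget p)) n ≫
          (endoArityIso x n).hom ≫ SimplicialFunctor.sMap (F := R) (power x n) x ≫
            eHomWhiskerRight SSet.{v}
              (powerHom p (Fin n) ≫ laxTens R (fun _ : Fin n => x) Enum.list) (R.obj x) := by
      rw [arityMap_comp, Category.assoc, (isPullback_endoHom p n).w,
        ← reassoc_of% arityMap_comp, ← operadPullback_condition, arityMap_comp, Category.assoc,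
        reassoc_of% arityMap_endoFunctor R x n, eHomWhiskerRight_comp]
    rw [e]
    exact (h₁ n).comp ((isWeakHomotopyEquiv_of_isIso _).comp
      (isWeakHomotopyEquiv_sMap_power adj p hp n))
  have := isIso_toHo_map h₁
  have := isIso_toHo_map h₂
  have e : toHo.map (operadPullbackFst (endoFunctor R x) (endoHomTarget p)) ≫
      toHo.map (endoFunctor R x) ≫ hoSpan p h =
      toHo.map (operadPullbackSnd (endoFunctor R x) (endoHomTarget p) ≫ endoHomSource p) := by
    rw [← Functor.map_comp_assoc, operadPullback_condition, Functor.map_comp_assoc,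
      map_comp_hoSpan, ← Functor.map_comp]
  have : IsIso (toHo.map (operadPullbackFst (endoFunctor R x) (endoHomTarget p)) ≫
      toHo.map (endoFunctor R x) ≫ hoSpan p h) := by
    rw [e]
    infer_instance
  exact IsIso.of_isIso_comp_left (toHo.map (operadPullbackFst (endoFunctor R x) (endoHomTarget p))) _

lemma isIso_hoSpan {y z : D} [IsCofibrant y] [IsFibrant z] (j : y ⟶ z) [Cofibration j]
    [WeakEquivalence j] (h : operadWeakEquivalences (endoHomTarget j)) : IsIso (hoSpan j h) := by
  have := isIso_toHo_map (endoHomSource_trivialFibration j).weakEquivalence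
  rw [hoSpan]
  infer_instance

end Adjunctions

end OperadicModel

/-! ### The induced map of endomorphism operads -/

theorem proposition2p17 {D : Type u} [Category.{v} D] [ModelCategory D] [MonoidalCategory D]
    [SymmetricCategory D] [SimplicialCategory D] [SimplicialTensor D] [IsOperadicModelCategory D]
    {D' : Type u'} [Category.{v} D'] [ModelCategory D'] [MonoidalCategory D']
    [SymmetricCategory D'] [SimplicialCategory D'] [SimplicialTensor D']
    [IsOperadicModelCategory D'] {L : D ⥤ D'} {R : D' ⥤ D} [SimplicialFunctor L]
    [SimplicialLaxFunctor R] (adj : L ⊣ R) [IsOperadicQuillenAdjunction adj]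
    (y : D) [IsCofibrant y] [IsFibrant y] (x : D') [IsCofibrant x] [IsFibrant x]
    (f : y ⟶ R.obj x) [WeakEquivalence f] :
    (∃! φ : toHo.obj (endo x) ⟶ toHo.obj (endo y), IsInducedMap R f φ) ∧
      (IsQuillenEquivalence adj →
        ∀ φ : toHo.obj (endo x) ⟶ toHo.obj (endo y), IsInducedMap R f φ → IsIso φ) := by
  have := isFibrant_rightAdjoint_obj adj x
  have hT (z : D) (j : y ⟶ z) (p : z ⟶ R.obj x) [Cofibration j] [WeakEquivalence j] [Fibration p]
      (h : j ≫ p = f) : IsCofibrant z ∧ IsFibrant z ∧ WeakEquivalence p :=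
    ⟨isCofibrant_of_cofibration j, isFibrant_of_fibration p, weakEquivalence_of_precomp_of_fac h⟩
  have F := MorphismProperty.factorizationData (trivialCofibrations D) (fibrations D) f
  obtain ⟨_, _, _⟩ := hT F.Z F.i F.p F.fac
  have hp := (endoHomTarget_trivialFibration F.p).weakEquivalence
  have hj := endoHomTarget_weakEquivalence F.i
  refine ⟨⟨toHo.map (endoFunctor R x) ≫ hoSpan F.p hp ≫ hoSpan F.i hj, ?_, ?_⟩, ?_⟩
  · intro z j p _ _ _ h
    obtain ⟨_, _, _⟩ := hT z j p h
    have hp' := (endoHomTarget_trivialFibration p).weakEquivalence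
    have hj' := endoHomTarget_weakEquivalence j
    refine ⟨hp', hj', ?_⟩
    rw [hoSpan_comp_hoSpan_unique F.i F.p j p F.fac h hp hj hp' hj']
    simp only [hoSpan, Category.assoc]
  -- Uniqueness: the property, applied to the chosen factorization alone, already determines `φ`.
  · intro φ hφ
    obtain ⟨_, _, rfl⟩ := hφ F.Z F.i F.p F.fac
    simp only [hoSpan, Category.assoc]
  · intro hQ φ hφ
    obtain ⟨hp', hj', rfl⟩ := hφ F.Z F.i F.p F.fac
    -- The Quillen equivalence enters here, for the cofibrant object `F.Z` and the fibrant object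
    -- `x`: the adjoint of `F.p` is a weak equivalence because `F.p` is one.
    have := isIso_endoFunctor_hoSpan adj F.p ((hQ F.Z x F.p).1 inferInstance) hp'
    have := isIso_hoSpan F.i hj'
    have h : IsIso ((toHo.map (endoFunctor R x) ≫ hoSpan F.p hp') ≫ hoSpan F.i hj') :=
      inferInstance
    simpa only [hoSpan, Category.assoc] using h
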